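/- **Setting.** Let $G$ be the graph with vertices $(j,R),(j,S),(j,T)$, $j\in\mathbb Z$, and edges $(j,S)(j,R)$, $(j,S)(j,T)$, $(j,S)(j-1,T)$. The arc set is $D(G)=\mathbb Z\times D(M)$ with $D(M)=\{e_0,e_+,e_-,\bar e_0,\bar e_+,\bar e_-\}$, where $(j,e_0):(j,S)\to(j,R)$, $(j,e_+):(j,S)\to(j,T)$, $(j,e_-):(j,S)\to(j-1,T)$, $(j,\bar e_0):(j,R)\to(j,S)$, $(j,\bar e_+):(j,T)\to(j,S)$, $(j,\bar e_-):(j,T)\to(j+1,S)$. For an arc $e$ let $o(e),t(e)$ be its origin and terminus and $\bar e$ the inverse arc. Let $0<p,q<1$ and $0<r\le 1$. The underlying random walk moves along the arcs $(j,e_0),(j,e_+),(j,e_-),(j,\bar e_0),(j,\bar e_+),(j,\bar e_-)$ with probabilities $1-r,\ rp,\ r(1-p),\ 1,\ q,\ 1-q$, written $p(e)$. The induced Szegedy walk is $$(U\psi)(e)=\sum_{f:\,t(f)=o(e)}\bigl(2\sqrt{p(e)p(\bar f)}-\delta_{e,\bar f}\bigr)\psi(f)\qquad\text{on }\ell^2(D(G)).$$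 For an initial state $\Psi_0\in\ell^2(D(G))$, $\|\Psi_0\|=1$, let $P(X_n=j)=\sum_{a\in D(M)}|(U^n\Psi_0)(j,a)|^2$ (this is a probability distribution on $\mathbb Z$). For the mixed initial state, $\Psi_0$ is drawn uniformly from the six states $\delta_{(0,a)}$, $a\in D(M)$. The pseudo velocity is $\inf\{x\in\mathbb R:\lim_{n\to\infty} P(|X_n/n|<x)=1\}$. Let $\lambda_0,\lambda_1\in[0,1]$ be given by $\lambda_0^2=1-r(\sqrt{p(1-q)}+\sqrt{(1-p)q})^2$ and $\lambda_1^2=1-r(\sqrt{p(1-q)}-\sqrt{(1-p)q})^2$. They are the edges of the spectrum of the random walk: its symmetrized transition operator $J$ on $\ell^2(V(G))$, $(Jf)(u)=\sum_{e:\,t(e)=u}\sqrt{p(e)p(\bar e)}\,f(o(e))$, has spectrum $[-\lambda_1,-\lambda_0]\cup\{0\}\cup[\lambda_0,\lambda_1]$. Put $\theta_i=\arccos\lambda_i$ and $\kappa=\tfrac12\sin(\theta_0-\theta_1)$. **Theorem.** (1) The pseudo velocity of the walk is $\kappa$. That is, $\kappa$ is the infimum of all $x$ such that $\lim_n P(|X_n/n|<x)=1$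 for every initial state $\Psi_0\in\ell^2(D(G))$ with $\|\Psi_0\|=1$. Moreover, the pseudo velocity equals $\kappa$ for each individual finitely supported initial state $\Psi_0$ that does not lie in the localized subspace, i.e. $U^2\Psi_0\ne-\Psi_0$, and also for the mixed initial state. (2) Let $r<1$ and let the walk start from the mixed initial state. Then $X_n/n$ converges weakly to the probability measure $$\tfrac13\delta_0+\tfrac23\{\gamma_-(x)+\gamma_+(x)\}\cdot 2f_K\bigl(2x;\sqrt{1-\lambda_0^2}\bigr)\mathbf 1_{\{|x|<\kappa\}}\,dx$$ and $P(X_n/n<y)$ converges to its mass on $(-\infty,y)$ for every $y\neq0$. Here $$f_K(x;k)=\frac{\sqrt{1-k^2}}{\pi(1-x^2)\sqrt{k^2-x^2}}\mathbf 1_{(-k,k)}(x),$$ $$\gamma_\pm(x)=\sqrt{\frac{1\pm\sqrt{1+(1-\lambda_1^2)\eta(x)/u(x)^2}+(1-\lambda_1^2)\zeta_\mp(x)/(\lambda_0^2u(x))}{2\,(1+(1-\lambda_1^2)\eta(x)/u(x)^2)}},$$ with $u(x)=1-\lambda_0^2-4x^2$, $\eta(x)=8(1-2\lambda_0^2)x^2-(1+\lambda_1^2-2\lambda_0^2)$,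 $\zeta_\pm(x)=4(2\lambda_0^2-1)x^2+\lambda_1^2\pm\sqrt{\phi(x)}$ and $\phi(x)=16x^4-8\{\lambda_1^2(1-\lambda_0^2)+\lambda_0^2(1-\lambda_1^2)\}x^2+(\lambda_1^2-\lambda_0^2)^2$. Moreover the following are equivalent: (a) the underlying random walk is recurrent; (b) $\lambda_1=1$; (c) $\gamma_-(x)=0$ for all $|x|<\kappa$; (d) $\gamma_+(x)=1$ for all $|x|<\kappa$. -/

import Mathlib

open MeasureTheory Filter Topology

noncomputable section

namespace Magnifier

/-! ### The magnifier graph -/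

/-- The vertices of the finite quotient graph. -/
inductive V0 : Type
  | R | S | T
  deriving DecidableEq

instance : Fintype V0 := ⟨{.R, .S, .T}, fun v => by cases v <;> simp⟩

/-- The six arcs of the finite quotient graph: `e0 : S → R`, `ep, em : S → T`, and their
inverses `e0bar`, `epbar`, `embar`. -/
inductive A0 : Type
  | e0 | ep | em | e0bar | epbar | embar
  deriving DecidableEq

instance : Fintype A0 :=
  ⟨{.e0, .ep, .em, .e0bar, .epbar, .embar}, fun a => by cases a <;> simp⟩

/-- Vertices of the magnifier graph `G`. -/
abbrev Vert : Type := ℤ × V0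

/-- Arcs of the magnifier graph `G`. The arc `(j, a)` starts in the `j`-th cell. -/
abbrev Arc : Type := ℤ × A0

/-- Origin of an arc of the quotient graph. -/
def A0.src : A0 → V0
  | .e0 => .S
  | .ep => .S
  | .em => .S
  | .e0bar => .R
  | .epbar => .T
  | .embar => .T

/-- Origin of an arc of `G`. -/
def org (e : Arc) : Vert := (e.1, e.2.src)

/-- Terminus of an arc of `G`: `(j, em)` leads from `(j, S)` to `(j - 1, T)` and `(j, embar)` from
`(j, T)` to `(j + 1, S)`; all the other arcs stay in their cell. -/
def ter : Arc → Vert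
  | (j, .e0) => (j, .R)
  | (j, .ep) => (j, .T)
  | (j, .em) => (j - 1, .T)
  | (j, .e0bar) => (j, .S)
  | (j, .epbar) => (j, .S)
  | (j, .embar) => (j + 1, .S)

/-- The inverse arc. -/
def bar : Arc → Arc
  | (j, .e0) => (j, .e0bar)
  | (j, .ep) => (j, .epbar)
  | (j, .em) => (j - 1, .embar)
  | (j, .e0bar) => (j, .e0)
  | (j, .epbar) => (j, .ep)
  | (j, .embar) => (j + 1, .em)

theorem bar_bar (e : Arc) : bar (bar e) = e := by
  obtain ⟨j, a⟩ := e
  cases a <;> simp [bar]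

theorem org_bar (e : Arc) : org (bar e) = ter e := by
  obtain ⟨j, a⟩ := e
  cases a <;> simp [bar, org, ter, A0.src]

/-- The arcs with a given origin. -/
def outArcs (v : Vert) : Finset Arc :=
  (Finset.univ.filter fun a : A0 => a.src = v.2).image fun a => (v.1, a)

/-- The arcs with a given terminus. -/
def inArcs (v : Vert) : Finset Arc := (outArcs v).image bar

theorem mem_outArcs (v : Vert) (e : Arc) : e ∈ outArcs v ↔ org e = v := by
  obtain ⟨j, a⟩ := e
  obtain ⟨i, w⟩ := v
  simp [outArcs, org, eq_comm, and_comm]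

theorem mem_inArcs (v : Vert) (e : Arc) : e ∈ inArcs v ↔ ter e = v := by
  simp only [inArcs, Finset.mem_image, mem_outArcs]
  constructor
  · rintro ⟨f, hf, rfl⟩
    rw [← org_bar, bar_bar, hf]
  · intro h
    exact ⟨bar e, by rw [org_bar, h], bar_bar e⟩

/-! ### The underlying random walk -/

/-- The probability with which the walker at the origin of an arc moves along it. -/
def prob (p q r : ℝ) (e : Arc) : ℝ :=
  match e.2 with
  | .e0bar => 1
  | .e0 => 1 - r
  | .ep => r * p
  | .em => r * (1 - p)
  | .epbar => q
  | .embar => 1 - q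

/-- `avoidProb p q r v n u` is the probability that the random walk started at `u` does not visit
`v` at any of the times `1, …, n`. -/
def avoidProb (p q r : ℝ) (v : Vert) : ℕ → Vert → ℝ
  | 0, _ => 1
  | n + 1, u => ∑ e ∈ (outArcs u).filter (fun e => ter e ≠ v),
      prob p q r e * avoidProb p q r v n (ter e)

/-- The random walk is recurrent: from every vertex it returns to that vertex almost surely. -/
def Recurrent (p q r : ℝ) : Prop :=
  ∀ v : Vert, Tendsto (fun n => avoidProb p q r v n v) atTop (𝓝 0)

/-- The symmetrized transition operator of the random walk, on functions on the vertices. -/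
def symmTrans (p q r : ℝ) (f : Vert → ℂ) (u : Vert) : ℂ :=
  ∑ e ∈ inArcs u, (Real.sqrt (prob p q r e * prob p q r (bar e)) : ℂ) * f (org e)

/-- Inner edge of the spectrum of the random walk. -/
def lam0 (p q r : ℝ) : ℝ :=
  Real.sqrt (1 - r * (Real.sqrt (p * (1 - q)) + Real.sqrt ((1 - p) * q)) ^ 2)

/-- Outer edge of the spectrum of the random walk. -/
def lam1 (p q r : ℝ) : ℝ :=
  Real.sqrt (1 - r * (Real.sqrt (p * (1 - q)) - Real.sqrt ((1 - p) * q)) ^ 2)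

/-- `½ sin(θ₀ - θ₁)` with `θᵢ = arccos λᵢ`. -/
def kappa (p q r : ℝ) : ℝ :=
  1 / 2 * Real.sin (Real.arccos (lam0 p q r) - Real.arccos (lam1 p q r))

/-! ### The induced Szegedy walk -/

/-- The time evolution operator of the Szegedy walk, on functions on the arcs. -/
def szegedy (p q r : ℝ) (ψ : Arc → ℂ) (e : Arc) : ℂ :=
  ∑ f ∈ inArcs (org e),
    (((2 * Real.sqrt (prob p q r e * prob p q r (bar f)) - if e = bar f then 1 else 0) : ℝ) : ℂ)
      * ψ f

/-- The probability of finding the quantum walker in the `j`-th cell at time `n`. -/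
def findProb (p q r : ℝ) (Ψ : Arc → ℂ) (n : ℕ) (j : ℤ) : ℝ :=
  ∑ a : A0, ‖((szegedy p q r)^[n] Ψ) (j, a)‖ ^ 2

/-- The same for the mixed initial state: the initial state is drawn uniformly from the six
states `δ_{(0, a)}`. -/
def mixedProb (p q r : ℝ) (n : ℕ) (j : ℤ) : ℝ :=
  ∑ a : A0, 1 / 6 * findProb p q r (Pi.single ((0, a) : Arc) 1) n j

/-- The law of `X_n / n` on `ℝ`, where `X_n` has the probability mass function `m n` on `ℤ`. -/
def scaledLaw (m : ℕ → ℤ → ℝ) (n : ℕ) : Measure ℝ :=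
  Measure.sum fun j : ℤ => ENNReal.ofReal (m n j) • Measure.dirac ((j : ℝ) / (n : ℝ))

/-- `lim P(|X_n / n| < x) = 1`. -/
def EventuallyWithin (m : ℕ → ℤ → ℝ) (x : ℝ) : Prop :=
  Tendsto (fun n => scaledLaw m n {y : ℝ | |y| < x}) atTop (𝓝 1)

/-- `c` is the pseudo velocity `inf {x | lim P(|X_n / n| < x) = 1}`. -/
def IsPseudoVelocity (m : ℕ → ℤ → ℝ) (c : ℝ) : Prop :=
  IsGLB {x : ℝ | EventuallyWithin m x} c

/-! ### The limit distribution -/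

/-- Konno's density function. -/
def konno (x k : ℝ) : ℝ :=
  Set.indicator (Set.Ioo (-k) k)
    (fun x => Real.sqrt (1 - k ^ 2) / (Real.pi * (1 - x ^ 2) * Real.sqrt (k ^ 2 - x ^ 2))) x

def uFun (l0 x : ℝ) : ℝ := (1 - l0 ^ 2) - 4 * x ^ 2

def phiFun (l1 l0 x : ℝ) : ℝ :=
  16 * x ^ 4 - 8 * (l1 ^ 2 * (1 - l0 ^ 2) + l0 ^ 2 * (1 - l1 ^ 2)) * x ^ 2
    + (l1 ^ 2 - l0 ^ 2) ^ 2

def etaFun (l1 l0 x : ℝ) : ℝ := 8 * (1 - 2 * l0 ^ 2) * x ^ 2 - (1 + l1 ^ 2 - 2 * l0 ^ 2)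

/-- `ζ_±`, for the sign `s = ±1`. -/
def zetaFun (s l1 l0 x : ℝ) : ℝ :=
  4 * (2 * l0 ^ 2 - 1) * x ^ 2 + l1 ^ 2 + s * Real.sqrt (phiFun l1 l0 x)

/-- `γ_±`, for the sign `s = ±1`. -/
def gammaFun (s x l1 l0 : ℝ) : ℝ :=
  Real.sqrt
    ((1 + s * Real.sqrt (1 + (1 - l1 ^ 2) * etaFun l1 l0 x / uFun l0 x ^ 2)
        + (1 - l1 ^ 2) * zetaFun (-s) l1 l0 x / (l0 ^ 2 * uFun l0 x))
      / (2 * (1 + (1 - l1 ^ 2) * etaFun l1 l0 x / uFun l0 x ^ 2)))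

/-- The density of the absolutely continuous part, before the factor `2/3`. -/
def waveDensity (p q r x : ℝ) : ℝ :=
  Set.indicator {x : ℝ | |x| < kappa p q r}
    (fun x => (gammaFun (-1) x (lam1 p q r) (lam0 p q r)
        + gammaFun 1 x (lam1 p q r) (lam0 p q r))
      * (2 * konno (2 * x) (Real.sqrt (1 - lam0 p q r ^ 2)))) x

/-- The limit law `(1/3) δ₀ + (2/3) (γ₋ + γ₊) 2 f_K 1_{|x| < κ} dx`. -/
def limitLaw (p q r : ℝ) : Measure ℝ :=
  ENNReal.ofReal (1 / 3) • Measure.dirac 0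
    + volume.withDensity fun x => ENNReal.ofReal (2 / 3 * waveDensity p q r x)

end Magnifier

end

noncomputable section
namespace Magnifier

/-! ### Explicit form of the walk -/

/-! Translation invariance splits the walk into 6×6 unitaries `fstep K z`, z = e^{iθ}, acting on the
Fourier transform. One step exchanges the arcs leaving the vertices S with their inverses, so on
each half the squared walk W is, up to sign, a product of two reflections. It is therefore -1 off a
plane, while on the plane its eigenvalues are e^{±iΩ}. This gives (W + 1)(W² - 2 cos Ω W + 1) = 0
with cos Ω = a + b cos θ (`fstep2_cubic`): a flat band, which carries the localized states, and two
moving bands with group velocities ±v, where v = Ω'/2 because W is two steps.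

By Parseval the characteristic function of X_n/n at ξ is an average over θ of scalar products of the
states evolved at θ and at θ + ξ/n (`charFun_cellProb`). In the limit different bands are
orthogonal, and each band contributes its weight times e^{iξ · velocity} (`tendsto_sip_iterate`).
Dominated convergence and Lévy's theorem then yield weak convergence to the image of the band
weights under the velocities 0, v, -v (`waveLaw`).

With α = θ₀ + θ₁ and β = θ₀ - θ₁ one has a = cos α cos β and b = sin α sin β, so the dispersion
relation is a spherical law of cosines. The law of sines gives |v| ≤ ½ sin β = κ, and this bound is
the supremum (`HasAngles.abs_velocity_le`, `HasAngles.exists_lt_velocity`). The transform of a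
finitely supported state is analytic in θ, so its moving part cannot vanish on an open set of fast θ
unless U²Ψ = -Ψ (`isPseudoVelocity_of_finite_support`). Arbitrary states are approximated by
finitely supported ones, which preserves the upper bound (`eventuallyWithin_of_lp`).

For the mixed state every band has weight 1/3, since all eigenspaces have dimension two
(`sum_normSq_part`). The density comes from the substitution x = v(θ). On (0, π) the sign of
`signedRoot`, which is that of v', separates a rising from a falling branch, and γ₋, γ₊ times
Konno's density are the reciprocals of |v'| on them, up to constants
(`HasEdges.gammaFun_mul_konno_mul_deriv`). If λ₁ = 1 the rising branch is empty. Now λ₁ = 1 means p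
= q, the absence of drift; its equivalence with recurrence is proved with subharmonic functions. The
spectrum of J follows from J³ = MJ, where M is affine in the nearest-neighbour hopping operator,
together with truncated plane waves. -/

theorem outArcs_S (j : ℤ) : outArcs (j, .S) = {(j, .e0), (j, .ep), (j, .em)} := by
  have h : (Finset.univ.filter fun a : A0 => a.src = V0.S) = {.e0, .ep, .em} := by decide
  simp [outArcs, h]

theorem outArcs_R (j : ℤ) : outArcs (j, .R) = {(j, .e0bar)} := by
  have h : (Finset.univ.filter fun a : A0 => a.src = V0.R) = {.e0bar} := by decide
  simp [outArcs, h]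

theorem outArcs_T (j : ℤ) : outArcs (j, .T) = {(j, .epbar), (j, .embar)} := by
  have h : (Finset.univ.filter fun a : A0 => a.src = V0.T) = {.epbar, .embar} := by decide
  simp [outArcs, h]

theorem sum_inArcs_S {M : Type*} [AddCommMonoid M] (j : ℤ) (g : Arc → M) :
    ∑ f ∈ inArcs (j, .S), g f = g (j, .e0bar) + g (j, .epbar) + g (j - 1, .embar) := by
  rw [inArcs, outArcs_S]
  simp [bar, add_assoc]

theorem sum_inArcs_R {M : Type*} [AddCommMonoid M] (j : ℤ) (g : Arc → M) :
    ∑ f ∈ inArcs (j, .R), g f = g (j, .e0) := by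
  rw [inArcs, outArcs_R]
  simp [bar]

theorem sum_inArcs_T {M : Type*} [AddCommMonoid M] (j : ℤ) (g : Arc → M) :
    ∑ f ∈ inArcs (j, .T), g f = g (j, .ep) + g (j + 1, .em) := by
  rw [inArcs, outArcs_T]
  simp [bar]

theorem sum_A0 {M : Type*} [AddCommMonoid M] (g : A0 → M) :
    ∑ a, g a = g .e0 + g .ep + g .em + (g .e0bar + (g .epbar + g .embar)) := by
  have h : (Finset.univ : Finset A0) = {.e0, .ep, .em, .e0bar, .epbar, .embar} := by decide
  rw [h]
  simp [add_assoc]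

/-- The square roots of the transition probabilities: `s0, sp, sm` at the vertices `S` and
`tp, tm` at the vertices `T`. -/
structure Coin where
  s0 : ℝ
  sp : ℝ
  sm : ℝ
  tp : ℝ
  tm : ℝ
  sq_s : s0 ^ 2 + sp ^ 2 + sm ^ 2 = 1
  sq_t : tp ^ 2 + tm ^ 2 = 1
  sp_pos : 0 < sp
  sm_pos : 0 < sm
  tp_pos : 0 < tp
  tm_pos : 0 < tm

/-- The coin of the walk with parameters `p, q, r`. -/
def coin {p q r : ℝ} (hp : p ∈ Set.Ioo (0 : ℝ) 1) (hq : q ∈ Set.Ioo (0 : ℝ) 1)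
    (hr : r ∈ Set.Ioc (0 : ℝ) 1) : Coin where
  s0 := √(1 - r)
  sp := √(r * p)
  sm := √(r * (1 - p))
  tp := √q
  tm := √(1 - q)
  sq_s := by
    have h0 : 0 ≤ 1 - r := by linarith [hr.2]
    have h1 : 0 ≤ r * p := mul_nonneg hr.1.le hp.1.le
    have h2 : 0 ≤ r * (1 - p) := mul_nonneg hr.1.le (by linarith [hp.2])
    rw [Real.sq_sqrt h0, Real.sq_sqrt h1, Real.sq_sqrt h2]
    ring
  sq_t := by
    rw [Real.sq_sqrt hq.1.le, Real.sq_sqrt (by linarith [hq.2])]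
    ring
  sp_pos := Real.sqrt_pos.2 (mul_pos hr.1 hp.1)
  sm_pos := Real.sqrt_pos.2 (mul_pos hr.1 (by linarith [hp.2]))
  tp_pos := Real.sqrt_pos.2 hq.1
  tm_pos := Real.sqrt_pos.2 (by linarith [hq.2])

/-- One step of the walk, in coordinates. -/
def step (K : Coin) (ψ : Arc → ℂ) : Arc → ℂ
  | (j, .e0) => 2 * K.s0 * (K.s0 * ψ (j, .e0bar) + K.sp * ψ (j, .epbar)
      + K.sm * ψ (j - 1, .embar)) - ψ (j, .e0bar)
  | (j, .ep) => 2 * K.sp * (K.s0 * ψ (j, .e0bar) + K.sp * ψ (j, .epbar)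
      + K.sm * ψ (j - 1, .embar)) - ψ (j, .epbar)
  | (j, .em) => 2 * K.sm * (K.s0 * ψ (j, .e0bar) + K.sp * ψ (j, .epbar)
      + K.sm * ψ (j - 1, .embar)) - ψ (j - 1, .embar)
  | (j, .e0bar) => ψ (j, .e0)
  | (j, .epbar) => 2 * K.tp * (K.tp * ψ (j, .ep) + K.tm * ψ (j + 1, .em)) - ψ (j, .ep)
  | (j, .embar) => 2 * K.tm * (K.tp * ψ (j, .ep) + K.tm * ψ (j + 1, .em)) - ψ (j + 1, .em)

theorem szegedy_eq_step {p q r : ℝ} (hp : p ∈ Set.Ioo (0 : ℝ) 1) (hq : q ∈ Set.Ioo (0 : ℝ) 1)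
    (hr : r ∈ Set.Ioc (0 : ℝ) 1) : szegedy p q r = step (coin hp hq hr) := by
  have h0 : 0 ≤ 1 - r := by linarith [hr.2]
  have h1 : 0 ≤ r * p := mul_nonneg hr.1.le hp.1.le
  have h2 : 0 ≤ r * (1 - p) := mul_nonneg hr.1.le (by linarith [hp.2])
  have h4 : 0 ≤ 1 - q := by linarith [hq.2]
  ext ψ ⟨j, a⟩
  cases a <;>
    simp only [szegedy, org, A0.src, sum_inArcs_S, sum_inArcs_R, sum_inArcs_T, bar, step, coin,
      prob, Real.sqrt_mul h0, Real.sqrt_mul h1, Real.sqrt_mul h2, Real.sqrt_mul hq.1.le,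
      Real.sqrt_mul h4, Prod.mk.injEq, and_false, reduceCtorEq, if_true,
      if_false, mul_one, one_mul, Real.sqrt_one, sub_add_cancel, add_sub_cancel_right] <;>
    push_cast <;> ring

/-! ### Conservation of energy -/

/-- The squared `ℓ²` norm of a function on the arcs. -/
def energy (ψ : Arc → ℂ) : ENNReal := ∑' j : ℤ, ∑ a, ENNReal.ofReal (‖ψ (j, a)‖ ^ 2)

/-- The map is the reflection 2ss* - 1 in the unit vector s = (s0, sp, sm), hence an isometry. -/
theorem normSq_reflect_three (K : Coin) (x y z : ℂ) :
    ‖2 * K.s0 * (K.s0 * x + K.sp * y + K.sm * z) - x‖ ^ 2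
      + ‖2 * K.sp * (K.s0 * x + K.sp * y + K.sm * z) - y‖ ^ 2
      + ‖2 * K.sm * (K.s0 * x + K.sp * y + K.sm * z) - z‖ ^ 2
      = ‖x‖ ^ 2 + ‖y‖ ^ 2 + ‖z‖ ^ 2 := by
  have h := K.sq_s
  simp only [← Complex.normSq_eq_norm_sq, Complex.normSq_apply]
  simp
  linear_combination (4 * ((K.s0 * x.re + K.sp * y.re + K.sm * z.re) ^ 2
    + (K.s0 * x.im + K.sp * y.im + K.sm * z.im) ^ 2)) * h

theorem normSq_reflect_two (K : Coin) (x y : ℂ) :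
    ‖2 * K.tp * (K.tp * x + K.tm * y) - x‖ ^ 2 + ‖2 * K.tm * (K.tp * x + K.tm * y) - y‖ ^ 2
      = ‖x‖ ^ 2 + ‖y‖ ^ 2 := by
  have h := K.sq_t
  simp only [← Complex.normSq_eq_norm_sq, Complex.normSq_apply]
  simp
  linear_combination (4 * ((K.tp * x.re + K.tm * y.re) ^ 2
    + (K.tp * x.im + K.tm * y.im) ^ 2)) * h

/-- The reflections at the vertices S and T of one cell preserve the energy of the arcs entering
them. Two of these arcs are indexed by neighbouring cells, so the balance closes only after summing
over all cells and shifting the index. -/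
theorem energy_step (K : Coin) (ψ : Arc → ℂ) : energy (step K ψ) = energy ψ := by
  have key : ∀ j : ℤ, ∑ a, ENNReal.ofReal (‖step K ψ (j, a)‖ ^ 2) =
      (ENNReal.ofReal (‖ψ (j, .e0)‖ ^ 2) + ENNReal.ofReal (‖ψ (j, .ep)‖ ^ 2)
        + ENNReal.ofReal (‖ψ (j, .e0bar)‖ ^ 2) + ENNReal.ofReal (‖ψ (j, .epbar)‖ ^ 2))
      + ENNReal.ofReal (‖ψ (j + 1, .em)‖ ^ 2) + ENNReal.ofReal (‖ψ (j - 1, .embar)‖ ^ 2) := by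
    intro j
    have h3 := normSq_reflect_three K (ψ (j, .e0bar)) (ψ (j, .epbar)) (ψ (j - 1, .embar))
    have h2 := normSq_reflect_two K (ψ (j, .ep)) (ψ (j + 1, .em))
    rw [← ENNReal.ofReal_sum_of_nonneg (fun _ _ => by positivity), sum_A0]
    simp only [step]
    repeat rw [← ENNReal.ofReal_add (by positivity) (by positivity)]
    congr 1
    linarith
  simp only [energy]
  simp_rw [key, sum_A0]
  simp only [ENNReal.tsum_add]
  have e1 : ∑' j : ℤ, ENNReal.ofReal (‖ψ (j + 1, .em)‖ ^ 2) = _ :=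
    (Equiv.addRight (1 : ℤ)).tsum_eq (fun j => ENNReal.ofReal (‖ψ (j, .em)‖ ^ 2))
  have e2 : ∑' j : ℤ, ENNReal.ofReal (‖ψ (j - 1, .embar)‖ ^ 2) = _ :=
    (Equiv.subRight (1 : ℤ)).tsum_eq (fun j => ENNReal.ofReal (‖ψ (j, .embar)‖ ^ 2))
  rw [e1, e2]
  ring

theorem energy_iterate (K : Coin) (ψ : Arc → ℂ) (n : ℕ) : energy ((step K)^[n] ψ) = energy ψ := by
  induction n generalizing ψ with
  | zero => rfl
  | succ n ih => rw [Function.iterate_succ_apply, ih, energy_step]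

theorem energy_eq_tsum (ψ : Arc → ℂ) : energy ψ = ∑' e, ENNReal.ofReal (‖ψ e‖ ^ 2) := by
  simp only [energy, ENNReal.tsum_prod', tsum_fintype]

theorem energy_lp (Ψ : lp (fun _ : Arc => ℂ) 2) : energy Ψ = ENNReal.ofReal (‖Ψ‖ ^ 2) := by
  have h := lp.hasSum_norm (p := 2) (by norm_num) Ψ
  norm_num at h
  rw [energy_eq_tsum, ← h.tsum_eq, ENNReal.ofReal_tsum_of_nonneg (fun _ => by positivity) h.summable]

/-! ### Linearity and finite propagation -/

theorem step_add (K : Coin) (ψ φ : Arc → ℂ) : step K (ψ + φ) = step K ψ + step K φ := by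
  ext ⟨j, a⟩
  cases a <;> simp only [step, Pi.add_apply] <;> ring

theorem iterate_step_add (K : Coin) (ψ φ : Arc → ℂ) (n : ℕ) :
    (step K)^[n] (ψ + φ) = (step K)^[n] ψ + (step K)^[n] φ := by
  induction n generalizing ψ φ with
  | zero => rfl
  | succ n ih => simp only [Function.iterate_succ_apply, step_add, ih]

theorem finite_support_step (K : Coin) {ψ : Arc → ℂ} (h : ψ.support.Finite) :
    (step K ψ).support.Finite := by
  have hsub : (step K ψ).support ⊆ ⋃ f ∈ ψ.support, (↑(outArcs (ter f)) : Set Arc) := by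
    rintro ⟨j, a⟩ he
    by_contra hn
    simp only [Set.mem_iUnion, Finset.mem_coe, mem_outArcs, not_exists, Function.mem_support,
      ne_eq] at hn
    have hz : ∀ f, ter f = org (j, a) → ψ f = 0 := fun f hf => by
      by_contra h0
      exact hn f h0 hf.symm
    apply he
    cases a
    case e0bar => simp [step, hz (j, .e0) rfl]
    case epbar | embar =>
      simp [step, hz (j, .ep) rfl, hz (j + 1, .em) (by simp [ter, org, A0.src])]
    all_goals
      simp [step, hz (j, .e0bar) rfl, hz (j, .epbar) rfl,
        hz (j - 1, .embar) (by simp [ter, org, A0.src])]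
  exact (h.biUnion fun f _ => (outArcs (ter f)).finite_toSet).subset hsub

theorem finite_support_iterate (K : Coin) {ψ : Arc → ℂ} (h : ψ.support.Finite) (n : ℕ) :
    ((step K)^[n] ψ).support.Finite := by
  induction n generalizing ψ with
  | zero => exact h
  | succ n ih => exact ih (finite_support_step K h)

open ComplexConjugate

/-! ### The walk on the fibres of the Fourier decomposition -/

/-- The standard sesquilinear form on functions on `A0`. -/
def sip (x y : A0 → ℂ) : ℂ := ∑ a, conj (x a) * y a

/-- The time evolution on the fibre over `z`, `|z| = 1`. -/
def fstep (K : Coin) (z : ℂ) : (A0 → ℂ) →ₗ[ℂ] (A0 → ℂ) where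
  toFun x := fun
    | .e0 => 2 * K.s0 * (K.s0 * x .e0bar + K.sp * x .epbar + K.sm * (z * x .embar)) - x .e0bar
    | .ep => 2 * K.sp * (K.s0 * x .e0bar + K.sp * x .epbar + K.sm * (z * x .embar)) - x .epbar
    | .em => 2 * K.sm * (K.s0 * x .e0bar + K.sp * x .epbar + K.sm * (z * x .embar))
        - z * x .embar
    | .e0bar => x .e0
    | .epbar => 2 * K.tp * (K.tp * x .ep + K.tm * (conj z * x .em)) - x .ep
    | .embar => 2 * K.tm * (K.tp * x .ep + K.tm * (conj z * x .em)) - conj z * x .em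
  map_add' x y := by
    ext a
    cases a <;> simp only [Pi.add_apply] <;> ring
  map_smul' c x := by
    ext a
    cases a <;> simp only [Pi.smul_apply, smul_eq_mul, RingHom.id_apply] <;> ring

theorem Coin.sq_s' (K : Coin) : (K.s0 : ℂ) ^ 2 + (K.sp : ℂ) ^ 2 + (K.sm : ℂ) ^ 2 = 1 := by
  exact_mod_cast congrArg (fun x : ℝ => (x : ℂ)) K.sq_s

theorem Coin.sq_t' (K : Coin) : (K.tp : ℂ) ^ 2 + (K.tm : ℂ) ^ 2 = 1 := by
  exact_mod_cast congrArg (fun x : ℝ => (x : ℂ)) K.sq_t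

theorem sip_fstep (K : Coin) {z : ℂ} (hz : z * conj z = 1) (x y : A0 → ℂ) :
    sip (fstep K z x) (fstep K z y) = sip x y := by
  have hs := K.sq_s'
  have ht := K.sq_t'
  simp only [sip, sum_A0, fstep, LinearMap.coe_mk, AddHom.coe_mk, map_sub, map_mul, map_add,
    Complex.conj_ofReal, Complex.conj_conj, map_ofNat]
  linear_combination
    (4 * (K.s0 * conj (x .e0bar) + K.sp * conj (x .epbar) + K.sm * (conj z * conj (x .embar)))
      * (K.s0 * y .e0bar + K.sp * y .epbar + K.sm * (z * y .embar))) * hs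
    + (4 * (K.tp * conj (x .ep) + K.tm * (z * conj (x .em)))
      * (K.tp * y .ep + K.tm * (conj z * y .em))) * ht
    + (conj (x .embar) * y .embar + conj (x .em) * y .em) * hz

/-- The scalar product of the two unit vectors whose reflections generate the squared walk. -/
def overlap (K : Coin) (z : ℂ) : ℂ := K.sp * K.tm - K.sm * K.tp * z

/-- Write X for the arcs leaving S and Y for their inverses. On X the squared walk is (2ss* - 1)(1 -
2nn*) with s = `vecSX` and n = `vecNX`; on Y it is the product in the opposite order, with `vecSY`
and `vecNY`. -/
def vecSX (K : Coin) : A0 → ℂ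
  | .e0 => K.s0
  | .ep => K.sp
  | .em => K.sm
  | _ => 0

def vecNX (K : Coin) (z : ℂ) : A0 → ℂ
  | .ep => K.tm
  | .em => -K.tp * z
  | _ => 0

def vecSY (K : Coin) (z : ℂ) : A0 → ℂ
  | .e0bar => K.s0
  | .epbar => K.sp
  | .embar => conj z * K.sm
  | _ => 0

def vecNY (K : Coin) : A0 → ℂ
  | .epbar => K.tm
  | .embar => -K.tp
  | _ => 0

theorem conj_overlap (K : Coin) (z : ℂ) :
    conj (overlap K z) = K.sp * K.tm - K.sm * K.tp * conj z := by
  simp [overlap]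

theorem fstep_vecSX (K : Coin) (z : ℂ) :
    fstep K z (vecSX K) = vecSY K z - (2 * conj (overlap K z)) • vecNY K := by
  have ht := K.sq_t'
  ext a
  cases a <;> simp [fstep, vecSX, vecSY, vecNY, conj_overlap]
  · linear_combination 2 * K.sp * ht
  · linear_combination 2 * conj z * K.sm * ht

theorem fstep_vecNX (K : Coin) {z : ℂ} (hz : z * conj z = 1) :
    fstep K z (vecNX K z) = -vecNY K := by
  ext a
  cases a <;> simp [fstep, vecNX, vecNY]
  · exact .inr (by linear_combination (-K.tp * K.tm) * hz)
  · linear_combination (-2 * K.tm ^ 2 * K.tp + K.tp) * hz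

theorem fstep_vecSY (K : Coin) {z : ℂ} (hz : z * conj z = 1) :
    fstep K z (vecSY K z) = vecSX K := by
  have hs := K.sq_s'
  ext a
  cases a <;> simp [fstep, vecSX, vecSY]
  · linear_combination 2 * K.s0 * hs + 2 * K.s0 * K.sm ^ 2 * hz
  · linear_combination 2 * K.sp * hs + 2 * K.sp * K.sm ^ 2 * hz
  · linear_combination 2 * K.sm * hs + (2 * K.sm ^ 3 - K.sm) * hz

theorem fstep_vecNY (K : Coin) (z : ℂ) :
    fstep K z (vecNY K) = (2 * overlap K z) • vecSX K - vecNX K z := by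
  ext a
  cases a <;> simp [fstep, vecSX, vecNX, vecNY, overlap] <;> ring

/-- The squared walk on the fibre over `z`. -/
def fstep2 (K : Coin) (z : ℂ) : (A0 → ℂ) →ₗ[ℂ] (A0 → ℂ) := fstep K z ∘ₗ fstep K z

/-- A product of two reflections differs from the identity only in the directions of the two mirror
normals; because of the overall sign this becomes a statement about W + 1. -/
theorem fstep2_add_self (K : Coin) {z : ℂ} (hz : z * conj z = 1) (x : A0 → ℂ) :
    ∃ c₁ c₂ c₃ c₄ : ℂ, fstep2 K z x + x =
      c₁ • vecSX K + c₂ • vecNX K z + c₃ • vecSY K z + c₄ • vecNY K := by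
  have hs := K.sq_s'
  have ht := K.sq_t'
  set u := fstep K z x with hu
  -- Each coefficient is ±2 times the scalar product with the reflecting vector, taken before the
  -- step for the first reflection and after it for the second.
  refine ⟨2 * (K.s0 * u .e0bar + K.sp * u .epbar + K.sm * (z * u .embar)),
    2 * (K.tm * x .ep - K.tp * (conj z * x .em)),
    2 * (K.s0 * x .e0bar + K.sp * x .epbar + K.sm * (z * x .embar)),
    -2 * (K.tm * u .ep - K.tp * (conj z * u .em)), ?_⟩
  have h1 : fstep2 K z x = fstep K z u := rfl
  rw [h1]
  have u1 : u .e0bar = x .e0 := rfl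
  have u2 : u .epbar = 2 * K.tp * (K.tp * x .ep + K.tm * (conj z * x .em)) - x .ep := rfl
  have u3 : u .embar = 2 * K.tm * (K.tp * x .ep + K.tm * (conj z * x .em)) - conj z * x .em := rfl
  have u4 : u .e0 = 2 * K.s0 * (K.s0 * x .e0bar + K.sp * x .epbar + K.sm * (z * x .embar))
    - x .e0bar := rfl
  have u5 : u .ep = 2 * K.sp * (K.s0 * x .e0bar + K.sp * x .epbar + K.sm * (z * x .embar))
    - x .epbar := rfl
  have u6 : u .em = 2 * K.sm * (K.s0 * x .e0bar + K.sp * x .epbar + K.sm * (z * x .embar))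
    - z * x .embar := rfl
  ext a
  cases a <;> simp [fstep, vecSX, vecNX, vecSY, vecNY]
  · linear_combination -u1
  · linear_combination -u2 - 2 * x .ep * ht
  · linear_combination -z * u3 + (-2 * x .em * K.tm ^ 2 - 2 * x .em * K.tp ^ 2 + x .em) * hz
      - 2 * x .em * ht
  · linear_combination u4
  · linear_combination u5 + 2 * u .ep * ht
  · linear_combination conj z * u6 + 2 * (conj z * u .em) * ht - x .embar * hz

/-- This is Cayley–Hamilton: on the two vectors of either half, W acts by a 2×2 matrix with trace 2
- 4|w|² = 2m and determinant 1. Linear independence of the vectors is not needed. -/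
theorem fstep2_quadratic_of_span (K : Coin) {z m : ℂ} (hz : z * conj z = 1)
    (hm : m = 1 - 2 * (overlap K z * conj (overlap K z))) (c₁ c₂ c₃ c₄ : ℂ) {y : A0 → ℂ}
    (hy : y = c₁ • vecSX K + c₂ • vecNX K z + c₃ • vecSY K z + c₄ • vecNY K) :
    fstep2 K z (fstep2 K z y) - (2 * m) • fstep2 K z y + y = 0 := by
  set w := overlap K z
  have hSX : fstep2 K z (vecSX K) = (1 - 4 * (w * conj w)) • vecSX K
      + (2 * conj w) • vecNX K z := by
    simp only [fstep2, LinearMap.comp_apply, fstep_vecSX, map_sub, map_smul, fstep_vecSY K hz,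
      fstep_vecNY]
    module
  have hNX : fstep2 K z (vecNX K z) = (-2 * w) • vecSX K + vecNX K z := by
    simp only [fstep2, LinearMap.comp_apply, fstep_vecNX K hz, map_neg, fstep_vecNY]
    module
  have hSY : fstep2 K z (vecSY K z) = vecSY K z - (2 * conj w) • vecNY K := by
    simp only [fstep2, LinearMap.comp_apply, fstep_vecSX, fstep_vecSY K hz]
    rfl
  have hNY : fstep2 K z (vecNY K) = (2 * w) • vecSY K z + (1 - 4 * (w * conj w)) • vecNY K := by
    simp only [fstep2, LinearMap.comp_apply, fstep_vecSX, map_sub, map_smul, fstep_vecNX K hz,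
      fstep_vecNY]
    module
  rw [hy, hm]
  simp only [map_add, map_sub, map_smul, hSX, hNX, hSY, hNY]
  module

/-- The squared walk satisfies `(W + 1) (W² - 2 m W + 1) = 0` on each fibre. -/
theorem fstep2_cubic (K : Coin) {z m : ℂ} (hz : z * conj z = 1)
    (hm : m = 1 - 2 * (overlap K z * conj (overlap K z))) (x : A0 → ℂ) :
    fstep2 K z (fstep2 K z (fstep2 K z x)) =
      (2 * m - 1) • fstep2 K z (fstep2 K z x) - (1 - 2 * m) • fstep2 K z x - x := by
  obtain ⟨c₁, c₂, c₃, c₄, h⟩ := fstep2_add_self K hz x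
  have h' := fstep2_quadratic_of_span K hz hm c₁ c₂ c₃ c₄ h
  simp only [map_add] at h'
  rw [← sub_eq_zero, ← h']
  module

theorem sip_fstep2 (K : Coin) {z : ℂ} (hz : z * conj z = 1) (x y : A0 → ℂ) :
    sip (fstep2 K z x) (fstep2 K z y) = sip x y := by
  simp only [fstep2, LinearMap.comp_apply, sip_fstep K hz]

theorem sip_self (x : A0 → ℂ) : sip x x = ((∑ a, ‖x a‖ ^ 2 : ℝ) : ℂ) := by
  simp [sip, Complex.conj_mul']

theorem sip_smul_smul (c d : ℂ) (x y : A0 → ℂ) : sip (c • x) (d • y) = conj c * d * sip x y := by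
  simp only [sip, Finset.mul_sum, Pi.smul_apply, smul_eq_mul, map_mul]
  exact Finset.sum_congr rfl fun a _ => by ring

theorem sip_sum_sum {ι κ : Type*} (s : Finset ι) (t : Finset κ) (x : ι → A0 → ℂ)
    (y : κ → A0 → ℂ) : sip (∑ i ∈ s, x i) (∑ j ∈ t, y j) = ∑ i ∈ s, ∑ j ∈ t, sip (x i) (y j) := by
  simp only [sip, Finset.sum_apply, map_sum, Finset.sum_mul_sum]
  rw [Finset.sum_comm]
  refine Finset.sum_congr rfl fun i _ => ?_
  rw [Finset.sum_comm]

theorem norm_sip_le (x y : A0 → ℂ) : ‖sip x y‖ ≤ (∑ a, ‖x a‖ ^ 2 + ∑ a, ‖y a‖ ^ 2) / 2 := by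
  rw [← Finset.sum_add_distrib, Finset.sum_div]
  refine (norm_sum_le _ _).trans (Finset.sum_le_sum fun a _ => ?_)
  rw [norm_mul, RCLike.norm_conj]
  nlinarith [sq_nonneg (‖x a‖ - ‖y a‖)]

/-! ### Spectral decomposition by interpolation -/

/-- The component of `x` in the eigenspace of `W` for `α`, if the eigenvalues are `α, β, γ`. -/
def eigenPart (W : (A0 → ℂ) →ₗ[ℂ] (A0 → ℂ)) (α β γ : ℂ) (x : A0 → ℂ) : A0 → ℂ :=
  ((α - β) * (α - γ))⁻¹ • (W (W x) - (β + γ) • W x + (β * γ) • x)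

/-- Up to a scalar, `eigenPart` is (W - β)(W - γ)x, and the cubic relation says that W - α
annihilates this vector. Lagrange interpolation at three distinct eigenvalues then recovers x from
its parts. -/
theorem apply_eigenPart {W : (A0 → ℂ) →ₗ[ℂ] (A0 → ℂ)} {α β γ : ℂ} {x : A0 → ℂ}
    (h : W (W (W x)) = (α + β + γ) • W (W x) - (α * β + β * γ + γ * α) • W x
      + (α * β * γ) • x) :
    W (eigenPart W α β γ x) = α • eigenPart W α β γ x := by
  simp only [eigenPart, map_smul, map_add, map_sub, h]
  module

theorem eigenPart_add_eigenPart_add_eigenPart (W : (A0 → ℂ) →ₗ[ℂ] (A0 → ℂ)) {α β γ : ℂ}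
    (hαβ : α ≠ β) (hβγ : β ≠ γ) (hγα : γ ≠ α) (x : A0 → ℂ) :
    eigenPart W α β γ x + eigenPart W β γ α x + eigenPart W γ α β x = x := by
  have h1 := sub_ne_zero.2 hαβ
  have h2 := sub_ne_zero.2 hβγ
  have h3 := sub_ne_zero.2 hγα
  have h1' := sub_ne_zero.2 hαβ.symm
  have h2' := sub_ne_zero.2 hβγ.symm
  have h3' := sub_ne_zero.2 hγα.symm
  simp only [eigenPart]
  match_scalars <;> field_simp <;> ring

theorem sip_eq_zero_of_eigen {W : (A0 → ℂ) →ₗ[ℂ] (A0 → ℂ)}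
    (hW : ∀ x y, sip (W x) (W y) = sip x y) {α β : ℂ} (hα : α * conj α = 1) (hαβ : α ≠ β)
    {x y : A0 → ℂ} (hx : W x = α • x) (hy : W y = β • y) : sip x y = 0 := by
  have h := hW x y
  rw [hx, hy, sip_smul_smul] at h
  by_contra h0
  apply hαβ
  have h1 : conj α * β = 1 := mul_right_cancel₀ h0 (by rw [h, one_mul])
  linear_combination β * hα - α * h1

/-! ### Dispersion relation -/

/-- The mean value of the dispersion relation `cos Ω = a + b cos θ`. -/
def Coin.a (K : Coin) : ℝ := 1 - 2 * (K.sp ^ 2 * K.tm ^ 2 + K.sm ^ 2 * K.tp ^ 2)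

/-- The amplitude of the dispersion relation `cos Ω = a + b cos θ`. -/
def Coin.b (K : Coin) : ℝ := 4 * (K.sp * K.sm * K.tp * K.tm)

theorem Coin.b_pos (K : Coin) : 0 < K.b := by
  have := K.sp_pos; have := K.sm_pos; have := K.tp_pos; have := K.tm_pos
  unfold Coin.b; positivity

/-- Here a ± b = 1 - 2(sp tm ∓ sm tp)². The upper bound is then clear, and the lower bound on a - b
is Cauchy–Schwarz. -/
theorem Coin.a_add_b_le (K : Coin) : K.a + K.b ≤ 1 := by
  unfold Coin.a Coin.b
  nlinarith [sq_nonneg (K.sp * K.tm - K.sm * K.tp)]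

theorem Coin.neg_one_le_a_sub_b (K : Coin) : -1 ≤ K.a - K.b := by
  have h1 : (K.sp * K.tm + K.sm * K.tp) ^ 2 ≤ (K.sp ^ 2 + K.sm ^ 2) * (K.tp ^ 2 + K.tm ^ 2) := by
    nlinarith [sq_nonneg (K.sp * K.tp - K.sm * K.tm)]
  rw [K.sq_t] at h1
  unfold Coin.a Coin.b
  nlinarith [sq_nonneg K.s0, K.sq_s]

/-- The cosine of the phase `Ω` of the squared walk. -/
def cosPhase (K : Coin) (θ : ℝ) : ℝ := K.a + K.b * Real.cos θ

/-- The phase of the squared walk on the fibre over `exp (iθ)`. -/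
def phase (K : Coin) (θ : ℝ) : ℝ := Real.arccos (cosPhase K θ)

/-- The group velocity of the walk. -/
def velocity (K : Coin) (θ : ℝ) : ℝ :=
  K.b / 2 * Real.sin θ / √(1 - cosPhase K θ ^ 2)

theorem abs_cos_lt_one {θ : ℝ} (h : Real.sin θ ≠ 0) : |Real.cos θ| < 1 := by
  rw [← sq_lt_one_iff_abs_lt_one]
  have := Real.sin_sq_add_cos_sq θ
  have : 0 < Real.sin θ ^ 2 := by positivity
  linarith

/-- Away from the null set sin θ = 0 the cosine of the phase lies strictly between -1 and 1. There
the three eigenvalues -1, e^{±iΩ} are distinct and the phase is differentiable. -/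
theorem cosPhase_lt_one (K : Coin) {θ : ℝ} (h : Real.sin θ ≠ 0) : cosPhase K θ < 1 := by
  have := (abs_lt.1 (abs_cos_lt_one h)).2
  unfold cosPhase
  nlinarith [K.a_add_b_le, K.b_pos]

theorem neg_one_lt_cosPhase (K : Coin) {θ : ℝ} (h : Real.sin θ ≠ 0) : -1 < cosPhase K θ := by
  have := (abs_lt.1 (abs_cos_lt_one h)).1
  unfold cosPhase
  nlinarith [K.neg_one_le_a_sub_b, K.b_pos]

theorem cosPhase_sq_lt_one (K : Coin) {θ : ℝ} (h : Real.sin θ ≠ 0) : cosPhase K θ ^ 2 < 1 := by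
  have h1 := cosPhase_lt_one K h
  have h2 := neg_one_lt_cosPhase K h
  nlinarith

theorem cos_phase (K : Coin) {θ : ℝ} (h : Real.sin θ ≠ 0) :
    Real.cos (phase K θ) = cosPhase K θ :=
  Real.cos_arccos (neg_one_lt_cosPhase K h).le (cosPhase_lt_one K h).le

theorem sin_phase_pos (K : Coin) {θ : ℝ} (h : Real.sin θ ≠ 0) : 0 < Real.sin (phase K θ) := by
  rw [phase, Real.sin_arccos]
  exact Real.sqrt_pos.2 (by linarith [cosPhase_sq_lt_one K h])

@[fun_prop]
theorem continuous_cosPhase (K : Coin) : Continuous (cosPhase K) := by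
  unfold cosPhase; fun_prop

@[fun_prop]
theorem continuous_phase (K : Coin) : Continuous (phase K) := by
  unfold phase; exact Real.continuous_arccos.comp (continuous_cosPhase K)

/-- The factor 2 appears because the phase belongs to two time steps, the velocity to one. -/
theorem hasDerivAt_phase (K : Coin) {θ : ℝ} (h : Real.sin θ ≠ 0) :
    HasDerivAt (phase K) (2 * velocity K θ) θ := by
  have h1 : HasDerivAt (cosPhase K) (K.b * -Real.sin θ) θ :=
    ((Real.hasDerivAt_cos θ).const_mul K.b).const_add K.a
  have h2 := (Real.hasDerivAt_arccos (neg_one_lt_cosPhase K h).ne'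
    (cosPhase_lt_one K h).ne).comp θ h1
  refine h2.congr_deriv ?_
  unfold velocity
  ring

@[fun_prop]
theorem measurable_velocity (K : Coin) : Measurable (velocity K) := by
  unfold velocity
  have := (continuous_cosPhase K).measurable
  fun_prop

theorem continuousAt_velocity (K : Coin) {θ : ℝ} (h : Real.sin θ ≠ 0) :
    ContinuousAt (velocity K) θ := by
  unfold velocity
  have h0 : √(1 - cosPhase K θ ^ 2) ≠ 0 :=
    (Real.sqrt_pos.2 (by linarith [cosPhase_sq_lt_one K h])).ne'
  exact ContinuousAt.div (by fun_prop) (by fun_prop) h0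

/-- The point of the unit circle over which the fibre lies. -/
def circ (θ : ℝ) : ℂ := Complex.exp (θ * Complex.I)

theorem conj_circ (θ : ℝ) : conj (circ θ) = Complex.exp (-(θ * Complex.I)) := by
  simp [circ, ← Complex.exp_conj]

theorem circ_mul_conj (θ : ℝ) : circ θ * conj (circ θ) = 1 := by
  rw [conj_circ, circ, ← Complex.exp_add]; simp

@[fun_prop]
theorem continuous_circ : Continuous circ := by unfold circ; fun_prop

theorem circ_add_conj (θ : ℝ) : circ θ + conj (circ θ) = 2 * Complex.cos θ := by
  rw [conj_circ, circ, Complex.cos]; ring_nf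

theorem cosPhase_eq_overlap (K : Coin) (θ : ℝ) :
    (cosPhase K θ : ℂ) = 1 - 2 * (overlap K (circ θ) * conj (overlap K (circ θ))) := by
  rw [conj_overlap, overlap]
  unfold cosPhase Coin.a Coin.b
  push_cast
  linear_combination (-2 * K.sp * K.sm * K.tp * K.tm : ℂ) * circ_add_conj θ
    + 2 * K.sm ^ 2 * K.tp ^ 2 * circ_mul_conj θ

/-- The three directions of propagation. -/
def dir : Fin 3 → ℝ := ![0, 1, -1]

/-- The eigenvalues of the squared walk on the fibre over `exp (iθ)`. -/
def ev (K : Coin) (k : Fin 3) (θ : ℝ) : ℂ :=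
  (![-1, 1, 1] : Fin 3 → ℂ) k * Complex.exp (((dir k * phase K θ : ℝ) : ℂ) * Complex.I)

@[fun_prop]
theorem continuous_ev (K : Coin) (k : Fin 3) : Continuous (ev K k) := by
  unfold ev; fun_prop

theorem ev_zero (K : Coin) (θ : ℝ) : ev K 0 θ = -1 := by simp [ev, dir]

theorem ev_one (K : Coin) {θ : ℝ} (h : Real.sin θ ≠ 0) :
    ev K 1 θ = cosPhase K θ + Real.sin (phase K θ) * Complex.I := by
  simp [ev, dir, Complex.exp_mul_I, ← cos_phase K h]

theorem ev_two (K : Coin) {θ : ℝ} (h : Real.sin θ ≠ 0) :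
    ev K 2 θ = cosPhase K θ - Real.sin (phase K θ) * Complex.I := by
  simp only [ev, dir, ← cos_phase K h]
  simp [← neg_mul, Complex.exp_mul_I, sub_eq_add_neg, -mul_neg]
  rw [neg_one_mul, Complex.cos_neg, Complex.sin_neg]

theorem ev_mul_conj (K : Coin) (k : Fin 3) (θ : ℝ) : ev K k θ * conj (ev K k θ) = 1 := by
  rw [Complex.mul_conj, Complex.normSq_eq_norm_sq, ev, norm_mul, Complex.norm_exp_ofReal_mul_I]
  fin_cases k <;> simp

theorem ev_ne (K : Coin) {θ : ℝ} (h : Real.sin θ ≠ 0) {j k : Fin 3} (hjk : j ≠ k) :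
    ev K j θ ≠ ev K k θ := by
  have hs := (sin_phase_pos K h).ne'
  have hm := neg_one_lt_cosPhase K h
  have h01 : ev K 0 θ ≠ ev K 1 θ := by
    rw [ev_zero, ev_one K h]
    intro he
    have := congrArg Complex.im he
    simp [-Complex.ofReal_sin] at this
    exact hs this.symm
  have h02 : ev K 0 θ ≠ ev K 2 θ := by
    rw [ev_zero, ev_two K h]
    intro he
    have := congrArg Complex.im he
    simp [-Complex.ofReal_sin] at this
    exact hs this
  have h12 : ev K 1 θ ≠ ev K 2 θ := by
    rw [ev_one K h, ev_two K h]
    intro he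
    have := congrArg Complex.im he
    simp [-Complex.ofReal_sin] at this
    exact hs (by linarith)
  fin_cases j <;> fin_cases k <;>
    first | exact absurd rfl hjk | assumption | exact Ne.symm (by assumption)

/-- The component of `x` in the `k`-th eigenspace of the squared walk. -/
def part (K : Coin) (k : Fin 3) (θ : ℝ) (x : A0 → ℂ) : A0 → ℂ :=
  eigenPart (fstep2 K (circ θ)) (ev K k θ) (ev K (k + 1) θ) (ev K (k + 2) θ) x

theorem fstep2_part (K : Coin) (k : Fin 3) {θ : ℝ} (h : Real.sin θ ≠ 0) (x : A0 → ℂ) :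
    fstep2 K (circ θ) (part K k θ x) = ev K k θ • part K k θ x := by
  apply apply_eigenPart
  rw [fstep2_cubic K (circ_mul_conj θ) (cosPhase_eq_overlap K θ)]
  have hsq : (cosPhase K θ : ℂ) ^ 2 + (Real.sin (phase K θ) : ℂ) ^ 2 = 1 := by
    rw [← cos_phase K h]; exact_mod_cast Real.cos_sq_add_sin_sq (phase K θ)
  -- With the sum and the product of e^{±iΩ}, the coefficients of the cubic become the elementary
  -- symmetric functions of the eigenvalues, whichever of them is listed first.
  have e1 : ev K 1 θ + ev K 2 θ = 2 * cosPhase K θ := by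
    rw [ev_one K h, ev_two K h]; ring
  have e2 : ev K 1 θ * ev K 2 θ = 1 := by
    rw [ev_one K h, ev_two K h]
    linear_combination hsq - (Real.sin (phase K θ) : ℂ) ^ 2 * Complex.I_sq
  have e0 := ev_zero K θ
  fin_cases k <;> simp only [Fin.zero_eta, Fin.mk_one, Fin.reduceFinMk, Fin.reduceAdd, zero_add,
      Fin.isValue, e0]
  all_goals
    match_scalars
    · linear_combination -e1
    · linear_combination e2 - e1
    · linear_combination e2

theorem sum_part (K : Coin) {θ : ℝ} (h : Real.sin θ ≠ 0) (x : A0 → ℂ) :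
    ∑ k, part K k θ x = x := by
  rw [Fin.sum_univ_three]
  exact eigenPart_add_eigenPart_add_eigenPart _ (ev_ne K h (by decide)) (ev_ne K h (by decide))
    (ev_ne K h (by decide)) x

theorem sip_part_part (K : Coin) {θ : ℝ} (h : Real.sin θ ≠ 0) {j k : Fin 3} (hjk : j ≠ k)
    (x y : A0 → ℂ) : sip (part K j θ x) (part K k θ y) = 0 :=
  sip_eq_zero_of_eigen (sip_fstep2 K (circ_mul_conj θ)) (ev_mul_conj K j θ) (ev_ne K h hjk)
    (fstep2_part K j h x) (fstep2_part K k h y)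

theorem iterate_fstep2 (K : Coin) {θ : ℝ} (h : Real.sin θ ≠ 0) (x : A0 → ℂ) (N : ℕ) :
    (fstep2 K (circ θ))^[N] x = ∑ k, ev K k θ ^ N • part K k θ x := by
  induction N with
  | zero => simp [sum_part K h]
  | succ N ih =>
    rw [Function.iterate_succ_apply', ih, map_sum]
    refine Finset.sum_congr rfl fun k _ => ?_
    rw [map_smul, fstep2_part K k h, smul_smul, pow_succ]

@[fun_prop]
theorem continuous_fstep (K : Coin) {X : Type*} [TopologicalSpace X] {z : X → ℂ}
    {x : X → A0 → ℂ} (hz : Continuous z) (hx : Continuous x) :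
    Continuous fun t => fstep K (z t) (x t) := by
  have h : ∀ a, Continuous fun t => x t a := fun a => (continuous_apply a).comp hx
  have h1 := h .e0
  have h2 := h .ep
  have h3 := h .em
  have h4 := h .e0bar
  have h5 := h .epbar
  have h6 := h .embar
  have h7 : Continuous fun t => conj (z t) := Complex.continuous_conj.comp hz
  refine continuous_pi fun a => ?_
  cases a <;> simp only [fstep, LinearMap.coe_mk, AddHom.coe_mk] <;> fun_prop

@[fun_prop]
theorem continuous_fstep2 (K : Coin) {X : Type*} [TopologicalSpace X] {z : X → ℂ}
    {x : X → A0 → ℂ} (hz : Continuous z) (hx : Continuous x) :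
    Continuous fun t => fstep2 K (z t) (x t) :=
  continuous_fstep K hz (continuous_fstep K hz hx)

theorem continuousAt_part (K : Coin) (k : Fin 3) {θ : ℝ} (h : Real.sin θ ≠ 0)
    {x : ℝ → A0 → ℂ} (hx : Continuous x) :
    ContinuousAt (fun φ => part K k φ (x φ)) θ := by
  have h1 : Continuous fun φ => fstep2 K (circ φ) (x φ) :=
    continuous_fstep2 K continuous_circ hx
  have h2 : Continuous fun φ => fstep2 K (circ φ) (fstep2 K (circ φ) (x φ)) :=
    continuous_fstep2 K continuous_circ h1
  have h3 : (ev K k θ - ev K (k + 1) θ) * (ev K k θ - ev K (k + 2) θ) ≠ 0 :=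
    mul_ne_zero (sub_ne_zero.2 (ev_ne K h (by revert k; decide)))
      (sub_ne_zero.2 (ev_ne K h (by revert k; decide)))
  have h4 : Continuous fun φ => (ev K k φ - ev K (k + 1) φ) * (ev K k φ - ev K (k + 2) φ) := by
    fun_prop
  have h5 : Continuous fun φ => fstep2 K (circ φ) (fstep2 K (circ φ) (x φ))
      - (ev K (k + 1) φ + ev K (k + 2) φ) • fstep2 K (circ φ) (x φ)
      + (ev K (k + 1) φ * ev K (k + 2) φ) • x φ := by fun_prop
  exact (h4.continuousAt.inv₀ h3).smul h5.continuousAt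

/-- Colliding eigenvalues do no harm: the inverse of zero is zero, so the formula is measurable
everywhere. -/
theorem measurable_part (K : Coin) (k : Fin 3) {x : ℝ → A0 → ℂ} (hx : Continuous x) :
    Measurable (fun φ => part K k φ (x φ)) := by
  have h1 : Continuous fun φ => fstep2 K (circ φ) (x φ) :=
    continuous_fstep2 K continuous_circ hx
  have h2 : Continuous fun φ => fstep2 K (circ φ) (fstep2 K (circ φ) (x φ)) :=
    continuous_fstep2 K continuous_circ h1
  have h4 : Continuous fun φ => (ev K k φ - ev K (k + 1) φ) * (ev K k φ - ev K (k + 2) φ) := by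
    fun_prop
  have h5 : Continuous fun φ => fstep2 K (circ φ) (fstep2 K (circ φ) (x φ))
      - (ev K (k + 1) φ + ev K (k + 2) φ) • fstep2 K (circ φ) (x φ)
      + (ev K (k + 1) φ * ev K (k + 2) φ) • x φ := by fun_prop
  exact h4.measurable.inv.smul h5.measurable

/-! ### The Fourier transform of finitely supported states -/

/-- The Fourier transform of a state. -/
def transform (ψ : Arc → ℂ) (θ : ℝ) (a : A0) : ℂ :=
  ∑' j : ℤ, ψ (j, a) * Complex.exp (((j : ℝ) * θ : ℝ) * Complex.I)

/-- The cells that meet a finite set of arcs. -/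
def cells {ψ : Arc → ℂ} (h : ψ.support.Finite) : Finset ℤ := h.toFinset.image Prod.fst

theorem eq_zero_of_notMem_cells {ψ : Arc → ℂ} (h : ψ.support.Finite) {j : ℤ} (hj : j ∉ cells h)
    (a : A0) : ψ (j, a) = 0 := by
  by_contra h0
  exact hj (Finset.mem_image.2 ⟨(j, a), by simpa using h0, rfl⟩)

theorem transform_eq_sum {ψ : Arc → ℂ} (h : ψ.support.Finite) (θ : ℝ) (a : A0) :
    transform ψ θ a =
      ∑ j ∈ cells h, ψ (j, a) * Complex.exp (((j : ℝ) * θ : ℝ) * Complex.I) :=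
  tsum_eq_sum fun j hj => by rw [eq_zero_of_notMem_cells h hj, zero_mul]

theorem summable_transform {ψ : Arc → ℂ} (h : ψ.support.Finite) (θ : ℝ) (a : A0) :
    Summable fun j : ℤ => ψ (j, a) * Complex.exp (((j : ℝ) * θ : ℝ) * Complex.I) :=
  summable_of_ne_finset_zero (s := cells h) fun j hj => by
    rw [eq_zero_of_notMem_cells h hj, zero_mul]

theorem continuous_transform {ψ : Arc → ℂ} (h : ψ.support.Finite) :
    Continuous (transform ψ) := by
  refine continuous_pi fun a => ?_
  simp only [transform_eq_sum h]
  fun_prop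

theorem hasSum_transform {ψ : Arc → ℂ} (h : ψ.support.Finite) (θ : ℝ) (a : A0) :
    HasSum (fun j : ℤ => ψ (j, a) * Complex.exp (((j : ℝ) * θ : ℝ) * Complex.I))
      (transform ψ θ a) := (summable_transform h θ a).hasSum

/-- A shift by one cell becomes multiplication by e^{iθ}; this is the source of z in `fstep`. -/
theorem hasSum_transform_pred {ψ : Arc → ℂ} (h : ψ.support.Finite) (θ : ℝ) (a : A0) :
    HasSum (fun j : ℤ => ψ (j - 1, a) * Complex.exp (((j : ℝ) * θ : ℝ) * Complex.I))
      (circ θ * transform ψ θ a) := by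
  have h1 := ((Equiv.subRight (1 : ℤ)).hasSum_iff.2 (hasSum_transform h θ a)).mul_left (circ θ)
  refine h1.congr_fun fun j => ?_
  simp only [Function.comp_apply, Equiv.subRight_apply, circ]
  rw [mul_left_comm, ← Complex.exp_add]
  congr 2
  push_cast
  ring

theorem hasSum_transform_succ {ψ : Arc → ℂ} (h : ψ.support.Finite) (θ : ℝ) (a : A0) :
    HasSum (fun j : ℤ => ψ (j + 1, a) * Complex.exp (((j : ℝ) * θ : ℝ) * Complex.I))
      (conj (circ θ) * transform ψ θ a) := by
  have h1 := ((Equiv.addRight (1 : ℤ)).hasSum_iff.2 (hasSum_transform h θ a)).mul_left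
    (conj (circ θ))
  refine h1.congr_fun fun j => ?_
  simp only [Function.comp_apply, Equiv.coe_addRight, conj_circ]
  rw [mul_left_comm, ← Complex.exp_add]
  congr 2
  push_cast
  ring

theorem transform_step (K : Coin) {ψ : Arc → ℂ} (h : ψ.support.Finite) (θ : ℝ) :
    transform (step K ψ) θ = fstep K (circ θ) (transform ψ θ) := by
  have hS (c : ℂ) := ((((hasSum_transform h θ .e0bar).mul_left (K.s0 : ℂ)).add
    ((hasSum_transform h θ .epbar).mul_left (K.sp : ℂ))).add
    ((hasSum_transform_pred h θ .embar).mul_left (K.sm : ℂ))).mul_left (2 * c)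
  have hT (c : ℂ) := (((hasSum_transform h θ .ep).mul_left (K.tp : ℂ)).add
    ((hasSum_transform_succ h θ .em).mul_left (K.tm : ℂ))).mul_left (2 * c)
  ext a
  refine HasSum.tsum_eq ?_
  cases a
  · exact ((hS K.s0).sub (hasSum_transform h θ .e0bar)).congr_fun fun j => by
      simp only [step]; ring
  · exact ((hS K.sp).sub (hasSum_transform h θ .epbar)).congr_fun fun j => by
      simp only [step]; ring
  · exact ((hS K.sm).sub (hasSum_transform_pred h θ .embar)).congr_fun fun j => by
      simp only [step]; ring
  · exact hasSum_transform h θ .e0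
  · exact ((hT K.tp).sub (hasSum_transform h θ .ep)).congr_fun fun j => by
      simp only [step]; ring
  · exact ((hT K.tm).sub (hasSum_transform_succ h θ .em)).congr_fun fun j => by
      simp only [step]; ring

theorem transform_iterate (K : Coin) {ψ : Arc → ℂ} (h : ψ.support.Finite) (n : ℕ) (θ : ℝ) :
    transform ((step K)^[n] ψ) θ = (fstep K (circ θ))^[n] (transform ψ θ) := by
  induction n generalizing ψ with
  | zero => rfl
  | succ n ih =>
    rw [Function.iterate_succ_apply, Function.iterate_succ_apply, ih (finite_support_step K h),
      transform_step K h]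

theorem integral_exp_int (k : ℤ) :
    ∫ θ in -Real.pi..Real.pi, Complex.exp (((k : ℝ) * θ : ℝ) * Complex.I) =
      if k = 0 then (2 * Real.pi : ℂ) else 0 := by
  split_ifs with hk
  · subst hk
    simp
    ring
  · have hk' : (k : ℂ) * Complex.I ≠ 0 := by simp [hk]
    have h1 : ∀ θ : ℝ, Complex.exp (((k : ℝ) * θ : ℝ) * Complex.I)
        = Complex.exp ((k * Complex.I) * θ) := fun θ => by
      congr 1; push_cast; ring
    simp_rw [h1]
    rw [integral_exp_mul_complex hk', div_eq_zero_iff]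
    left
    rw [sub_eq_zero, Complex.exp_eq_exp_iff_exists_int]
    exact ⟨k, by push_cast; ring⟩

/-- Parseval's formula, with a shift of the fibres. -/
theorem integral_sip_transform {ψ : Arc → ℂ} (h : ψ.support.Finite) (s : ℝ) :
    ∫ θ in -Real.pi..Real.pi, sip (transform ψ θ) (transform ψ (θ + s)) =
      2 * Real.pi * ∑ j ∈ cells h, ((∑ a, ‖ψ (j, a)‖ ^ 2 : ℝ) : ℂ)
        * Complex.exp ((s * j : ℝ) * Complex.I) := by
  have key : ∀ θ : ℝ, sip (transform ψ θ) (transform ψ (θ + s)) =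
      ∑ a, ∑ j ∈ cells h, ∑ k ∈ cells h, (conj (ψ (j, a)) * ψ (k, a)
        * Complex.exp ((s * k : ℝ) * Complex.I))
          * Complex.exp ((((k - j : ℤ) : ℝ) * θ : ℝ) * Complex.I) := by
    intro θ
    simp only [sip, transform_eq_sum h, map_sum, Finset.sum_mul_sum]
    refine Finset.sum_congr rfl fun a _ => Finset.sum_congr rfl fun j _ =>
      Finset.sum_congr rfl fun k _ => ?_
    rw [map_mul, ← Complex.exp_conj]
    have e1 : Complex.exp (conj ((((j : ℝ) * θ : ℝ) : ℂ) * Complex.I))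
        * Complex.exp (((k : ℝ) * (θ + s) : ℝ) * Complex.I) =
        Complex.exp ((s * k : ℝ) * Complex.I)
          * Complex.exp ((((k - j : ℤ) : ℝ) * θ : ℝ) * Complex.I) := by
      rw [← Complex.exp_add, ← Complex.exp_add]
      congr 1
      simp only [map_mul, Complex.conj_ofReal, Complex.conj_I]
      push_cast
      ring
    linear_combination (conj (ψ (j, a)) * ψ (k, a)) * e1
  simp_rw [key]
  rw [intervalIntegral.integral_finsetSum fun a _ =>
    Continuous.intervalIntegrable (by fun_prop) _ _]
  simp_rw [Complex.ofReal_sum, Finset.mul_sum, Finset.sum_mul, Finset.mul_sum]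
  rw [Finset.sum_comm]
  refine Finset.sum_congr rfl fun a _ => ?_
  rw [intervalIntegral.integral_finsetSum fun a _ =>
    Continuous.intervalIntegrable (by fun_prop) _ _]
  refine Finset.sum_congr rfl fun j hj => ?_
  rw [intervalIntegral.integral_finsetSum fun a _ =>
    Continuous.intervalIntegrable (by fun_prop) _ _]
  simp_rw [intervalIntegral.integral_const_mul, integral_exp_int]
  rw [Finset.sum_eq_single j]
  · simp only [sub_self, if_true]
    push_cast
    rw [← Complex.conj_mul']
    ring
  · intro k _ hkj
    rw [if_neg (sub_ne_zero.2 hkj)]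
    simp
  · exact fun hj' => absurd hj hj'

/-! ### Characteristic functions -/

theorem scaledLaw_eq_sum {m : ℕ → ℤ → ℝ} {n : ℕ} {S : Finset ℤ} (hS : ∀ j ∉ S, m n j = 0) :
    scaledLaw m n =
      ∑ j ∈ S, ENNReal.ofReal (m n j) • Measure.dirac ((j : ℝ) / (n : ℝ)) := by
  ext s hs
  rw [scaledLaw, Measure.sum_apply _ hs, Measure.finsetSum_apply]
  exact tsum_eq_sum fun j hj => by simp [hS j hj]

theorem charFun_scaledLaw {m : ℕ → ℤ → ℝ} {n : ℕ} {S : Finset ℤ} (hS : ∀ j ∉ S, m n j = 0)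
    (hm : ∀ j, 0 ≤ m n j) (ξ : ℝ) :
    charFun (scaledLaw m n) ξ =
      ∑ j ∈ S, (m n j : ℂ) * Complex.exp ((ξ / n * j : ℝ) * Complex.I) := by
  rw [scaledLaw_eq_sum hS, charFun_apply_real, integral_finsetSum_measure]
  · refine Finset.sum_congr rfl fun j _ => ?_
    rw [integral_smul_measure, integral_dirac, ENNReal.toReal_ofReal (hm j), Complex.real_smul]
    congr 3
    push_cast
    ring
  · intro j _
    exact (integrable_dirac (by simp)).smul_measure ENNReal.ofReal_ne_top

/-- The squared modulus of the state at time `n` in the `j`-th cell. -/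
def cellProb (K : Coin) (Ψ : Arc → ℂ) (n : ℕ) (j : ℤ) : ℝ :=
  ∑ a : A0, ‖((step K)^[n] Ψ) (j, a)‖ ^ 2

theorem cellProb_nonneg (K : Coin) (Ψ : Arc → ℂ) (n : ℕ) (j : ℤ) : 0 ≤ cellProb K Ψ n j :=
  Finset.sum_nonneg fun _ _ => by positivity

/-- The character e^{iξj/n} translates the Fourier variable by ξ/n, so the claim is the shifted
Parseval formula applied to the evolved state. -/
theorem charFun_cellProb (K : Coin) {Ψ : Arc → ℂ} (h : Ψ.support.Finite) (n : ℕ) (ξ : ℝ) :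
    charFun (scaledLaw (cellProb K Ψ) n) ξ =
      (2 * Real.pi : ℂ)⁻¹ * ∫ θ in -Real.pi..Real.pi,
        sip ((fstep K (circ θ))^[n] (transform Ψ θ))
          ((fstep K (circ (θ + ξ / n)))^[n] (transform Ψ (θ + ξ / n))) := by
  have h' := finite_support_iterate K h n
  rw [charFun_scaledLaw (S := cells h') (fun j hj => by
    simp [cellProb, eq_zero_of_notMem_cells h' hj]) (cellProb_nonneg K Ψ n)]
  simp_rw [← transform_iterate K h]
  rw [integral_sip_transform h', inv_mul_cancel_left₀]
  · rfl
  · exact mul_ne_zero two_ne_zero (by exact_mod_cast Real.pi_ne_zero)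

/-! ### Convergence of the characteristic functions -/

theorem tendsto_half_div : Tendsto (fun n : ℕ => ((n / 2 : ℕ) : ℝ) / n) atTop (𝓝 (1 / 2)) := by
  have h := (tendsto_nat_floor_mul_div_atTop (R := ℝ) (a := 1 / 2) (by norm_num)).comp
    tendsto_natCast_atTop_atTop
  refine h.congr fun n => ?_
  simp only [Function.comp_apply]
  rw [one_div_mul_eq_div, show (n : ℝ) / 2 = (n : ℝ) / (2 : ℕ) by norm_num, Nat.floor_div_natCast,
    Nat.floor_natCast]

theorem tendsto_add_div (θ ξ : ℝ) : Tendsto (fun n : ℕ => θ + ξ / n) atTop (𝓝 θ) := by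
  simpa using (tendsto_const_div_atTop_nhds_zero_nat ξ).const_add θ

/-- Only ⌊n/2⌋ double steps fit into time n, which cancels the factor 2 in `hasDerivAt_phase`. -/
theorem tendsto_phase_sub (K : Coin) {θ : ℝ} (h : Real.sin θ ≠ 0) (ξ : ℝ) :
    Tendsto (fun n : ℕ => ((n / 2 : ℕ) : ℝ) * (phase K (θ + ξ / n) - phase K θ)) atTop
      (𝓝 (ξ * velocity K θ)) := by
  have h1 : HasDerivAt (fun t : ℝ => phase K (θ + ξ * t)) (2 * velocity K θ * ξ) 0 := by
    have h2 : HasDerivAt (fun t : ℝ => θ + ξ * t) ξ 0 := by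
      simpa using ((hasDerivAt_id (0 : ℝ)).const_mul ξ).const_add θ
    have h3 : HasDerivAt (phase K) (2 * velocity K θ) (θ + ξ * 0) := by
      simpa using hasDerivAt_phase K h
    exact HasDerivAt.comp (h₂ := phase K) (h := fun t : ℝ => θ + ξ * t) 0 h3 h2
  have h4 : Tendsto (fun n : ℕ => ((n : ℝ))⁻¹) atTop (𝓝[≠] 0) := by
    refine tendsto_nhdsWithin_iff.2 ⟨tendsto_inv_atTop_nhds_zero_nat, ?_⟩
    filter_upwards [eventually_gt_atTop 0] with n hn
    simp [hn.ne']
  have h5 := tendsto_half_div.mul ((hasDerivAt_iff_tendsto_slope_zero.1 h1).comp h4)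
  rw [show 1 / 2 * (2 * velocity K θ * ξ) = ξ * velocity K θ by ring] at h5
  refine h5.congr' ?_
  filter_upwards [eventually_gt_atTop 0] with n hn
  have hn' : (n : ℝ) ≠ 0 := by exact_mod_cast hn.ne'
  simp only [Function.comp_apply, zero_add, mul_zero, add_zero, inv_inv, smul_eq_mul]
  rw [← div_eq_mul_inv]
  field_simp

theorem tendsto_conj_ev_mul_ev (K : Coin) (k : Fin 3) {θ : ℝ} (h : Real.sin θ ≠ 0) (ξ : ℝ) :
    Tendsto (fun n : ℕ => conj (ev K k θ ^ (n / 2)) * ev K k (θ + ξ / n) ^ (n / 2)) atTop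
      (𝓝 (Complex.exp ((ξ * (dir k * velocity K θ) : ℝ) * Complex.I))) := by
  have hε : ∀ N : ℕ, conj ((![-1, 1, 1] : Fin 3 → ℂ) k ^ N) * (![-1, 1, 1] : Fin 3 → ℂ) k ^ N
      = 1 := fun N => by
    rw [map_pow, ← mul_pow]
    fin_cases k <;> simp
  have h1 : ∀ n : ℕ, conj (ev K k θ ^ (n / 2)) * ev K k (θ + ξ / n) ^ (n / 2) =
      Complex.exp ((dir k * (((n / 2 : ℕ) : ℝ) * (phase K (θ + ξ / n) - phase K θ)) : ℝ)
        * Complex.I) := by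
    intro n
    simp only [ev, mul_pow, ← Complex.exp_nat_mul]
    rw [map_mul, mul_mul_mul_comm, hε, one_mul, ← Complex.exp_conj, ← Complex.exp_add]
    congr 1
    simp only [map_mul, Complex.conj_ofReal, Complex.conj_I, Complex.conj_natCast]
    push_cast
    ring
  simp_rw [h1]
  have h2 := (tendsto_phase_sub K h ξ).const_mul (dir k)
  rw [show dir k * (ξ * velocity K θ) = ξ * (dir k * velocity K θ) by ring] at h2
  exact (Complex.continuous_exp.tendsto _).comp
    (((Complex.continuous_ofReal.tendsto _).comp h2).mul_const Complex.I)

theorem norm_conj_ev_pow_mul (K : Coin) (j k : Fin 3) (θ φ : ℝ) (N : ℕ) :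
    ‖conj (ev K j θ ^ N) * ev K k φ ^ N‖ = 1 := by
  have h : ∀ k θ, ‖ev K k θ‖ = 1 := fun k θ => by
    have := ev_mul_conj K k θ
    rw [Complex.mul_conj, Complex.normSq_eq_norm_sq] at this
    have h1 : ‖ev K k θ‖ ^ 2 = 1 := by exact_mod_cast this
    exact (pow_eq_one_iff_of_nonneg (norm_nonneg _) two_ne_zero).1 h1
  rw [norm_mul, RCLike.norm_conj, norm_pow, norm_pow, h, h]
  simp

theorem continuous_sip {X : Type*} [TopologicalSpace X] {x y : X → A0 → ℂ} {t : X}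
    (hx : ContinuousAt x t) (hy : ContinuousAt y t) : ContinuousAt (fun s => sip (x s) (y s)) t := by
  unfold sip
  refine tendsto_finsetSum _ fun a _ => ?_
  have h1 : ContinuousAt (fun s => x s a) t := (continuous_apply a).continuousAt.comp hx
  have h2 : ContinuousAt (fun s => y s a) t := (continuous_apply a).continuousAt.comp hy
  exact (Complex.continuous_conj.continuousAt.comp h1).mul h2

theorem continuousAt_fstep (K : Coin) {x : ℝ → A0 → ℂ} {θ : ℝ} (hx : ContinuousAt x θ) :
    ContinuousAt (fun φ => fstep K (circ φ) (x φ)) θ := by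
  have h1 : Continuous fun p : ℂ × (A0 → ℂ) => fstep K p.1 p.2 :=
    continuous_fstep K continuous_fst continuous_snd
  have h2 : ContinuousAt (fun φ => (circ φ, x φ)) θ := continuous_circ.continuousAt.prodMk hx
  exact ContinuousAt.comp (f := fun φ => (circ φ, x φ)) h1.continuousAt h2

theorem sip_iterate_fstep (K : Coin) {z : ℂ} (hz : z * conj z = 1) (n : ℕ) (x y : A0 → ℂ) :
    sip ((fstep K z)^[n] x) ((fstep K z)^[n] y) = sip x y := by
  induction n generalizing x y with
  | zero => rfl
  | succ n ih => rw [Function.iterate_succ_apply, Function.iterate_succ_apply, ih, sip_fstep K hz]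

theorem iterate_fstep_eq (K : Coin) {θ : ℝ} (h : Real.sin θ ≠ 0) (x : A0 → ℂ) (n : ℕ) :
    (fstep K (circ θ))^[n] x =
      ∑ k, ev K k θ ^ (n / 2) • (fstep K (circ θ))^[n % 2] (part K k θ x) := by
  have h2 : (fstep K (circ θ))^[2] = fstep2 K (circ θ) := rfl
  conv_lhs => rw [← Nat.mod_add_div n 2]
  rw [Function.iterate_add_apply, Function.iterate_mul, h2, iterate_fstep2 K h]
  rcases Nat.mod_two_eq_zero_or_one n with h0 | h0 <;> simp [h0]

theorem tendsto_sip_iterate_part (K : Coin) (j k : Fin 3) {θ : ℝ} (h : Real.sin θ ≠ 0)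
    {x : ℝ → A0 → ℂ} (hx : Continuous x) (ξ : ℝ) :
    Tendsto (fun n : ℕ => sip ((fstep K (circ θ))^[n % 2] (part K j θ (x θ)))
        ((fstep K (circ (θ + ξ / n)))^[n % 2] (part K k (θ + ξ / n) (x (θ + ξ / n))))) atTop
      (𝓝 (sip (part K j θ (x θ)) (part K k θ (x θ)))) := by
  have hp := continuousAt_part K k h hx
  have h0 : Tendsto (fun φ => sip (part K j θ (x θ)) (part K k φ (x φ))) (𝓝 θ)
      (𝓝 (sip (part K j θ (x θ)) (part K k θ (x θ)))) :=
    continuous_sip (x := fun _ => part K j θ (x θ)) continuousAt_const hp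
  have h1 : Tendsto (fun φ => sip (fstep K (circ θ) (part K j θ (x θ)))
      (fstep K (circ φ) (part K k φ (x φ)))) (𝓝 θ)
      (𝓝 (sip (part K j θ (x θ)) (part K k θ (x θ)))) := by
    have := continuous_sip (x := fun _ => fstep K (circ θ) (part K j θ (x θ))) continuousAt_const
      (continuousAt_fstep K hp)
    unfold ContinuousAt at this
    beta_reduce at this
    rwa [sip_fstep K (circ_mul_conj θ)] at this
  have h0' := h0.comp (tendsto_add_div θ ξ)
  have h1' := h1.comp (tendsto_add_div θ ξ)
  -- Even and odd times are interleaved. The step left over at odd times does not change the limit,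
  -- because it is unitary on the fibre.
  have h2 := h0'.if' (p := fun n : ℕ => n % 2 = 0) h1'
  refine h2.congr fun n => ?_
  rcases Nat.mod_two_eq_zero_or_one n with h0 | h0 <;> simp [h0]

/-- In the eigenvector expansion the oscillating factors have modulus one. The scalar products of
different bands tend to those at the same θ, which vanish by orthogonality; on the diagonal the
phase difference converges to ξ times the velocity. -/
theorem tendsto_sip_iterate (K : Coin) {θ : ℝ} (h : Real.sin θ ≠ 0)
    {x : ℝ → A0 → ℂ} (hx : Continuous x) (ξ : ℝ) :
    Tendsto (fun n : ℕ => sip ((fstep K (circ θ))^[n] (x θ))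
        ((fstep K (circ (θ + ξ / n)))^[n] (x (θ + ξ / n)))) atTop
      (𝓝 (∑ k, Complex.exp ((ξ * (dir k * velocity K θ) : ℝ) * Complex.I)
        * sip (part K k θ (x θ)) (part K k θ (x θ)))) := by
  have hev : ∀ᶠ n : ℕ in atTop, Real.sin (θ + ξ / n) ≠ 0 :=
    (((Real.continuous_sin.tendsto θ).comp (tendsto_add_div θ ξ)).eventually_ne h)
  have hlim : Tendsto (fun n : ℕ => ∑ j, ∑ k,
      conj (ev K j θ ^ (n / 2)) * ev K k (θ + ξ / n) ^ (n / 2)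
        * sip ((fstep K (circ θ))^[n % 2] (part K j θ (x θ)))
          ((fstep K (circ (θ + ξ / n)))^[n % 2] (part K k (θ + ξ / n) (x (θ + ξ / n))))) atTop
      (𝓝 (∑ j, ∑ k, if j = k then Complex.exp ((ξ * (dir k * velocity K θ) : ℝ) * Complex.I)
        * sip (part K k θ (x θ)) (part K k θ (x θ)) else 0)) := by
    refine tendsto_finsetSum _ fun j _ => tendsto_finsetSum _ fun k _ => ?_
    have h1 := tendsto_sip_iterate_part K j k h hx ξ
    split_ifs with hjk
    · subst hjk
      exact (tendsto_conj_ev_mul_ev K j h ξ).mul h1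
    · rw [sip_part_part K h hjk] at h1
      refine squeeze_zero_norm (fun n => ?_) (tendsto_zero_iff_norm_tendsto_zero.1 h1)
      rw [norm_mul, norm_conj_ev_pow_mul, one_mul]
  simp only [Finset.sum_ite_eq, Finset.mem_univ, if_true] at hlim
  refine hlim.congr' ?_
  filter_upwards [hev] with n hn
  rw [iterate_fstep_eq K h, iterate_fstep_eq K hn, sip_sum_sum]
  simp only [sip_smul_smul]

theorem ae_sin_ne_zero : ∀ᵐ θ : ℝ, Real.sin θ ≠ 0 := by
  have hc : {θ : ℝ | Real.sin θ = 0}.Countable := by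
    refine (Set.countable_range fun n : ℤ => (n : ℝ) * Real.pi).mono fun θ hθ => ?_
    exact Real.sin_eq_zero_iff.1 hθ
  simpa [ae_iff] using hc.measure_zero volume

theorem tendsto_integral_sip_iterate (K : Coin) {x : ℝ → A0 → ℂ} (hx : Continuous x) (ξ : ℝ) :
    Tendsto (fun n : ℕ => ∫ θ in -Real.pi..Real.pi, sip ((fstep K (circ θ))^[n] (x θ))
        ((fstep K (circ (θ + ξ / n)))^[n] (x (θ + ξ / n)))) atTop
      (𝓝 (∫ θ in -Real.pi..Real.pi,
        ∑ k, Complex.exp ((ξ * (dir k * velocity K θ) : ℝ) * Complex.I)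
          * sip (part K k θ (x θ)) (part K k θ (x θ)))) := by
  have hQ : Continuous fun θ => ∑ a, ‖x θ a‖ ^ 2 := by fun_prop
  -- By unitarity it suffices to bound the initial data, on an interval containing all θ + ξ/n. It
  -- also serves n = 0, where ξ/0 = 0.
  obtain ⟨C, hC⟩ := (isCompact_Icc (a := -Real.pi - |ξ|) (b := Real.pi + |ξ|)).exists_bound_of_continuousOn
    hQ.continuousOn
  have hit : ∀ n : ℕ, Continuous fun θ => (fstep K (circ θ))^[n] (x θ) := by
    intro n
    induction n with
    | zero => exact hx
    | succ n ih =>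
      simp only [Function.iterate_succ_apply']
      exact continuous_fstep K continuous_circ ih
  have hsq : ∀ (n : ℕ) (θ : ℝ), ∑ a, ‖(fstep K (circ θ))^[n] (x θ) a‖ ^ 2
      = ∑ a, ‖x θ a‖ ^ 2 := by
    intro n θ
    have := sip_iterate_fstep K (circ_mul_conj θ) n (x θ) (x θ)
    rw [sip_self, sip_self] at this
    exact_mod_cast this
  refine intervalIntegral.tendsto_integral_filter_of_dominated_convergence (fun _ => C)
    (.of_forall fun n => ?_) (.of_forall fun n => ?_) (by simp) ?_
  · have h2 : Continuous fun θ : ℝ => (fstep K (circ (θ + ξ / n)))^[n] (x (θ + ξ / n)) :=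
      (hit n).comp (continuous_id.add continuous_const)
    have : Continuous fun θ => sip ((fstep K (circ θ))^[n] (x θ))
        ((fstep K (circ (θ + ξ / n)))^[n] (x (θ + ξ / n))) :=
      continuous_iff_continuousAt.2 fun θ =>
        continuous_sip (hit n).continuousAt h2.continuousAt
    exact this.aestronglyMeasurable
  · refine .of_forall fun θ hθ => ?_
    rw [Set.uIoc_of_le (by linarith [Real.pi_pos])] at hθ
    refine (norm_sip_le _ _).trans ?_
    rw [hsq, hsq]
    have hξ : |ξ / n| ≤ |ξ| := by
      rw [abs_div, Nat.abs_cast]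
      rcases Nat.eq_zero_or_pos n with rfl | hn
      · simp
      · exact div_le_self (abs_nonneg _) (by exact_mod_cast hn)
    have h3 := abs_le.1 hξ
    have h1 := (le_abs_self _).trans (hC θ ⟨by linarith [hθ.1, abs_nonneg ξ],
      by linarith [hθ.2, abs_nonneg ξ]⟩)
    have h2 := (le_abs_self _).trans (hC (θ + ξ / n) ⟨by linarith [hθ.1], by linarith [hθ.2]⟩)
    linarith
  · filter_upwards [ae_sin_ne_zero] with θ hθ _
    exact tendsto_sip_iterate K hθ hx ξ

/-! ### Weak limits -/

theorem scaledLaw_apply {m : ℕ → ℤ → ℝ} {n : ℕ} {s : Set ℝ} (hs : MeasurableSet s) :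
    scaledLaw m n s =
      ∑' j : ℤ, ENNReal.ofReal (m n j) * s.indicator 1 ((j : ℝ) / (n : ℝ)) := by
  rw [scaledLaw, Measure.sum_apply _ hs]
  simp [Measure.dirac_apply' _ hs]

theorem scaledLaw_univ (m : ℕ → ℤ → ℝ) (n : ℕ) :
    scaledLaw m n Set.univ = ∑' j : ℤ, ENNReal.ofReal (m n j) := by
  rw [scaledLaw_apply MeasurableSet.univ]
  simp

theorem scaledLaw_cellProb_univ (K : Coin) (Ψ : Arc → ℂ) (n : ℕ) :
    scaledLaw (cellProb K Ψ) n Set.univ = energy Ψ := by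
  rw [scaledLaw_univ, ← energy_iterate K Ψ n, energy]
  refine tsum_congr fun j => ?_
  rw [cellProb, ENNReal.ofReal_sum_of_nonneg fun _ _ => by positivity]

theorem isProbabilityMeasure_scaledLaw_cellProb (K : Coin) {Ψ : Arc → ℂ} (hΨ : energy Ψ = 1)
    (n : ℕ) : IsProbabilityMeasure (scaledLaw (cellProb K Ψ) n) :=
  ⟨by rw [scaledLaw_cellProb_univ, hΨ]⟩

theorem isProbabilityMeasure_of_tendsto_charFun {μ : ℕ → Measure ℝ}
    [∀ n, IsProbabilityMeasure (μ n)] {ν : Measure ℝ} [IsFiniteMeasure ν]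
    (h : ∀ ξ, Tendsto (fun n => charFun (μ n) ξ) atTop (𝓝 (charFun ν ξ))) :
    IsProbabilityMeasure ν := by
  have h0 := h 0
  simp only [charFun_zero, probReal_univ] at h0
  have h1 : (ν.real Set.univ : ℂ) = 1 := tendsto_nhds_unique h0 (by simp)
  refine ⟨?_⟩
  have h2 : ν.real Set.univ = 1 := by exact_mod_cast h1
  rwa [Measure.real, ENNReal.toReal_eq_one_iff] at h2

theorem tendsto_probabilityMeasure {μ : ℕ → Measure ℝ} (hμ : ∀ n, IsProbabilityMeasure (μ n))
    {ν : Measure ℝ} (hν : IsProbabilityMeasure ν)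
    (h : ∀ ξ, Tendsto (fun n => charFun (μ n) ξ) atTop (𝓝 (charFun ν ξ))) :
    Tendsto (β := ProbabilityMeasure ℝ) (fun n => ⟨μ n, hμ n⟩) atTop (𝓝 ⟨ν, hν⟩) :=
  ProbabilityMeasure.tendsto_iff_tendsto_charFun.2 h

theorem eventuallyWithin_of_tendsto {m : ℕ → ℤ → ℝ}
    (hm : ∀ n, IsProbabilityMeasure (scaledLaw m n)) {ν : Measure ℝ}
    (hν : IsProbabilityMeasure ν)
    (h : Tendsto (β := ProbabilityMeasure ℝ) (fun n => ⟨scaledLaw m n, hm n⟩) atTop (𝓝 ⟨ν, hν⟩))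
    {x : ℝ} (hx : ν {y | x ≤ |y|} = 0) : EventuallyWithin m x := by
  have ho : IsOpen {y : ℝ | |y| < x} := isOpen_lt continuous_abs continuous_const
  have h1 := ProbabilityMeasure.le_liminf_measure_open_of_tendsto h ho
  have h2 : ν {y : ℝ | |y| < x} = 1 := by
    rw [← prob_compl_eq_zero_iff ho.measurableSet]
    convert hx using 2
    ext y
    simp
  simp only [ProbabilityMeasure.coe_mk, h2] at h1
  exact tendsto_of_le_liminf_of_limsup_le h1
    (limsup_le_of_le (h := .of_forall fun n => prob_le_one))

/-- The laws lose all mass on the open set x < |y|, and by the portmanteau theorem the limit cannot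
have more there. The sphere |y| = x itself is not controlled. -/
theorem measure_eq_zero_of_eventuallyWithin {m : ℕ → ℤ → ℝ}
    (hm : ∀ n, IsProbabilityMeasure (scaledLaw m n)) {ν : Measure ℝ}
    (hν : IsProbabilityMeasure ν)
    (h : Tendsto (β := ProbabilityMeasure ℝ) (fun n => ⟨scaledLaw m n, hm n⟩) atTop (𝓝 ⟨ν, hν⟩))
    {x : ℝ} (hx : EventuallyWithin m x) : ν {y | x < |y|} = 0 := by
  have ho : IsOpen {y : ℝ | x < |y|} := isOpen_lt continuous_const continuous_abs
  have ho' : IsOpen {y : ℝ | |y| < x} := isOpen_lt continuous_abs continuous_const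
  have h1 := ProbabilityMeasure.le_liminf_measure_open_of_tendsto h ho
  simp only [ProbabilityMeasure.coe_mk] at h1
  have h2 : Tendsto (fun n => 1 - scaledLaw m n {y : ℝ | |y| < x}) atTop (𝓝 0) := by
    have := ENNReal.Tendsto.sub (tendsto_const_nhds (x := (1 : ENNReal))) hx
      (.inl ENNReal.one_ne_top)
    simpa using this
  have h3 : Tendsto (fun n => scaledLaw m n {y : ℝ | x < |y|}) atTop (𝓝 0) := by
    refine tendsto_of_tendsto_of_tendsto_of_le_of_le tendsto_const_nhds h2 (fun _ => zero_le) ?_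
    intro n
    beta_reduce
    rw [← prob_compl_eq_one_sub ho'.measurableSet]
    exact measure_mono fun y hy => by simpa using le_of_lt hy
  rw [h3.liminf_eq] at h1
  exact le_antisymm h1 (zero_le)

/-- The distribution of the group velocity, if the `k`-th mode at `θ` carries the weight
`w k θ`. -/
def waveLaw (K : Coin) (w : Fin 3 → ℝ → ℝ) : Measure ℝ :=
  ∑ k, ((volume.restrict (Set.Ioc (-Real.pi) Real.pi)).withDensity
    fun θ => ENNReal.ofReal (w k θ / (2 * Real.pi))).map fun θ => dir k * velocity K θ

section

variable {K : Coin} {w : Fin 3 → ℝ → ℝ}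

theorem measurable_dir_mul_velocity (K : Coin) (k : Fin 3) :
    Measurable fun θ => dir k * velocity K θ := by fun_prop

theorem isFiniteMeasure_waveLaw
    (hi : ∀ k, IntegrableOn (w k) (Set.Ioc (-Real.pi) Real.pi)) :
    IsFiniteMeasure (waveLaw K w) := by
  unfold waveLaw
  have : ∀ k, IsFiniteMeasure ((volume.restrict (Set.Ioc (-Real.pi) Real.pi)).withDensity
    fun θ => ENNReal.ofReal (w k θ / (2 * Real.pi))) := fun k =>
    isFiniteMeasure_withDensity_ofReal ((hi k).div_const _).2
  infer_instance

theorem integrableOn_exp_mul (hi : ∀ k, IntegrableOn (w k) (Set.Ioc (-Real.pi) Real.pi)) (ξ : ℝ)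
    (k : Fin 3) : IntegrableOn (fun θ => Complex.exp ((ξ * (dir k * velocity K θ) : ℝ)
      * Complex.I) * (w k θ : ℂ)) (Set.Ioc (-Real.pi) Real.pi) := by
  have hE : Measurable fun θ =>
      Complex.exp ((ξ * (dir k * velocity K θ) : ℝ) * Complex.I) := by fun_prop
  refine (hi k).ofReal.bdd_mul (c := 1) hE.aestronglyMeasurable (.of_forall fun θ => ?_)
  rw [Complex.norm_exp_ofReal_mul_I]

theorem charFun_waveLaw (hw : ∀ k θ, 0 ≤ w k θ) (hwm : ∀ k, Measurable (w k))
    (hi : ∀ k, IntegrableOn (w k) (Set.Ioc (-Real.pi) Real.pi)) (ξ : ℝ) :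
    charFun (waveLaw K w) ξ = (2 * Real.pi : ℂ)⁻¹ * ∫ θ in -Real.pi..Real.pi,
      ∑ k, Complex.exp ((ξ * (dir k * velocity K θ) : ℝ) * Complex.I) * (w k θ : ℂ) := by
  have hfin : ∀ k, IsFiniteMeasure ((volume.restrict (Set.Ioc (-Real.pi) Real.pi)).withDensity
    fun θ => ENNReal.ofReal (w k θ / (2 * Real.pi))) := fun k =>
    isFiniteMeasure_withDensity_ofReal ((hi k).div_const _).2
  rw [charFun_apply_real, waveLaw, integral_finsetSum_measure,
    intervalIntegral.integral_of_le (by linarith [Real.pi_pos]),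
    integral_finsetSum _ fun k _ => integrableOn_exp_mul hi ξ k, Finset.mul_sum]
  · refine Finset.sum_congr rfl fun k _ => ?_
    rw [integral_map (measurable_dir_mul_velocity K k).aemeasurable
      (Measurable.aestronglyMeasurable (by fun_prop)),
      integral_withDensity_eq_integral_toReal_smul (by have := hwm k; fun_prop)
        (.of_forall fun _ => ENNReal.ofReal_lt_top), ← integral_const_mul]
    refine integral_congr_ae (.of_forall fun θ => ?_)
    have hpos : 0 ≤ w k θ / (2 * Real.pi) := div_nonneg (hw k θ) (by positivity)
    simp only [ENNReal.toReal_ofReal hpos, Complex.real_smul]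
    push_cast
    ring
  · intro k _
    have : IsFiniteMeasure (Measure.map (fun θ => dir k * velocity K θ)
        ((volume.restrict (Set.Ioc (-Real.pi) Real.pi)).withDensity
          fun θ => ENNReal.ofReal (w k θ / (2 * Real.pi)))) := inferInstance
    refine (integrable_const (1 : ℝ)).mono' (Measurable.aestronglyMeasurable (by fun_prop))
      (.of_forall fun y => ?_)
    rw [← Complex.ofReal_mul, Complex.norm_exp_ofReal_mul_I]

theorem waveLaw_apply_eq_zero_iff {s : Set ℝ} (hs : MeasurableSet s)
    (hwm : ∀ k, Measurable (w k)) :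
    waveLaw K w s = 0 ↔ ∀ k, ∀ᵐ θ, θ ∈ Set.Ioc (-Real.pi) Real.pi →
      dir k * velocity K θ ∈ s → w k θ ≤ 0 := by
  simp only [waveLaw, Measure.finsetSum_apply, Finset.sum_eq_zero_iff, Finset.mem_univ,
    true_imp_iff]
  refine forall_congr' fun k => ?_
  have hms : MeasurableSet ((fun θ => dir k * velocity K θ) ⁻¹' s) :=
    measurable_dir_mul_velocity K k hs
  rw [Measure.map_apply (measurable_dir_mul_velocity K k) hs,
    withDensity_apply_eq_zero' (by have := hwm k; fun_prop), Measure.restrict_apply',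
    ae_iff]
  · refine iff_of_eq (congrArg (fun t => volume t = 0) ?_)
    ext θ
    simp only [Set.mem_inter_iff, Set.mem_ofPred_eq, Set.mem_preimage, ne_eq,
      ENNReal.ofReal_eq_zero, not_le, Classical.not_imp, div_pos_iff_of_pos_right
        (show 0 < 2 * Real.pi by positivity)]
    tauto
  · exact measurableSet_Ioc

end

/-! ### The limit law of a finitely supported state -/

/-- The weight of the `k`-th mode of the state `Ψ` at `θ`. -/
def modeWeight (K : Coin) (Ψ : Arc → ℂ) (k : Fin 3) (θ : ℝ) : ℝ :=
  ∑ a, ‖part K k θ (transform Ψ θ) a‖ ^ 2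

theorem modeWeight_nonneg (K : Coin) (Ψ : Arc → ℂ) (k : Fin 3) (θ : ℝ) :
    0 ≤ modeWeight K Ψ k θ := Finset.sum_nonneg fun _ _ => by positivity

theorem measurable_modeWeight (K : Coin) {Ψ : Arc → ℂ} (h : Ψ.support.Finite) (k : Fin 3) :
    Measurable (modeWeight K Ψ k) := by
  have h1 := measurable_part K k (continuous_transform h)
  unfold modeWeight
  refine Finset.measurable_sum _ fun a _ => ?_
  exact ((measurable_pi_apply a).comp h1).norm.pow_const 2

/-- Pythagoras for the mutually orthogonal spectral parts. -/
theorem sum_modeWeight (K : Coin) (Ψ : Arc → ℂ) {θ : ℝ} (h : Real.sin θ ≠ 0) :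
    ∑ k, modeWeight K Ψ k θ = ∑ a, ‖transform Ψ θ a‖ ^ 2 := by
  have h1 : sip (transform Ψ θ) (transform Ψ θ) = ∑ k, (modeWeight K Ψ k θ : ℂ) := by
    conv_lhs => rw [← sum_part K h (transform Ψ θ), sip_sum_sum]
    refine Finset.sum_congr rfl fun j _ => ?_
    rw [Finset.sum_eq_single j (fun k _ hkj => sip_part_part K h hkj.symm _ _)
      (fun hj => absurd (Finset.mem_univ j) hj), sip_self]
    rfl
  rw [sip_self] at h1
  exact_mod_cast h1.symm

theorem integrableOn_modeWeight (K : Coin) {Ψ : Arc → ℂ} (h : Ψ.support.Finite) (k : Fin 3) :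
    IntegrableOn (modeWeight K Ψ k) (Set.Ioc (-Real.pi) Real.pi) := by
  have hc := continuous_transform h
  have hQ : IntegrableOn (fun θ => ∑ a, ‖transform Ψ θ a‖ ^ 2) (Set.Ioc (-Real.pi) Real.pi) :=
    (by fun_prop : Continuous fun θ => ∑ a, ‖transform Ψ θ a‖ ^ 2).integrableOn_Ioc
  refine hQ.mono' (measurable_modeWeight K h k).aestronglyMeasurable
    (ae_restrict_of_ae ?_)
  filter_upwards [ae_sin_ne_zero] with θ hθ
  rw [← sum_modeWeight K Ψ hθ, Real.norm_of_nonneg (modeWeight_nonneg K Ψ k θ)]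
  exact Finset.single_le_sum (fun k _ => modeWeight_nonneg K Ψ k θ) (Finset.mem_univ k)

theorem tendsto_charFun_cellProb (K : Coin) {Ψ : Arc → ℂ} (h : Ψ.support.Finite) (ξ : ℝ) :
    Tendsto (fun n => charFun (scaledLaw (cellProb K Ψ) n) ξ) atTop
      (𝓝 (charFun (waveLaw K (modeWeight K Ψ)) ξ)) := by
  rw [charFun_waveLaw (modeWeight_nonneg K Ψ) (measurable_modeWeight K h)
    (integrableOn_modeWeight K h)]
  simp_rw [charFun_cellProb K h]
  have h1 := tendsto_integral_sip_iterate K (continuous_transform h) ξ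
  simp only [sip_self] at h1
  exact h1.const_mul _

theorem isProbabilityMeasure_waveLaw (K : Coin) {Ψ : Arc → ℂ} (h : Ψ.support.Finite)
    (hΨ : energy Ψ = 1) : IsProbabilityMeasure (waveLaw K (modeWeight K Ψ)) := by
  have := isFiniteMeasure_waveLaw (K := K) (integrableOn_modeWeight K h)
  have := isProbabilityMeasure_scaledLaw_cellProb K hΨ
  exact isProbabilityMeasure_of_tendsto_charFun (tendsto_charFun_cellProb K h)

theorem waveLaw_outside {K : Coin} {κ x : ℝ} (hκ : ∀ θ, |velocity K θ| ≤ κ) (hx : κ < x)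
    {w : Fin 3 → ℝ → ℝ} (hwm : ∀ k, Measurable (w k)) : waveLaw K w {y | x ≤ |y|} = 0 := by
  rw [waveLaw_apply_eq_zero_iff (measurableSet_le measurable_const (by fun_prop)) hwm]
  refine fun k => .of_forall fun θ _ hθ => ?_
  exfalso
  have h1 : |dir k| ≤ 1 := by fin_cases k <;> simp [dir]
  have h2 : x ≤ |dir k * velocity K θ| := hθ
  rw [abs_mul] at h2
  nlinarith [hκ θ, abs_nonneg (velocity K θ), abs_nonneg (dir k)]

theorem eventuallyWithin_of_finite_support {K : Coin} {κ x : ℝ} (hκ : ∀ θ, |velocity K θ| ≤ κ)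
    (hx : κ < x) {Ψ : Arc → ℂ} (h : Ψ.support.Finite) (hΨ : energy Ψ = 1) :
    EventuallyWithin (cellProb K Ψ) x :=
  eventuallyWithin_of_tendsto (isProbabilityMeasure_scaledLaw_cellProb K hΨ)
    (isProbabilityMeasure_waveLaw K h hΨ)
    (tendsto_probabilityMeasure _ _ (tendsto_charFun_cellProb K h))
    (waveLaw_outside hκ hx (measurable_modeWeight K h))

/-! ### States outside the localized subspace -/

theorem analyticOnNhd_transform {ψ : Arc → ℂ} (h : ψ.support.Finite) (a : A0) :
    AnalyticOnNhd ℝ (fun θ => transform ψ θ a) Set.univ := by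
  intro θ _
  simp only [transform_eq_sum h]
  refine Finset.analyticAt_fun_sum _ fun j _ => analyticAt_const.mul ?_
  have h1 : AnalyticAt ℝ (fun θ : ℝ => (((j : ℝ) * θ : ℝ) : ℂ) * Complex.I) θ := by
    refine AnalyticAt.mul ?_ analyticAt_const
    exact (Complex.ofRealCLM.analyticAt _).comp (analyticAt_const.mul analyticAt_id)
  exact analyticAt_cexp.restrictScalars.comp h1

theorem eq_zero_of_transform_eq_zero {ψ : Arc → ℂ} (h : ψ.support.Finite)
    (h0 : ∀ θ, transform ψ θ = 0) : ψ = 0 := by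
  have h1 := integral_sip_transform h 0
  simp only [h0, sip, Pi.zero_apply, mul_zero, Finset.sum_const_zero, zero_mul, Complex.ofReal_zero,
    Complex.exp_zero, mul_one, intervalIntegral.integral_zero] at h1
  have h2 : ∑ j ∈ cells h, ∑ a, ‖ψ (j, a)‖ ^ 2 = 0 := by
    have h3 := (mul_eq_zero.1 h1.symm).resolve_left
      (mul_ne_zero two_ne_zero (by exact_mod_cast Real.pi_ne_zero))
    exact_mod_cast h3
  ext ⟨j, a⟩
  by_cases hj : j ∈ cells h
  · have h4 := (Finset.sum_eq_zero_iff_of_nonneg fun j _ =>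
      Finset.sum_nonneg fun a _ => by positivity).1 h2 j hj
    have h5 := (Finset.sum_eq_zero_iff_of_nonneg fun a _ => by positivity).1 h4 a
      (Finset.mem_univ a)
    simpa using h5
  · exact eq_zero_of_notMem_cells h hj a

theorem transform_add {ψ φ : Arc → ℂ} (hψ : ψ.support.Finite) (hφ : φ.support.Finite) (θ : ℝ) :
    transform (ψ + φ) θ = transform ψ θ + transform φ θ := by
  ext a
  refine HasSum.tsum_eq (((hasSum_transform hψ θ a).add (hasSum_transform hφ θ a)).congr_fun
    fun j => ?_)
  simp only [Pi.add_apply, add_mul]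

/-- The transform of a finitely supported state is a trigonometric polynomial, so the identity
theorem spreads its zeros from an open set to the whole line. -/
theorem eq_zero_of_transform_ae_eq_zero {ψ : Arc → ℂ} (h : ψ.support.Finite) {O : Set ℝ}
    (hO : IsOpen O) (hne : O.Nonempty) (h0 : ∀ᵐ θ, θ ∈ O → transform ψ θ = 0) : ψ = 0 := by
  refine eq_zero_of_transform_eq_zero h fun θ => ?_
  have h1 : Set.EqOn (transform ψ) 0 O :=
    Measure.eqOn_open_of_ae_eq (μ := volume) ((ae_restrict_iff' hO.measurableSet).2 h0) hO
      (continuous_transform h).continuousOn continuousOn_const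
  obtain ⟨θ₀, hθ₀⟩ := hne
  ext a
  refine (analyticOnNhd_transform h a).eqOn_zero_of_preconnected_of_eventuallyEq_zero
    isPreconnected_univ (Set.mem_univ θ₀) ?_ (Set.mem_univ θ)
  filter_upwards [hO.mem_nhds hθ₀] with φ hφ
  rw [h1 hφ]
  rfl

/-- If some x < κ sufficed, the limit law would have no mass beyond x, and the weights of both
moving bands would vanish almost everywhere on the nonempty open set v > x in (0, π). There only the
flat band W = -1 remains, and analyticity extends U²Ψ = -Ψ to the whole state. -/
theorem isPseudoVelocity_of_finite_support {K : Coin} {κ : ℝ} (hκ : ∀ θ, |velocity K θ| ≤ κ)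
    (hκ' : ∀ x < κ, ∃ θ ∈ Set.Ioo 0 Real.pi, x < velocity K θ) {Ψ : Arc → ℂ}
    (h : Ψ.support.Finite) (hΨ : energy Ψ = 1) (hloc : step K (step K Ψ) ≠ -Ψ) :
    IsPseudoVelocity (cellProb K Ψ) κ := by
  refine ⟨fun x hx => ?_, fun b hb => le_of_forall_gt_imp_ge_of_dense fun x hx =>
    hb (eventuallyWithin_of_finite_support hκ hx h hΨ)⟩
  by_contra! hlt
  have h1 := measure_eq_zero_of_eventuallyWithin (isProbabilityMeasure_scaledLaw_cellProb K hΨ)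
    (isProbabilityMeasure_waveLaw K h hΨ)
    (tendsto_probabilityMeasure _ _ (tendsto_charFun_cellProb K h)) hx
  rw [waveLaw_apply_eq_zero_iff (measurableSet_lt measurable_const (by fun_prop))
    (measurable_modeWeight K h)] at h1
  have h2 := finite_support_step K (finite_support_step K h)
  obtain ⟨θ₀, hθ₀, hv⟩ := hκ' x hlt
  have hsin : ∀ θ ∈ Set.Ioo 0 Real.pi, Real.sin θ ≠ 0 := fun θ hθ =>
    (Real.sin_pos_of_mem_Ioo hθ).ne'
  have hO : IsOpen (Set.Ioo 0 Real.pi ∩ velocity K ⁻¹' Set.Ioi x) :=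
    ContinuousOn.isOpen_inter_preimage
      (fun θ hθ => (continuousAt_velocity K (hsin θ hθ)).continuousWithinAt) isOpen_Ioo isOpen_Ioi
  have h3 : step K (step K Ψ) + Ψ = 0 := by
    refine eq_zero_of_transform_ae_eq_zero ?_ hO ⟨θ₀, hθ₀, hv⟩ ?_
    · exact (h2.union h).subset (Function.support_add _ _)
    · filter_upwards [h1 1, h1 2] with θ w1 w2 hθ
      have hmem : θ ∈ Set.Ioc (-Real.pi) Real.pi :=
        ⟨by linarith [hθ.1.1, Real.pi_pos], hθ.1.2.le⟩
      have hv : x < |velocity K θ| := lt_of_lt_of_le hθ.2 (le_abs_self _)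
      have hz : ∀ k, modeWeight K Ψ k θ ≤ 0 → part K k θ (transform Ψ θ) = 0 := by
        intro k hk
        have h4 := le_antisymm hk (modeWeight_nonneg K Ψ k θ)
        ext a
        simpa using (Finset.sum_eq_zero_iff_of_nonneg fun a _ => by positivity).1 h4 a
          (Finset.mem_univ a)
      have p1 := hz 1 (w1 hmem (by simpa [dir] using hv))
      have p2 := hz 2 (w2 hmem (by simpa [dir] using hv))
      have hsum := sum_part K (hsin θ hθ.1) (transform Ψ θ)
      rw [Fin.sum_univ_three, p1, p2, add_zero, add_zero] at hsum
      have h5 := fstep2_part K 0 (hsin θ hθ.1) (transform Ψ θ)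
      rw [hsum, ev_zero] at h5
      rw [transform_add h2 h, transform_step K (finite_support_step K h), transform_step K h]
      change fstep2 K (circ θ) (transform Ψ θ) + transform Ψ θ = 0
      rw [h5]
      simp
  exact hloc (eq_neg_of_add_eq_zero_left h3)

/-! ### The range of the group velocity -/

/-- The dispersion relation is the spherical law of cosines with sides `α` and `β`. -/
structure HasAngles (K : Coin) (α β : ℝ) : Prop where
  pos : 0 < β
  le_half : β ≤ Real.pi / 2
  le : β ≤ α
  le_sub : α ≤ Real.pi - β
  a_eq : K.a = Real.cos α * Real.cos β
  b_eq : K.b = Real.sin α * Real.sin β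

namespace HasAngles

variable {K : Coin} {α β : ℝ} (H : HasAngles K α β)

include H

theorem sin_pos : 0 < Real.sin β :=
  Real.sin_pos_of_pos_of_lt_pi H.pos (by linarith [H.le_half, Real.pi_pos])

theorem cos_nonneg : 0 ≤ Real.cos β :=
  Real.cos_nonneg_of_mem_Icc ⟨by linarith [H.pos, H.le_half], H.le_half⟩

theorem sin_alpha_pos : 0 < Real.sin α :=
  Real.sin_pos_of_pos_of_lt_pi (H.pos.trans_le H.le) (by linarith [H.pos, H.le_sub])

/-- The quantity is b(1 - y) - ay. Together with `edge_lower` it shows that ay / (b(1 - y)), the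
cosine used in `exists_lt_velocity`, lies in (-1, 1). -/
theorem edge_upper {y : ℝ} (hy : 0 ≤ y) (hyβ : y < Real.sin β ^ 2) :
    0 < K.b - (K.a + K.b) * y := by
  rw [H.a_eq, H.b_eq, ← Real.cos_sub]
  have h1 : 0 ≤ Real.sin (α - β) * Real.cos β :=
    mul_nonneg (Real.sin_nonneg_of_nonneg_of_le_pi (by linarith [H.le])
      (by linarith [H.le_sub, H.pos])) H.cos_nonneg
  have h2 : Real.sin α = Real.sin (α - β) * Real.cos β + Real.cos (α - β) * Real.sin β := by
    rw [← Real.sin_add]; ring_nf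
  have h3 : 0 ≤ Real.sin β * (Real.sin α - Real.cos (α - β) * Real.sin β) :=
    mul_nonneg H.sin_pos.le (by linarith)
  rcases le_or_gt (Real.cos (α - β)) 0 with h | h
  · have := mul_pos H.sin_alpha_pos H.sin_pos
    nlinarith
  · nlinarith

theorem edge_lower {y : ℝ} (hy : 0 ≤ y) (hyβ : y < Real.sin β ^ 2) :
    0 < K.b + (K.a - K.b) * y := by
  rw [H.a_eq, H.b_eq, ← Real.cos_add]
  have h1 : 0 ≤ Real.sin (α + β) * Real.cos β :=
    mul_nonneg (Real.sin_nonneg_of_nonneg_of_le_pi (by linarith [H.le, H.pos])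
      (by linarith [H.le_sub, H.pos])) H.cos_nonneg
  have h2 : Real.sin α = Real.sin (α + β) * Real.cos β - Real.cos (α + β) * Real.sin β := by
    rw [← Real.sin_sub]; ring_nf
  have h3 : 0 ≤ Real.sin β * (Real.sin α + Real.cos (α + β) * Real.sin β) :=
    mul_nonneg H.sin_pos.le (by linarith)
  rcases le_or_gt 0 (Real.cos (α + β)) with h | h
  · have := mul_pos H.sin_alpha_pos H.sin_pos
    nlinarith
  · nlinarith

/-- The discriminant that decides which velocities are attained. -/
theorem disc_pos {y : ℝ} (hyβ : y < Real.sin β ^ 2) :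
    0 < y ^ 2 - y * (1 - K.a ^ 2 + K.b ^ 2) + K.b ^ 2 := by
  have h1 : Real.sin β ≤ Real.sin α := by
    rcases le_total α (Real.pi / 2) with h | h
    · exact Real.sin_le_sin_of_le_of_le_pi_div_two (by linarith [H.pos, Real.pi_pos]) h H.le
    · rw [← Real.sin_pi_sub α]
      exact Real.sin_le_sin_of_le_of_le_pi_div_two (by linarith [H.pos, Real.pi_pos])
        (by linarith) (by linarith [H.le_sub])
  have h2 : Real.sin β ^ 2 ≤ Real.sin α ^ 2 := pow_le_pow_left₀ H.sin_pos.le h1 2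
  -- The roots of the quadratic are sin²α and sin²β, and the second is the smaller because β ≤ α ≤ π
  -- - β.
  have h3 : y ^ 2 - y * (1 - K.a ^ 2 + K.b ^ 2) + K.b ^ 2
      = (Real.sin α ^ 2 - y) * (Real.sin β ^ 2 - y) := by
    rw [H.a_eq, H.b_eq]
    have := Real.sin_sq_add_cos_sq α
    have := Real.sin_sq_add_cos_sq β
    have e1 : Real.cos α ^ 2 = 1 - Real.sin α ^ 2 := by linarith
    have e2 : Real.cos β ^ 2 = 1 - Real.sin β ^ 2 := by linarith
    rw [mul_pow, mul_pow, e1, e2]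
    ring
  rw [h3]
  exact mul_pos (by linarith) (by linarith)

/-- In a spherical triangle with sides α, β enclosing the angle θ, the third side is Ω. By the law
of sines 2v is sin β times the sine of the angle opposite α. The square in `key` is the
corresponding cosine term. -/
theorem velocity_sq_le (θ : ℝ) : velocity K θ ^ 2 ≤ (1 / 2 * Real.sin β) ^ 2 := by
  by_cases h : Real.sin θ = 0
  · rw [show velocity K θ = 0 by simp [velocity, h], zero_pow two_ne_zero]
    positivity
  have hm : 0 < 1 - cosPhase K θ ^ 2 := by linarith [cosPhase_sq_lt_one K h]
  rw [velocity, div_pow, Real.sq_sqrt hm.le, div_le_iff₀ hm]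
  have key : Real.sin β ^ 2 * (1 - cosPhase K θ ^ 2) - K.b ^ 2 * Real.sin θ ^ 2 =
      (Real.sin β * (Real.cos α * Real.sin β - Real.sin α * Real.cos β * Real.cos θ)) ^ 2 := by
    rw [cosPhase, H.a_eq, H.b_eq]
    have h1 := Real.sin_sq_add_cos_sq α
    have h2 := Real.sin_sq_add_cos_sq β
    have h3 := Real.sin_sq_add_cos_sq θ
    have e2 : Real.cos β ^ 2 = 1 - Real.sin β ^ 2 := by linarith
    have e3 : Real.sin θ ^ 2 = 1 - Real.cos θ ^ 2 := by linarith
    rw [e3]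
    linear_combination (-Real.sin β ^ 2) * h1
      + (-Real.sin β ^ 2 * Real.cos α ^ 2 - Real.sin β ^ 2 * Real.sin α ^ 2 * Real.cos θ ^ 2) * h2
  nlinarith [sq_nonneg (Real.sin β * (Real.cos α * Real.sin β
    - Real.sin α * Real.cos β * Real.cos θ))]

theorem abs_velocity_le (θ : ℝ) : |velocity K θ| ≤ 1 / 2 * Real.sin β :=
  abs_le_of_sq_le_sq (H.velocity_sq_le θ) (by linarith [H.sin_pos])

theorem exists_lt_velocity {x : ℝ} (hx : x < 1 / 2 * Real.sin β) :
    ∃ θ ∈ Set.Ioo 0 Real.pi, x < velocity K θ := by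
  have hb := K.b_pos
  have hpos : ∀ θ ∈ Set.Ioo 0 Real.pi, 0 < velocity K θ := by
    intro θ hθ
    have hs := Real.sin_pos_of_mem_Ioo hθ
    have := cosPhase_sq_lt_one K hs.ne'
    exact div_pos (by positivity) (Real.sqrt_pos.2 (by linarith))
  rcases lt_or_ge x 0 with h | h
  · have hmem : Real.pi / 2 ∈ Set.Ioo 0 Real.pi := ⟨by positivity, by linarith [Real.pi_pos]⟩
    exact ⟨_, hmem, h.trans (hpos _ hmem)⟩
  set y := 4 * x ^ 2 with hy
  have hy0 : 0 ≤ y := by positivity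
  have hyβ : y < Real.sin β ^ 2 := by nlinarith
  have hy1 : y < 1 := hyβ.trans_le (Real.sin_sq_le_one β)
  have h1 := H.edge_upper hy0 hyβ
  have h2 := H.edge_lower hy0 hyβ
  have h3 := H.disc_pos hyβ
  have hd : 0 < K.b * (1 - y) := mul_pos hb (by linarith)
  -- With 4v² compared to y = 4x², the deficit is, up to the factor 1 - y, the discriminant minus
  -- (b(1 - y) cos θ - ay)². This choice of cos θ annihilates the square.
  set c := K.a * y / (K.b * (1 - y)) with hc
  have hcd : c * (K.b * (1 - y)) = K.a * y := div_mul_cancel₀ _ hd.ne'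
  have hc1 : c < 1 := by rw [hc, div_lt_one hd]; nlinarith
  have hc2 : -1 < c := by rw [hc, lt_div_iff₀ hd]; nlinarith
  have hcos : Real.cos (Real.arccos c) = c := Real.cos_arccos hc2.le hc1.le
  have hmem : Real.arccos c ∈ Set.Ioo 0 Real.pi :=
    ⟨Real.arccos_pos.2 hc1, lt_of_le_of_ne (Real.arccos_le_pi c) fun h => by
      rw [Real.arccos_eq_pi] at h; linarith⟩
  refine ⟨_, hmem, lt_of_pow_lt_pow_left₀ 2 (hpos _ hmem).le ?_⟩
  have hs := Real.sin_pos_of_mem_Ioo hmem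
  have hm : 0 < 1 - cosPhase K (Real.arccos c) ^ 2 := by
    linarith [cosPhase_sq_lt_one K hs.ne']
  rw [velocity, div_pow, Real.sq_sqrt hm.le, lt_div_iff₀ hm]
  have hs2 : Real.sin (Real.arccos c) ^ 2 = 1 - c ^ 2 := by
    rw [Real.sin_sq, hcos]
  rw [mul_pow, hs2, cosPhase, hcos]
  have h4 : 0 < (1 - y) * (K.b ^ 2 * (1 - c ^ 2) - y * (1 - (K.a + K.b * c) ^ 2)) := by
    have e : (1 - y) * (K.b ^ 2 * (1 - c ^ 2) - y * (1 - (K.a + K.b * c) ^ 2)) =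
        y ^ 2 - y * (1 - K.a ^ 2 + K.b ^ 2) + K.b ^ 2 := by
      linear_combination (K.a * y - c * (K.b * (1 - y))) * hcd
    rw [e]; exact h3
  have h5 := (mul_pos_iff_of_pos_left (by linarith)).1 h4
  rw [hy] at h5
  linarith

end HasAngles

/-! ### The spectral edges in terms of the coin -/

section

variable {p q r : ℝ} (hp : p ∈ Set.Ioo (0 : ℝ) 1) (hq : q ∈ Set.Ioo (0 : ℝ) 1)
  (hr : r ∈ Set.Ioc (0 : ℝ) 1)

theorem lam0_sq_eq : lam0 p q r ^ 2 =
    1 - ((coin hp hq hr).sp * (coin hp hq hr).tm + (coin hp hq hr).sm * (coin hp hq hr).tp) ^ 2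
      ∧ 0 ≤ lam0 p q r := by
  have hp1 : 0 ≤ 1 - p := by linarith [hp.2]
  have hq1 : 0 ≤ 1 - q := by linarith [hq.2]
  have e : r * (√(p * (1 - q)) + √((1 - p) * q)) ^ 2 = ((coin hp hq hr).sp * (coin hp hq hr).tm
      + (coin hp hq hr).sm * (coin hp hq hr).tp) ^ 2 := by
    simp only [coin]
    rw [Real.sqrt_mul hp.1.le, Real.sqrt_mul hp1, Real.sqrt_mul hr.1.le, Real.sqrt_mul hr.1.le]
    linear_combination (-(√p * √(1 - q) + √(1 - p) * √q) ^ 2) * Real.sq_sqrt hr.1.le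
  refine ⟨?_, Real.sqrt_nonneg _⟩
  rw [lam0, Real.sq_sqrt, e]
  rw [e]
  have := (coin hp hq hr).neg_one_le_a_sub_b
  unfold Coin.a Coin.b at this
  linarith

theorem lam1_sq_eq : lam1 p q r ^ 2 =
    1 - ((coin hp hq hr).sp * (coin hp hq hr).tm - (coin hp hq hr).sm * (coin hp hq hr).tp) ^ 2
      ∧ 0 ≤ lam1 p q r := by
  have hp1 : 0 ≤ 1 - p := by linarith [hp.2]
  have hq1 : 0 ≤ 1 - q := by linarith [hq.2]
  have e : r * (√(p * (1 - q)) - √((1 - p) * q)) ^ 2 = ((coin hp hq hr).sp * (coin hp hq hr).tm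
      - (coin hp hq hr).sm * (coin hp hq hr).tp) ^ 2 := by
    simp only [coin]
    rw [Real.sqrt_mul hp.1.le, Real.sqrt_mul hp1, Real.sqrt_mul hr.1.le, Real.sqrt_mul hr.1.le]
    linear_combination (-(√p * √(1 - q) - √(1 - p) * √q) ^ 2) * Real.sq_sqrt hr.1.le
  refine ⟨?_, Real.sqrt_nonneg _⟩
  rw [lam1, Real.sq_sqrt, e]
  rw [e]
  have := (coin hp hq hr).neg_one_le_a_sub_b
  have := (coin hp hq hr).b_pos
  unfold Coin.a Coin.b at *
  linarith

theorem coin_a_eq : (coin hp hq hr).a = lam0 p q r ^ 2 + lam1 p q r ^ 2 - 1 := by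
  rw [(lam0_sq_eq hp hq hr).1, (lam1_sq_eq hp hq hr).1, Coin.a]
  ring

theorem coin_b_eq : (coin hp hq hr).b = lam1 p q r ^ 2 - lam0 p q r ^ 2 := by
  rw [(lam0_sq_eq hp hq hr).1, (lam1_sq_eq hp hq hr).1, Coin.b]
  ring

include hp hq hr in
theorem lam0_lt_lam1 : lam0 p q r < lam1 p q r := by
  have h := (coin hp hq hr).b_pos
  rw [coin_b_eq] at h
  exact lt_of_pow_lt_pow_left₀ 2 (lam1_sq_eq hp hq hr).2 (by linarith)

include hp hq hr in
theorem lam1_le_one : lam1 p q r ≤ 1 := by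
  have h := (lam1_sq_eq hp hq hr).1
  have h2 := (lam1_sq_eq hp hq hr).2
  nlinarith [sq_nonneg ((coin hp hq hr).sp * (coin hp hq hr).tm
    - (coin hp hq hr).sm * (coin hp hq hr).tp)]

/-- Since a = λ₀² + λ₁² - 1 and b = λ₁² - λ₀², the addition theorems factor both through θ₀ ± θ₁. -/
theorem hasAngles_coin : HasAngles (coin hp hq hr)
    (Real.arccos (lam0 p q r) + Real.arccos (lam1 p q r))
    (Real.arccos (lam0 p q r) - Real.arccos (lam1 p q r)) := by
  have h0 := (lam0_sq_eq hp hq hr).2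
  have h1 := lam1_le_one hp hq hr
  have h01 := lam0_lt_lam1 hp hq hr
  have hlt : Real.arccos (lam1 p q r) < Real.arccos (lam0 p q r) :=
    Real.arccos_lt_arccos (by linarith) h01 h1
  have hle : Real.arccos (lam0 p q r) ≤ Real.pi / 2 := Real.arccos_le_pi_div_two.2 h0
  have hn := Real.arccos_nonneg (lam1 p q r)
  have c0 : Real.cos (Real.arccos (lam0 p q r)) = lam0 p q r :=
    Real.cos_arccos (by linarith) (by linarith)
  have c1 : Real.cos (Real.arccos (lam1 p q r)) = lam1 p q r :=
    Real.cos_arccos (by linarith) h1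
  have s0 := Real.sin_sq_add_cos_sq (Real.arccos (lam0 p q r))
  have s1 := Real.sin_sq_add_cos_sq (Real.arccos (lam1 p q r))
  rw [c0] at s0
  rw [c1] at s1
  refine ⟨by linarith, by linarith, by linarith, by linarith, ?_, ?_⟩
  · rw [coin_a_eq, Real.cos_add, Real.cos_sub, c0, c1]
    linear_combination Real.sin (Real.arccos (lam0 p q r)) ^ 2 * s1 + (1 - lam1 p q r ^ 2) * s0
  · rw [coin_b_eq, Real.sin_add, Real.sin_sub, c0, c1]
    linear_combination - lam1 p q r ^ 2 * s0 + lam0 p q r ^ 2 * s1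

end

/-! ### The mixed initial state -/

/-- Together with the dimension 6, the trace determines the multiplicities of the three eigenvalues.
-/
theorem trace_fstep2 (K : Coin) {z m : ℂ} (hz : z * conj z = 1)
    (hm : m = 1 - 2 * (overlap K z * conj (overlap K z))) :
    ∑ a, fstep2 K z (Pi.single a 1) a = -2 + 4 * m := by
  have hs := K.sq_s'
  have ht := K.sq_t'
  rw [hm, conj_overlap, overlap, sum_A0]
  simp [fstep2, fstep]
  linear_combination 4 * hs + (8 * K.sp ^ 2 + 8 * K.sm ^ 2 - 4 : ℂ) * ht
    + (8 * K.sm ^ 2 * K.tm ^ 2 - 4 * K.sm ^ 2 - 4 * K.tm ^ 2 + 2 + 8 * K.sm ^ 2 * K.tp ^ 2 : ℂ) * hz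

theorem sip_single (a : A0) (y : A0 → ℂ) : sip (Pi.single a 1) y = y a := by
  simp only [sip]
  rw [Finset.sum_eq_single a]
  · simp
  · intro b _ hb
    simp [hb]
  · simp

/-- The sum is the trace of an orthogonal projection, that is, the dimension of an eigenspace. The
dimensions add up to 6; the imaginary part of the trace of W gives equality for e^{±iΩ}, and the
real part makes both equal to 2. -/
theorem sum_normSq_part (K : Coin) {θ : ℝ} (h : Real.sin θ ≠ 0) (k : Fin 3) :
    ∑ a, ∑ b, ‖part K k θ (Pi.single a 1) b‖ ^ 2 = 2 := by
  set n : Fin 3 → ℝ := fun k => ∑ a, ∑ b, ‖part K k θ (Pi.single a 1) b‖ ^ 2 with hn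
  have hpart : ∀ k a, part K k θ (Pi.single a 1) a =
      ((∑ b, ‖part K k θ (Pi.single a 1) b‖ ^ 2 : ℝ) : ℂ) := by
    intro k a
    have h1 := sip_single a (part K k θ (Pi.single a 1))
    rw [← h1, ← sip_self]
    have h2 := sip_sum_sum Finset.univ {k} (fun j => part K j θ (Pi.single a 1))
      (fun j => part K j θ (Pi.single a 1))
    simp only [Finset.sum_singleton, sum_part K h] at h2
    rw [h2, Finset.sum_eq_single k (fun j _ hj => sip_part_part K h hj _ _)
      (fun hj => absurd (Finset.mem_univ k) hj)]
  have h6 : n 0 + n 1 + n 2 = 6 := by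
    have h1 : ((n 0 + n 1 + n 2 : ℝ) : ℂ) = 6 := by
      have h2 : ∀ a : A0, part K 0 θ (Pi.single a 1) a + part K 1 θ (Pi.single a 1) a
          + part K 2 θ (Pi.single a 1) a = 1 := by
        intro a
        have := congrFun (sum_part K h (Pi.single a 1)) a
        rw [Fin.sum_univ_three] at this
        simpa using this
      have h3 : ((n 0 + n 1 + n 2 : ℝ) : ℂ) = ∑ a : A0, (part K 0 θ (Pi.single a 1) a
          + part K 1 θ (Pi.single a 1) a + part K 2 θ (Pi.single a 1) a) := by
        simp only [hpart, hn, Finset.sum_add_distrib]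
        push_cast
        rfl
      rw [h3]
      simp only [h2, Finset.sum_const, Finset.card_univ, nsmul_eq_mul, mul_one]
      rfl
    exact_mod_cast h1
  have htr : (n 0 : ℂ) * ev K 0 θ + n 1 * ev K 1 θ + n 2 * ev K 2 θ = -2 + 4 * cosPhase K θ := by
    rw [← trace_fstep2 K (circ_mul_conj θ) (cosPhase_eq_overlap K θ)]
    have h2 : ∀ a : A0, fstep2 K (circ θ) (Pi.single a 1) a =
        part K 0 θ (Pi.single a 1) a * ev K 0 θ + part K 1 θ (Pi.single a 1) a * ev K 1 θ
          + part K 2 θ (Pi.single a 1) a * ev K 2 θ := by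
      intro a
      conv_lhs => rw [← sum_part K h (Pi.single a 1), map_sum, Fin.sum_univ_three,
        fstep2_part K _ h, fstep2_part K _ h, fstep2_part K _ h]
      simp only [Pi.add_apply, Pi.smul_apply, smul_eq_mul]
      ring
    simp only [h2, hpart, hn, Finset.sum_add_distrib, ← Finset.sum_mul]
    push_cast
    rfl
  rw [ev_zero, ev_one K h, ev_two K h] at htr
  have hre := congrArg Complex.re htr
  have him := congrArg Complex.im htr
  simp [-Complex.ofReal_sin] at hre him
  have hs := (sin_phase_pos K h).ne'
  have hm := neg_one_lt_cosPhase K h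
  have e12 : n 1 = n 2 := by
    have : (n 1 - n 2) * Real.sin (phase K θ) = 0 := by linarith
    have := (mul_eq_zero.1 this).resolve_right hs
    linarith
  have e1 : n 1 = 2 := by
    have : (n 1 - 2) * (1 + cosPhase K θ) = 0 := by
      rw [← e12] at hre h6
      linear_combination hre / 2 + h6 / 2
    have := (mul_eq_zero.1 this).resolve_right (by linarith)
    linarith
  fin_cases k
  · change n 0 = 2; linarith
  · exact e1
  · exact e12.symm.trans e1

/-- The distribution of the walk with the mixed initial state. -/
def mixedCellProb (K : Coin) (n : ℕ) (j : ℤ) : ℝ :=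
  ∑ a : A0, 1 / 6 * cellProb K (Pi.single ((0, a) : Arc) 1) n j

theorem scaledLaw_mixedCellProb (K : Coin) (n : ℕ) :
    scaledLaw (mixedCellProb K) n = ∑ a : A0, ENNReal.ofReal (1 / 6) •
      scaledLaw (cellProb K (Pi.single ((0, a) : Arc) 1)) n := by
  ext s hs
  simp only [Measure.finsetSum_apply, Measure.smul_apply, scaledLaw_apply hs, smul_eq_mul,
    ← ENNReal.tsum_mul_left]
  rw [← Summable.tsum_finsetSum fun _ _ => ENNReal.summable]
  refine tsum_congr fun j => ?_
  rw [mixedCellProb, ENNReal.ofReal_sum_of_nonneg fun a _ =>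
    mul_nonneg (by norm_num) (cellProb_nonneg K _ n j), Finset.sum_mul]
  refine Finset.sum_congr rfl fun a _ => ?_
  rw [ENNReal.ofReal_mul (by norm_num), mul_assoc]

theorem finite_support_single (a : A0) :
    (Pi.single ((0, a) : Arc) (1 : ℂ) : Arc → ℂ).support.Finite :=
  (Set.finite_singleton ((0, a) : Arc)).subset Pi.support_single_subset

theorem energy_single (a : A0) : energy (Pi.single ((0, a) : Arc) (1 : ℂ)) = 1 := by
  rw [energy_eq_tsum, tsum_eq_single ((0, a) : Arc)]
  · simp
  · intro b hb
    simp [hb]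

theorem transform_single (a : A0) (θ : ℝ) :
    transform (Pi.single ((0, a) : Arc) 1) θ = Pi.single a 1 := by
  ext b
  rw [transform, tsum_eq_single 0]
  · by_cases hb : b = a
    · subst hb; simp
    · simp [hb]
  · intro j hj
    have : ((j, b) : Arc) ≠ (0, a) := by simp [hj]
    simp [Pi.single_eq_of_ne this]

theorem isProbabilityMeasure_scaledLaw_mixedCellProb (K : Coin) (n : ℕ) :
    IsProbabilityMeasure (scaledLaw (mixedCellProb K) n) := by
  refine ⟨?_⟩
  rw [scaledLaw_mixedCellProb]
  simp only [Measure.finsetSum_apply, Measure.smul_apply, scaledLaw_cellProb_univ, energy_single,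
    smul_eq_mul, mul_one, Finset.sum_const, Finset.card_univ, nsmul_eq_mul]
  rw [show Fintype.card A0 = 6 from rfl, ← ENNReal.ofReal_natCast, ← ENNReal.ofReal_mul (by norm_num)]
  norm_num

theorem charFun_mixedCellProb (K : Coin) (n : ℕ) (ξ : ℝ) :
    charFun (scaledLaw (mixedCellProb K) n) ξ =
      ∑ a : A0, (1 / 6 : ℂ) * charFun (scaledLaw (cellProb K (Pi.single ((0, a) : Arc) 1)) n) ξ := by
  rw [scaledLaw_mixedCellProb, charFun_apply_real, integral_finsetSum_measure]
  · refine Finset.sum_congr rfl fun a _ => ?_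
    rw [integral_smul_measure, charFun_apply_real, ENNReal.toReal_ofReal (by norm_num),
      Complex.real_smul]
    norm_num
  · intro a _
    have := isProbabilityMeasure_scaledLaw_cellProb K (energy_single a) n
    refine Integrable.smul_measure ?_ ENNReal.ofReal_ne_top
    refine (integrable_const (1 : ℝ)).mono' (Measurable.aestronglyMeasurable (by fun_prop))
      (.of_forall fun y => ?_)
    rw [← Complex.ofReal_mul, Complex.norm_exp_ofReal_mul_I]

/-- At almost every θ the six initial states together give weight 2 to each band, and averaging
turns this into 2/6 = 1/3. -/
theorem tendsto_charFun_mixedCellProb (K : Coin) (ξ : ℝ) :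
    Tendsto (fun n => charFun (scaledLaw (mixedCellProb K) n) ξ) atTop
      (𝓝 (charFun (waveLaw K fun _ _ => 1 / 3) ξ)) := by
  have hlim : charFun (waveLaw K fun _ _ => 1 / 3) ξ = ∑ a : A0, (1 / 6 : ℂ) *
      charFun (waveLaw K (modeWeight K (Pi.single ((0, a) : Arc) 1))) ξ := by
    rw [charFun_waveLaw (fun _ _ => by norm_num) (fun _ => measurable_const) (fun _ => by simp)]
    have e : ∀ a : A0, (1 / 6 : ℂ) *
        charFun (waveLaw K (modeWeight K (Pi.single ((0, a) : Arc) 1))) ξ =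
        (2 * Real.pi : ℂ)⁻¹ * ∫ θ in -Real.pi..Real.pi, (1 / 6 : ℂ) *
          ∑ k, Complex.exp ((ξ * (dir k * velocity K θ) : ℝ) * Complex.I)
            * (modeWeight K (Pi.single ((0, a) : Arc) 1) k θ : ℂ) := by
      intro a
      rw [charFun_waveLaw (modeWeight_nonneg K _)
        (measurable_modeWeight K (finite_support_single a))
        (integrableOn_modeWeight K (finite_support_single a)),
        intervalIntegral.integral_const_mul]
      ring
    simp_rw [e, ← Finset.mul_sum]
    rw [← intervalIntegral.integral_finsetSum]
    · congr 1
      refine intervalIntegral.integral_congr_ae ?_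
      filter_upwards [ae_sin_ne_zero] with θ hθ _
      simp only [Finset.mul_sum]
      rw [Finset.sum_comm]
      refine Finset.sum_congr rfl fun k _ => ?_
      simp only [mul_left_comm, ← Finset.mul_sum]
      congr 1
      rw [← Complex.ofReal_sum]
      have h2 : ∑ a, modeWeight K (Pi.single ((0, a) : Arc) 1) k θ = 2 := by
        simp only [modeWeight, transform_single]
        exact sum_normSq_part K hθ k
      rw [h2]
      norm_num
    · intro a _
      refine IntervalIntegrable.const_mul ?_ _
      refine (intervalIntegrable_iff_integrableOn_Ioc_of_le (by linarith [Real.pi_pos])).2 ?_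
      exact integrable_finsetSum _ fun k _ =>
        integrableOn_exp_mul (integrableOn_modeWeight K (finite_support_single a)) ξ k
  rw [hlim]
  simp_rw [charFun_mixedCellProb]
  exact tendsto_finsetSum _ fun a _ =>
    (tendsto_charFun_cellProb K (finite_support_single a) ξ).const_mul _

theorem isProbabilityMeasure_waveLaw_const (K : Coin) :
    IsProbabilityMeasure (waveLaw K fun _ _ => 1 / 3) := by
  have := isFiniteMeasure_waveLaw (K := K) (w := fun _ _ => 1 / 3) fun _ => by simp
  have := isProbabilityMeasure_scaledLaw_mixedCellProb K
  exact isProbabilityMeasure_of_tendsto_charFun (tendsto_charFun_mixedCellProb K)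

theorem isPseudoVelocity_mixedCellProb {K : Coin} {κ : ℝ} (hκ : ∀ θ, |velocity K θ| ≤ κ)
    (hκ' : ∀ x < κ, ∃ θ ∈ Set.Ioo 0 Real.pi, x < velocity K θ) :
    IsPseudoVelocity (mixedCellProb K) κ := by
  have hlim := tendsto_probabilityMeasure (isProbabilityMeasure_scaledLaw_mixedCellProb K)
    (isProbabilityMeasure_waveLaw_const K) (tendsto_charFun_mixedCellProb K)
  refine ⟨fun x hx => ?_, fun b hb => le_of_forall_gt_imp_ge_of_dense fun x hx =>
    hb (eventuallyWithin_of_tendsto _ _ hlim (waveLaw_outside hκ hx fun _ => measurable_const))⟩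
  by_contra! hlt
  have h1 := measure_eq_zero_of_eventuallyWithin _ _ hlim hx
  rw [waveLaw_apply_eq_zero_iff (measurableSet_lt measurable_const (by fun_prop))
    fun _ => measurable_const] at h1
  obtain ⟨θ₀, hθ₀, hv⟩ := hκ' x hlt
  have hO : IsOpen (Set.Ioo 0 Real.pi ∩ velocity K ⁻¹' Set.Ioi x) :=
    ContinuousOn.isOpen_inter_preimage
      (fun θ hθ => (continuousAt_velocity K
        (Real.sin_pos_of_mem_Ioo hθ).ne').continuousWithinAt) isOpen_Ioo isOpen_Ioi
  refine (hO.measure_pos volume ⟨θ₀, hθ₀, hv⟩).ne' (measure_mono_null (fun θ hθ => ?_) (h1 1))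
  have hmem : θ ∈ Set.Ioc (-Real.pi) Real.pi := ⟨by linarith [hθ.1.1, Real.pi_pos], hθ.1.2.le⟩
  have hv : x < |velocity K θ| := lt_of_lt_of_le hθ.2 (le_abs_self _)
  simp only [Set.mem_compl_iff, Set.mem_ofPred_eq, Classical.not_imp, not_le]
  exact ⟨hmem, by simpa [dir] using hv, by norm_num⟩

/-! ### General initial states -/

/-- Finite truncations converge to Ψ in norm, and so do their normalizations because ‖Ψ‖ = 1. -/
theorem exists_finite_support_near (Ψ : lp (fun _ : Arc => ℂ) 2) (hΨ : ‖Ψ‖ = 1) {ε : ENNReal}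
    (hε : 0 < ε) : ∃ Φ : lp (fun _ : Arc => ℂ) 2, ‖Φ‖ = 1 ∧
      (Function.support (Φ : Arc → ℂ)).Finite ∧ energy ((Ψ - Φ : lp (fun _ : Arc => ℂ) 2)) < ε := by
  classical
  have h1 : Tendsto (fun s : Finset Arc => ∑ i ∈ s, lp.single (E := fun _ : Arc => ℂ) 2 i (Ψ i))
      atTop (𝓝 Ψ) := lp.hasSum_single (by norm_num) Ψ
  set T := fun s : Finset Arc => ∑ i ∈ s, lp.single (E := fun _ : Arc => ℂ) 2 i (Ψ i) with hT
  have h2 : Tendsto (fun s => ‖T s‖) atTop (𝓝 1) := hΨ ▸ h1.norm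
  have h3 : Tendsto (fun s => (‖T s‖⁻¹ : ℝ) • T s) atTop (𝓝 Ψ) := by
    simpa using (h2.inv₀ one_ne_zero).smul h1
  have h4 : Tendsto (fun s => ENNReal.ofReal (‖Ψ - (‖T s‖⁻¹ : ℝ) • T s‖ ^ 2)) atTop (𝓝 0) := by
    have := ENNReal.tendsto_ofReal (((tendsto_const_nhds (x := Ψ)).sub h3).norm.pow 2)
    simpa using this
  obtain ⟨s, hs1, hs2⟩ := ((h4.eventually_lt_const hε).and (h2.eventually_ne one_ne_zero)).exists
  refine ⟨(‖T s‖⁻¹ : ℝ) • T s, ?_, ?_, ?_⟩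
  · rw [norm_smul, norm_inv, norm_norm, inv_mul_cancel₀ hs2]
  · refine s.finite_toSet.subset fun e he => ?_
    by_contra hn
    apply he
    have : ∀ t : Finset Arc, e ∉ t →
        (∑ i ∈ t, lp.single (E := fun _ : Arc => ℂ) 2 i (Ψ i) : lp (fun _ : Arc => ℂ) 2) e = 0 := by
      intro t ht
      rw [lp.coeFn_sum, Finset.sum_apply]
      refine Finset.sum_eq_zero fun i hi => ?_
      have hei : e ≠ i := fun h => ht (h ▸ hi)
      simp [lp.single_apply, hei]
    rw [lp.coeFn_smul, Pi.smul_apply, this s hn, smul_zero]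
  · rwa [energy_lp]

/-- From |x + y|² ≤ 2|x|² + 2|y|². Conservation of energy makes the error term independent of n. -/
theorem scaledLaw_cellProb_le (K : Coin) (Ψ Φ : Arc → ℂ) (n : ℕ) {s : Set ℝ}
    (hs : MeasurableSet s) : scaledLaw (cellProb K (Ψ + Φ)) n s ≤
      2 * scaledLaw (cellProb K Ψ) n s + 2 * energy Φ := by
  have h1 : scaledLaw (cellProb K Φ) n s ≤ energy Φ := by
    rw [← scaledLaw_cellProb_univ K Φ n]
    exact measure_mono (Set.subset_univ _)
  refine le_trans ?_ (add_le_add_right (mul_le_mul_right h1 2) _)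
  simp only [scaledLaw_apply hs, ← ENNReal.tsum_mul_left, ← ENNReal.tsum_add]
  refine ENNReal.tsum_le_tsum fun j => ?_
  rw [← mul_assoc, ← mul_assoc, ← add_mul]
  gcongr
  rw [show (2 : ENNReal) = ENNReal.ofReal 2 by simp, ← ENNReal.ofReal_mul (by norm_num),
    ← ENNReal.ofReal_mul (by norm_num), ← ENNReal.ofReal_add
      (mul_nonneg (by norm_num) (cellProb_nonneg ..)) (mul_nonneg (by norm_num) (cellProb_nonneg ..))]
  refine ENNReal.ofReal_le_ofReal ?_
  simp only [cellProb, Finset.mul_sum, ← Finset.sum_add_distrib, iterate_step_add, Pi.add_apply]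
  refine Finset.sum_le_sum fun a _ => ?_
  have := norm_add_le ((step K)^[n] Ψ (j, a)) ((step K)^[n] Φ (j, a))
  have := norm_nonneg ((step K)^[n] Ψ (j, a) + (step K)^[n] Φ (j, a))
  nlinarith [sq_nonneg (‖(step K)^[n] Ψ (j, a)‖ - ‖(step K)^[n] Φ (j, a)‖)]

/-- The mass outside is at most twice that of a nearby finitely supported state plus twice the
conserved energy of the difference. Passing to complements lets the two small quantities be added.
-/
theorem eventuallyWithin_of_lp {K : Coin} {κ x : ℝ} (hκ : ∀ θ, |velocity K θ| ≤ κ)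
    (hx : κ < x) (Ψ : lp (fun _ : Arc => ℂ) 2) (hΨ : ‖Ψ‖ = 1) :
    EventuallyWithin (cellProb K Ψ) x := by
  have hm : MeasurableSet {y : ℝ | |y| < x} := measurableSet_lt (by fun_prop) measurable_const
  have hprob : ∀ Φ : lp (fun _ : Arc => ℂ) 2, ‖Φ‖ = 1 →
      ∀ n, IsProbabilityMeasure (scaledLaw (cellProb K Φ) n) := fun Φ hΦ =>
    isProbabilityMeasure_scaledLaw_cellProb K (by rw [energy_lp, hΦ]; simp)
  have hcompl : ∀ Φ : lp (fun _ : Arc => ℂ) 2, ‖Φ‖ = 1 →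
      (EventuallyWithin (cellProb K Φ) x ↔
        Tendsto (fun n => scaledLaw (cellProb K Φ) n {y : ℝ | |y| < x}ᶜ) atTop (𝓝 0)) := by
    intro Φ hΦ
    have := hprob Φ hΦ
    constructor
    · intro h
      simp only [prob_compl_eq_one_sub hm]
      simpa using ENNReal.Tendsto.sub (tendsto_const_nhds (x := (1 : ENNReal))) h
        (.inl ENNReal.one_ne_top)
    · intro h
      have h2 := ENNReal.Tendsto.sub (tendsto_const_nhds (x := (1 : ENNReal))) h
        (.inl ENNReal.one_ne_top)
      rw [tsub_zero] at h2
      refine h2.congr fun n => ?_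
      rw [← prob_compl_eq_one_sub hm.compl, compl_compl]
  rw [hcompl Ψ hΨ, ENNReal.tendsto_nhds_zero]
  intro ε hε
  have hε4 : 0 < ε / 2 / 2 := ENNReal.half_pos (ENNReal.half_pos hε.ne').ne'
  obtain ⟨Φ, hΦ, hfin, hclose⟩ := exists_finite_support_near Ψ hΨ hε4
  have h1 := (hcompl Φ hΦ).1 (eventuallyWithin_of_finite_support hκ hx hfin
    (by rw [energy_lp, hΦ]; simp))
  filter_upwards [ENNReal.tendsto_nhds_zero.1 h1 _ hε4] with n hn
  have h2 := scaledLaw_cellProb_le K Φ (Ψ - Φ : lp (fun _ : Arc => ℂ) 2) n hm.compl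
  rw [lp.coeFn_sub, add_sub_cancel, ← lp.coeFn_sub] at h2
  refine h2.trans ?_
  calc _ ≤ 2 * (ε / 2 / 2) + 2 * (ε / 2 / 2) := by gcongr
    _ = ε := by
      rw [ENNReal.mul_div_cancel two_ne_zero ENNReal.ofNat_ne_top, ENNReal.add_halves]

/-! ### The density of the group velocity -/

/-- `K` has the spectral edges `l0 < l1`, with `l0 > 0`. -/
structure HasEdges (K : Coin) (l0 l1 α β : ℝ) : Prop extends HasAngles K α β where
  a_eq' : K.a = l0 ^ 2 + l1 ^ 2 - 1
  b_eq' : K.b = l1 ^ 2 - l0 ^ 2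
  l0_pos : 0 < l0

/-- The signed root of the discriminant at `θ`, proportional to the derivative of the group
velocity. -/
def signedRoot (K : Coin) (θ : ℝ) : ℝ :=
  K.b * (1 - 4 * velocity K θ ^ 2) * Real.cos θ - K.a * (4 * velocity K θ ^ 2)

theorem four_mul_velocity_sq (K : Coin) {θ : ℝ} (h : Real.sin θ ≠ 0) :
    4 * velocity K θ ^ 2 * (1 - cosPhase K θ ^ 2) = K.b ^ 2 * Real.sin θ ^ 2 := by
  have hm : 0 < 1 - cosPhase K θ ^ 2 := by linarith [cosPhase_sq_lt_one K h]
  rw [velocity, div_pow, Real.sq_sqrt hm.le]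
  field_simp
  ring

theorem hasDerivAt_velocity (K : Coin) {θ : ℝ} (h : Real.sin θ ≠ 0) :
    HasDerivAt (velocity K) (signedRoot K θ / (2 * √(1 - cosPhase K θ ^ 2))) θ := by
  have hm : 0 < 1 - cosPhase K θ ^ 2 := by linarith [cosPhase_sq_lt_one K h]
  have hR : 0 < √(1 - cosPhase K θ ^ 2) := Real.sqrt_pos.2 hm
  have hR2 := Real.sq_sqrt hm.le
  have hV := four_mul_velocity_sq K h
  have h1 : HasDerivAt (cosPhase K) (K.b * -Real.sin θ) θ :=
    ((Real.hasDerivAt_cos θ).const_mul K.b).const_add K.a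
  have h2 := (((h1.fun_pow 2).const_sub 1).sqrt hm.ne')
  have h3 := ((Real.hasDerivAt_sin θ).const_mul (K.b / 2)).fun_div h2 hR.ne'
  refine h3.congr_deriv ?_
  have hE : signedRoot K θ * (1 - cosPhase K θ ^ 2) =
      K.b * (Real.cos θ * (1 - cosPhase K θ ^ 2) - K.b * Real.sin θ ^ 2 * cosPhase K θ) := by
    rw [signedRoot]
    have : K.a + K.b * Real.cos θ = cosPhase K θ := rfl
    linear_combination (-K.b * Real.cos θ - K.a) * hV - K.b ^ 2 * Real.sin θ ^ 2 * this
  set R := √(1 - cosPhase K θ ^ 2)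
  rw [← hR2] at hE
  field_simp
  norm_num
  linear_combination -2 * hE

theorem measurable_signedRoot (K : Coin) : Measurable (signedRoot K) := by
  unfold signedRoot; fun_prop

theorem velocity_pos (K : Coin) {θ : ℝ} (hθ : θ ∈ Set.Ioo 0 Real.pi) : 0 < velocity K θ := by
  have hs := Real.sin_pos_of_mem_Ioo hθ
  have := cosPhase_sq_lt_one K hs.ne'
  have := K.b_pos
  exact div_pos (by positivity) (Real.sqrt_pos.2 (by linarith))

/-- For y = 4v² and c = cos θ the right-hand side vanishes by `four_mul_velocity_sq`, so the
discriminant in y is the square of `signedRoot`. Conversely, solving for c inverts the velocity on a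
branch. -/
theorem disc_eq (K : Coin) (y c : ℝ) :
    y ^ 2 - y * (1 - K.a ^ 2 + K.b ^ 2) + K.b ^ 2 - (K.b * (1 - y) * c - K.a * y) ^ 2 =
      (1 - y) * (K.b ^ 2 * (1 - c ^ 2) - y * (1 - (K.a + K.b * c) ^ 2)) := by
  ring

theorem disc_velocity (K : Coin) {θ : ℝ} (h : Real.sin θ ≠ 0) :
    (4 * velocity K θ ^ 2) ^ 2 - 4 * velocity K θ ^ 2 * (1 - K.a ^ 2 + K.b ^ 2) + K.b ^ 2 =
      signedRoot K θ ^ 2 := by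
  have h1 := disc_eq K (4 * velocity K θ ^ 2) (Real.cos θ)
  have h2 := four_mul_velocity_sq K h
  rw [Real.sin_sq, cosPhase] at h2
  rw [signedRoot]
  linear_combination h1 - (1 - 4 * velocity K θ ^ 2) * h2

namespace HasEdges

variable {K : Coin} {l0 l1 α β : ℝ} (H : HasEdges K l0 l1 α β)

include H

theorem phiFun_eq (x : ℝ) : phiFun l1 l0 x =
    (4 * x ^ 2) ^ 2 - 4 * x ^ 2 * (1 - K.a ^ 2 + K.b ^ 2) + K.b ^ 2 := by
  rw [phiFun, H.a_eq', H.b_eq']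
  ring

/-- The angle (α + β)/2 plays the role of θ₀, and β ≤ (α + β)/2 ≤ π/2. This keeps `uFun` positive
and the support inside that of Konno's density. -/
theorem sin_sq_le : Real.sin β ^ 2 ≤ 1 - l0 ^ 2 := by
  have h1 : Real.sin β ≤ Real.sin ((α + β) / 2) :=
    Real.sin_le_sin_of_le_of_le_pi_div_two (by linarith [H.pos, Real.pi_pos])
      (by linarith [H.le_sub]) (by linarith [H.le])
  have h2 : Real.sin ((α + β) / 2) ^ 2 = 1 - l0 ^ 2 := by
    rw [Real.sin_sq_eq_half_sub]
    have : Real.cos (2 * ((α + β) / 2)) = K.a - K.b := by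
      rw [mul_div_cancel₀ _ two_ne_zero, Real.cos_add, H.a_eq, H.b_eq]
    rw [this, H.a_eq', H.b_eq']
    ring
  rw [← h2]
  exact pow_le_pow_left₀ H.sin_pos.le h1 2

theorem sin_sq_lt_one : Real.sin β ^ 2 < 1 :=
  H.sin_sq_le.trans_lt (by have := pow_pos H.l0_pos 2; linarith)

theorem uFun_pos {x : ℝ} (hx : 4 * x ^ 2 < Real.sin β ^ 2) : 0 < uFun l0 x := by
  have := H.sin_sq_le
  rw [uFun]
  linarith

/-- The nested fraction clears because 1 + (1 - λ₁²)η/u² = φ/u². -/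
theorem gammaFun_eq {s x : ℝ} (hx : 4 * x ^ 2 < Real.sin β ^ 2) :
    gammaFun s x l1 l0 = √(uFun l0 x * (l0 ^ 2 * (uFun l0 x + s * √(phiFun l1 l0 x))
      + (1 - l1 ^ 2) * zetaFun (-s) l1 l0 x) / (2 * phiFun l1 l0 x * l0 ^ 2)) := by
  have hu := H.uFun_pos hx
  have hφ : 0 < phiFun l1 l0 x := by
    rw [H.phiFun_eq]; exact H.disc_pos hx
  have h1 : 1 + (1 - l1 ^ 2) * etaFun l1 l0 x / uFun l0 x ^ 2
      = phiFun l1 l0 x / uFun l0 x ^ 2 := by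
    rw [eq_div_iff (by positivity), add_mul, div_mul_cancel₀ _ (by positivity)]
    unfold etaFun uFun phiFun
    ring
  have h0 := H.l0_pos
  rw [gammaFun, h1, Real.sqrt_div hφ.le, Real.sqrt_sq hu.le]
  congr 1
  field_simp

/-- The velocity density of a branch, at the velocity of a mode on this branch. -/
theorem gammaFun_velocity {s θ : ℝ} (hθ : θ ∈ Set.Ioo 0 Real.pi) (hs : s ^ 2 = 1)
    (hE : 0 < -s * signedRoot K θ) (hV : 4 * velocity K θ ^ 2 < Real.sin β ^ 2) :
    gammaFun s (velocity K θ) l1 l0 = √(uFun l0 (velocity K θ)) * (1 - 4 * velocity K θ ^ 2)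
      * √(1 - cosPhase K θ ^ 2) / (2 * |signedRoot K θ| * l0) := by
  have hsin := (Real.sin_pos_of_mem_Ioo hθ).ne'
  have hm : 0 < 1 - cosPhase K θ ^ 2 := by linarith [cosPhase_sq_lt_one K hsin]
  have hu := H.uFun_pos hV
  have h0 := H.l0_pos
  have hφ : phiFun l1 l0 (velocity K θ) = signedRoot K θ ^ 2 := by
    rw [H.phiFun_eq, disc_velocity K hsin]
  have hR : √(phiFun l1 l0 (velocity K θ)) = -s * signedRoot K θ := by
    rw [hφ, ← Real.sqrt_sq hE.le, mul_pow, neg_sq, hs, one_mul]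
  have hy1 : 0 < 1 - 4 * velocity K θ ^ 2 := by linarith [H.sin_sq_lt_one]
  have habs : 0 < |signedRoot K θ| := abs_pos.2 fun h => by rw [h, mul_zero] at hE; exact hE.false
  rw [H.gammaFun_eq hV]
  -- On the branch s one has s√φ = -`signedRoot`, and (1 - 4v²) cos Ω = a + `signedRoot`. So the
  -- bracket in γ collapses to ½(1 - 4v²)² sin²Ω.
  have key : l0 ^ 2 * (uFun l0 (velocity K θ) + s * √(phiFun l1 l0 (velocity K θ)))
      + (1 - l1 ^ 2) * zetaFun (-s) l1 l0 (velocity K θ) =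
      (1 - 4 * velocity K θ ^ 2) ^ 2 * (1 - cosPhase K θ ^ 2) / 2 := by
    have hd := disc_velocity K hsin
    have e1 : (1 - 4 * velocity K θ ^ 2) * cosPhase K θ = K.a + signedRoot K θ := by
      rw [cosPhase, signedRoot]; ring
    have e2 : (1 - 4 * velocity K θ ^ 2) ^ 2 * (1 - cosPhase K θ ^ 2) =
        (1 - 4 * velocity K θ ^ 2) ^ 2 - (K.a + signedRoot K θ) ^ 2 := by
      rw [← e1]; ring
    have e3 : s * √(phiFun l1 l0 (velocity K θ)) = -signedRoot K θ := by
      rw [hR]; linear_combination (-signedRoot K θ) * hs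
    have e4 : zetaFun (-s) l1 l0 (velocity K θ) =
        4 * (2 * l0 ^ 2 - 1) * velocity K θ ^ 2 + l1 ^ 2 + signedRoot K θ := by
      rw [zetaFun]; linear_combination -e3
    rw [e2, e3, e4, uFun]
    rw [H.a_eq', H.b_eq'] at hd
    rw [H.a_eq']
    linear_combination (-1 / 2 : ℝ) * hd
  rw [key, hφ, ← sq_abs (signedRoot K θ)]
  have e : uFun l0 (velocity K θ) * ((1 - 4 * velocity K θ ^ 2) ^ 2 * (1 - cosPhase K θ ^ 2) / 2)
      / (2 * |signedRoot K θ| ^ 2 * l0 ^ 2) = (√(uFun l0 (velocity K θ))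
        * (1 - 4 * velocity K θ ^ 2) * √(1 - cosPhase K θ ^ 2)
          / (2 * |signedRoot K θ| * l0)) ^ 2 := by
    rw [div_pow, mul_pow, mul_pow, Real.sq_sqrt hu.le, Real.sq_sqrt hm.le]
    field_simp
  rw [e, Real.sqrt_sq (by positivity)]

theorem konno_eq {x : ℝ} (hx : 4 * x ^ 2 < Real.sin β ^ 2) :
    konno (2 * x) (√(1 - l0 ^ 2)) =
      l0 / (Real.pi * (1 - 4 * x ^ 2) * √(uFun l0 x)) := by
  have hu := H.uFun_pos hx
  have h0 := H.l0_pos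
  have hk : 0 ≤ 1 - l0 ^ 2 := by rw [uFun] at hu; nlinarith
  have hmem : 2 * x ∈ Set.Ioo (-√(1 - l0 ^ 2)) (√(1 - l0 ^ 2)) := by
    rw [Set.mem_Ioo, ← abs_lt]
    refine abs_lt_of_sq_lt_sq ?_ (Real.sqrt_nonneg _)
    rw [Real.sq_sqrt hk]
    rw [uFun] at hu
    linarith
  rw [konno, Set.indicator_of_mem hmem, Real.sq_sqrt hk, sub_sub_cancel, Real.sqrt_sq h0.le,
    mul_pow, uFun]
  norm_num

/-- The derivative of the velocity and the density of a branch are inverse to each other. -/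
theorem gammaFun_mul_konno_mul_deriv {s θ : ℝ} (hθ : θ ∈ Set.Ioo 0 Real.pi) (hs : s ^ 2 = 1)
    (hE : 0 < -s * signedRoot K θ) (hV : 4 * velocity K θ ^ 2 < Real.sin β ^ 2) :
    |signedRoot K θ / (2 * √(1 - cosPhase K θ ^ 2))|
      * (2 * Real.pi * (gammaFun s (velocity K θ) l1 l0
        * (2 * konno (2 * velocity K θ) (√(1 - l0 ^ 2))))) = 1 := by
  have hsin := (Real.sin_pos_of_mem_Ioo hθ).ne'
  have hm : 0 < √(1 - cosPhase K θ ^ 2) :=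
    Real.sqrt_pos.2 (by linarith [cosPhase_sq_lt_one K hsin])
  have hu := Real.sqrt_pos.2 (H.uFun_pos hV)
  have h0 := H.l0_pos
  have hy1 : 0 < 1 - 4 * velocity K θ ^ 2 := by linarith [H.sin_sq_lt_one]
  have habs : 0 < |signedRoot K θ| := abs_pos.2 fun h => by rw [h, mul_zero] at hE; exact hE.false
  rw [H.gammaFun_velocity hθ hs hE hV, H.konno_eq hV, abs_div, abs_of_pos (mul_pos two_pos hm)]
  have := Real.pi_pos
  field_simp

/-- At the extremal velocity the discriminant vanishes, and `signedRoot` with it. -/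
theorem four_velocity_sq_lt {θ : ℝ} (hθ : θ ∈ Set.Ioo 0 Real.pi) (hE : signedRoot K θ ≠ 0) :
    4 * velocity K θ ^ 2 < Real.sin β ^ 2 := by
  have hsin := (Real.sin_pos_of_mem_Ioo hθ).ne'
  have h1 := H.velocity_sq_le θ
  have h2 : 4 * velocity K θ ^ 2 ≤ Real.sin β ^ 2 := by linarith
  refine lt_of_le_of_ne h2 fun h3 => hE ?_
  have h4 := disc_velocity K hsin
  rw [h3, H.a_eq, H.b_eq] at h4
  have h5 : Real.cos β ^ 2 = 1 - Real.sin β ^ 2 := Real.cos_sq' β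
  have h6 : Real.cos α ^ 2 = 1 - Real.sin α ^ 2 := Real.cos_sq' α
  have h7 : signedRoot K θ ^ 2 = 0 := by
    rw [← h4, mul_pow, mul_pow, h5, h6]
    ring
  exact pow_eq_zero_iff two_ne_zero |>.1 h7

/-- Solving the quadratic for cos θ at given velocity gives one root per branch; it must be checked
that it lies in (-1, 1). For s = -1 and λ₁ = 1 the root would be 1, which is why this case is
excluded. -/
theorem image_velocity {s : ℝ} (hs : s = 1 ∨ s = -1 ∧ l1 < 1) (hl1 : 0 < l1) :
    velocity K '' {θ ∈ Set.Ioo 0 Real.pi | 0 < -s * signedRoot K θ} =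
      Set.Ioo 0 (1 / 2 * Real.sin β) := by
  have hs2 : s ^ 2 = 1 := by rcases hs with rfl | ⟨rfl, _⟩ <;> norm_num
  have hb := K.b_pos
  ext x
  constructor
  · rintro ⟨θ, ⟨hθ, hE⟩, rfl⟩
    have h1 := H.four_velocity_sq_lt hθ fun h => by rw [h, mul_zero] at hE; exact hE.false
    exact ⟨velocity_pos K hθ, lt_of_pow_lt_pow_left₀ 2 (by linarith [H.sin_pos]) (by linarith)⟩
  rintro ⟨hx0, hxκ⟩
  have hy0 : 0 < 4 * x ^ 2 := by positivity
  have hyβ : 4 * x ^ 2 < Real.sin β ^ 2 := by nlinarith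
  have hd := H.disc_pos hyβ
  have hP := H.edge_upper hy0.le hyβ
  have hP' := H.edge_lower hy0.le hyβ
  have hy1 : 4 * x ^ 2 < 1 := hyβ.trans H.sin_sq_lt_one
  set y := 4 * x ^ 2 with hy
  set D := y ^ 2 - y * (1 - K.a ^ 2 + K.b ^ 2) + K.b ^ 2 with hD
  have hR := Real.sqrt_pos.2 hd
  have hR2 := Real.sq_sqrt hd.le
  have hden : 0 < K.b * (1 - y) := mul_pos hb (by linarith)
  -- The solution of b(1 - y)c - ay = -s√D, the left-hand side being `signedRoot` at the velocity
  -- sought.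
  set c := (K.a * y - s * √D) / (K.b * (1 - y)) with hc
  have hcd : c * (K.b * (1 - y)) = K.a * y - s * √D := div_mul_cancel₀ _ hden.ne'
  have hapb : -1 < K.a + K.b := by linarith [K.neg_one_le_a_sub_b]
  have hamb : K.a - K.b < 1 := by linarith [K.a_add_b_le]
  have hc1 : c < 1 := by
    rw [hc, div_lt_one hden]
    rcases hs with rfl | ⟨rfl, hl⟩
    · linarith
    · have h1 : K.a + K.b < 1 := by rw [H.a_eq', H.b_eq']; nlinarith
      have h2 : √D < K.b - (K.a + K.b) * y := by
        refine lt_of_pow_lt_pow_left₀ 2 hP.le ?_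
        rw [hR2, hD, ← sub_pos]
        -- This product is exactly (b - (a + b)y)² - D; its positivity uses a + b < 1, which is λ₁ <
        -- 1.
        have : 0 < y * (1 - y) * ((1 - (K.a + K.b)) * (1 + (K.a + K.b))) :=
          mul_pos (mul_pos hy0 (by linarith)) (mul_pos (by linarith) (by linarith))
        linarith
      linarith
  have hc2 : -1 < c := by
    rw [hc, lt_div_iff₀ hden]
    rcases hs with rfl | ⟨rfl, hl⟩
    · have h1 : -1 < K.a - K.b := by
        rw [H.a_eq', H.b_eq']; have := pow_pos H.l0_pos 2; linarith
      have h2 : √D < K.b + (K.a - K.b) * y := by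
        refine lt_of_pow_lt_pow_left₀ 2 hP'.le ?_
        rw [hR2, hD, ← sub_pos]
        have : 0 < y * (1 - y) * ((1 - (K.a - K.b)) * (1 + (K.a - K.b))) :=
          mul_pos (mul_pos hy0 (by linarith)) (mul_pos (by linarith) (by linarith))
        linarith
      linarith
    · linarith
  have hcos : Real.cos (Real.arccos c) = c := Real.cos_arccos hc2.le hc1.le
  have hmem : Real.arccos c ∈ Set.Ioo 0 Real.pi :=
    ⟨Real.arccos_pos.2 hc1, lt_of_le_of_ne (Real.arccos_le_pi c) fun h => by
      rw [Real.arccos_eq_pi] at h; linarith⟩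
  have hsin := (Real.sin_pos_of_mem_Ioo hmem).ne'
  have hm : 0 < 1 - cosPhase K (Real.arccos c) ^ 2 := by
    linarith [cosPhase_sq_lt_one K hsin]
  have hv : velocity K (Real.arccos c) = x := by
    have h1 := disc_eq K y c
    have h2 : (K.b * (1 - y) * c - K.a * y) ^ 2 = D := by
      rw [← hR2]
      have : K.b * (1 - y) * c - K.a * y = -s * √D := by linarith
      rw [this, mul_pow, neg_sq, hs2, one_mul]
    rw [h2, ← hD, sub_self] at h1
    have h3 := (mul_eq_zero.1 h1.symm).resolve_left (by linarith)
    have h4 := four_mul_velocity_sq K hsin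
    rw [Real.sin_sq, hcos] at h4
    have h5 : (4 * velocity K (Real.arccos c) ^ 2 - y)
        * (1 - cosPhase K (Real.arccos c) ^ 2) = 0 := by
      have e : cosPhase K (Real.arccos c) = K.a + K.b * c := by rw [cosPhase, hcos]
      rw [e] at h4 ⊢
      linear_combination h4 + h3
    have h6 := (mul_eq_zero.1 h5).resolve_right hm.ne'
    exact (pow_left_inj₀ (velocity_pos K hmem).le hx0.le two_ne_zero).1 (by linarith)
  refine ⟨Real.arccos c, ⟨hmem, ?_⟩, hv⟩
  rw [signedRoot, hv, hcos]
  have : K.b * (1 - 4 * x ^ 2) * c - K.a * (4 * x ^ 2) = -s * √D := by linarith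
  rw [this, ← mul_assoc, neg_mul_neg, ← sq, hs2, one_mul]
  exact hR

/-- The velocity determines the square of `signedRoot`, the branch its sign, and then `signedRoot`
is affine in cos θ with nonzero slope. -/
theorem injOn_velocity (s : ℝ) :
    Set.InjOn (velocity K) {θ ∈ Set.Ioo 0 Real.pi | 0 < -s * signedRoot K θ} := by
  rintro θ ⟨hθ, hE⟩ φ ⟨hφ, hE'⟩ heq
  have hne : signedRoot K θ ≠ 0 := fun h => by rw [h, mul_zero] at hE; exact hE.false
  have hy1 := (H.four_velocity_sq_lt hθ hne).trans H.sin_sq_lt_one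
  have h1 := disc_velocity K (Real.sin_pos_of_mem_Ioo hθ).ne'
  have h2 := disc_velocity K (Real.sin_pos_of_mem_Ioo hφ).ne'
  rw [← heq, h1] at h2
  have h3 : -s * signedRoot K θ = -s * signedRoot K φ :=
    (pow_left_inj₀ hE.le hE'.le two_ne_zero).1 (by rw [mul_pow, mul_pow, h2])
  have hs0 : -s ≠ 0 := fun h => by rw [h, zero_mul] at hE; exact hE.false
  have h4 := mul_left_cancel₀ hs0 h3
  rw [signedRoot, signedRoot, ← heq] at h4
  have h5 : K.b * (1 - 4 * velocity K θ ^ 2) ≠ 0 := (mul_pos K.b_pos (by linarith)).ne'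
  exact Real.injOn_cos ⟨hθ.1.le, hθ.2.le⟩ ⟨hφ.1.le, hφ.2.le⟩
    (mul_left_cancel₀ h5 (by linarith))

end HasEdges

/-! ### The limit law of the mixed initial state -/

theorem gammaFun_neg_one_of_eq_one (x l0 : ℝ) : gammaFun (-1) x 1 l0 = 0 := by
  simp [gammaFun]

theorem gammaFun_one_of_eq_one (x l0 : ℝ) : gammaFun 1 x 1 l0 = 1 := by
  norm_num [gammaFun]

/-- The density of the velocity on a branch, with respect to the Lebesgue measure of `θ`. -/
def branchDensity (s l0 l1 x : ℝ) : ℝ :=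
  2 * Real.pi * (gammaFun s x l1 l0 * (2 * konno (2 * x) (√(1 - l0 ^ 2))))

theorem measurable_branchDensity (s l0 l1 : ℝ) : Measurable (branchDensity s l0 l1) := by
  have h1 : Measurable fun x => gammaFun s x l1 l0 := by
    unfold gammaFun zetaFun etaFun uFun phiFun
    fun_prop
  have h2 : Measurable fun x => konno x (√(1 - l0 ^ 2)) := by
    unfold konno
    exact Measurable.indicator (by fun_prop) measurableSet_Ioo
  have h3 : Measurable fun x => konno (2 * x) (√(1 - l0 ^ 2)) := h2.comp (by fun_prop)
  unfold branchDensity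
  fun_prop

theorem branchDensity_neg (s l0 l1 x : ℝ) :
    branchDensity s l0 l1 (-x) = branchDensity s l0 l1 x := by
  have h1 : gammaFun s (-x) l1 l0 = gammaFun s x l1 l0 := by
    simp only [gammaFun, zetaFun, etaFun, uFun, phiFun, neg_sq, Even.neg_pow (by decide : Even 4)]
  have h2 : ∀ k, konno (2 * -x) k = konno (2 * x) k := by
    intro k
    simp only [konno, Set.indicator, Set.mem_Ioo, mul_neg, neg_sq]
    congr 1
    rw [eq_iff_iff]
    constructor <;> rintro ⟨h, h'⟩ <;> constructor <;> linarith
  rw [branchDensity, h1, h2, branchDensity]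

theorem velocity_neg (K : Coin) (θ : ℝ) : velocity K (-θ) = -velocity K θ := by
  simp only [velocity, cosPhase, Real.sin_neg, Real.cos_neg]
  ring

namespace HasEdges

variable {K : Coin} {l0 l1 α β : ℝ} (H : HasEdges K l0 l1 α β)

include H

theorem branchDensity_nonneg (s : ℝ) {x : ℝ} (hx : 4 * x ^ 2 < Real.sin β ^ 2) :
    0 ≤ branchDensity s l0 l1 x := by
  have h0 := H.l0_pos
  have hy1 : 0 ≤ 1 - 4 * x ^ 2 := by linarith [H.sin_sq_lt_one]
  rw [branchDensity, H.konno_eq hx]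
  have : 0 ≤ gammaFun s x l1 l0 := Real.sqrt_nonneg _
  have := Real.pi_pos
  positivity

/-- Change of variables x = v(θ) on a branch, where the density is the reciprocal of |v'|. -/
theorem volume_branch {s : ℝ} (hs : s = 1 ∨ s = -1) (hl1 : 0 < l1) (hl1' : l1 ≤ 1) {t : Set ℝ}
    (ht : MeasurableSet t) :
    volume ({θ ∈ Set.Ioo 0 Real.pi | 0 < -s * signedRoot K θ} ∩ velocity K ⁻¹' t) =
      ∫⁻ x in t ∩ Set.Ioo 0 (1 / 2 * Real.sin β), ENNReal.ofReal (branchDensity s l0 l1 x) := by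
  have hs2 : s ^ 2 = 1 := by rcases hs with rfl | rfl <;> norm_num
  set A := {θ ∈ Set.Ioo 0 Real.pi | 0 < -s * signedRoot K θ} with hA
  have hAm : MeasurableSet A :=
    measurableSet_Ioo.inter (measurableSet_lt measurable_const
      (measurable_const.mul (measurable_signedRoot K)))
  have hone : ∀ θ ∈ A, |signedRoot K θ / (2 * √(1 - cosPhase K θ ^ 2))|
      * branchDensity s l0 l1 (velocity K θ) = 1 := fun θ hθ =>
    H.gammaFun_mul_konno_mul_deriv hθ.1 hs2 hθ.2 (H.four_velocity_sq_lt hθ.1 fun h => by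
      have := hθ.2
      rw [h, mul_zero] at this
      exact this.false)
  -- In the driftless case γ₋ vanishes identically, which contradicts `hone` at any point of the
  -- branch; so the branch is empty and both sides are zero.
  by_cases hcase : s = -1 ∧ l1 = 1
  · obtain ⟨rfl, rfl⟩ := hcase
    have hD : ∀ x, branchDensity (-1) l0 1 x = 0 := fun x => by
      rw [branchDensity, gammaFun_neg_one_of_eq_one]; simp
    have hempty : A = ∅ := Set.eq_empty_of_forall_notMem fun θ hθ => by
      have := hone θ hθ
      rw [hD, mul_zero] at this
      exact zero_ne_one this
    simp [hempty, hD]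
  have himg : velocity K '' A = Set.Ioo 0 (1 / 2 * Real.sin β) := by
    refine H.image_velocity ?_ hl1
    rcases hs with rfl | rfl
    · exact .inl rfl
    · exact .inr ⟨rfl, lt_of_le_of_ne hl1' fun h => hcase ⟨rfl, h⟩⟩
  have hB : MeasurableSet (A ∩ velocity K ⁻¹' t) := hAm.inter (measurable_velocity K ht)
  have h1 := lintegral_image_eq_lintegral_abs_deriv_mul hB
    (fun θ hθ => (hasDerivAt_velocity K
      (Real.sin_pos_of_mem_Ioo hθ.1.1).ne').hasDerivWithinAt)
    ((H.injOn_velocity s).mono Set.inter_subset_left)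
    (fun x => ENNReal.ofReal (branchDensity s l0 l1 x))
  rw [Set.image_inter_preimage, himg, Set.inter_comm] at h1
  rw [h1, ← setLIntegral_one]
  refine setLIntegral_congr_fun hB fun θ hθ => ?_
  rw [← ENNReal.ofReal_mul (abs_nonneg _), hone θ hθ.1, ENNReal.ofReal_one]

/-- A zero of `signedRoot` forces the maximal velocity, and then cos θ is determined. Hence at most
one point separates the branches. -/
theorem volume_signedRoot_eq_zero :
    volume {θ ∈ Set.Ioo 0 Real.pi | signedRoot K θ = 0} = 0 := by
  refine Set.Subsingleton.measure_zero ?_ volume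
  rintro θ ⟨hθ, hE⟩ φ ⟨hφ, hE'⟩
  have hmax : ∀ θ ∈ Set.Ioo 0 Real.pi, signedRoot K θ = 0 →
      4 * velocity K θ ^ 2 = Real.sin β ^ 2 := by
    intro θ hθ hE
    have h1 := disc_velocity K (Real.sin_pos_of_mem_Ioo hθ).ne'
    rw [hE, zero_pow two_ne_zero] at h1
    refine le_antisymm (by linarith [H.velocity_sq_le θ]) ?_
    by_contra! h
    exact (H.disc_pos h).ne' h1
  have hb : K.b * (1 - Real.sin β ^ 2) ≠ 0 :=
    (mul_pos K.b_pos (by linarith [H.sin_sq_lt_one])).ne'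
  have h1 := hE.trans hE'.symm
  rw [signedRoot, signedRoot, hmax θ hθ hE, hmax φ hφ hE'] at h1
  exact Real.injOn_cos ⟨hθ.1.le, hθ.2.le⟩ ⟨hφ.1.le, hφ.2.le⟩
    (mul_left_cancel₀ hb (by linarith))

theorem volume_Ioo_inter (hl1 : 0 < l1) (hl1' : l1 ≤ 1) {t : Set ℝ} (ht : MeasurableSet t) :
    volume (Set.Ioo 0 Real.pi ∩ velocity K ⁻¹' t) =
      ∫⁻ x in t ∩ Set.Ioo 0 (1 / 2 * Real.sin β),
        (ENNReal.ofReal (branchDensity (-1) l0 l1 x) + ENNReal.ofReal (branchDensity 1 l0 l1 x)) := by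
  rw [lintegral_add_left (measurable_branchDensity _ _ _).ennreal_ofReal,
    ← H.volume_branch (.inr rfl) hl1 hl1' ht, ← H.volume_branch (.inl rfl) hl1 hl1' ht,
    ← measure_union]
  · refine measure_congr ?_
    have h0 := H.volume_signedRoot_eq_zero
    have h1 : ∀ᵐ θ, ¬(θ ∈ Set.Ioo 0 Real.pi ∧ signedRoot K θ = 0) := by
      rw [ae_iff]
      simpa only [not_not] using h0
    filter_upwards [h1] with θ hθ
    refine propext ?_
    change (θ ∈ Set.Ioo 0 Real.pi ∧ velocity K θ ∈ t) ↔
      ((θ ∈ Set.Ioo 0 Real.pi ∧ 0 < - -1 * signedRoot K θ) ∧ velocity K θ ∈ t) ∨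
      ((θ ∈ Set.Ioo 0 Real.pi ∧ 0 < -1 * signedRoot K θ) ∧ velocity K θ ∈ t)
    rw [neg_neg, one_mul, neg_one_mul, neg_pos]
    have := lt_trichotomy (signedRoot K θ) 0
    tauto
  · rw [Set.disjoint_left]
    rintro θ ⟨⟨_, h1⟩, _⟩ ⟨⟨_, h2⟩, _⟩
    linarith
  · exact (measurableSet_Ioo.inter (measurableSet_lt measurable_const
      (measurable_const.mul (measurable_signedRoot K)))).inter (measurable_velocity K ht)

end HasEdges

/-! ### From the half period to the full limit law -/

theorem volume_Ioc_inter (K : Coin) {t : Set ℝ} (ht : MeasurableSet t) :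
    volume (Set.Ioc (-Real.pi) Real.pi ∩ velocity K ⁻¹' t) =
      volume (Set.Ioo 0 Real.pi ∩ velocity K ⁻¹' t)
        + volume (Set.Ioo 0 Real.pi ∩ velocity K ⁻¹' (Neg.neg ⁻¹' t)) := by
  have h1 : volume (Set.Ioo 0 Real.pi ∩ velocity K ⁻¹' (Neg.neg ⁻¹' t)) =
      volume (Set.Ioo (-Real.pi) 0 ∩ velocity K ⁻¹' t) := by
    rw [← Measure.measure_preimage_neg]
    congr 1
    ext θ
    simp only [Set.mem_inter_iff, Set.mem_preimage, Set.mem_Ioo, velocity_neg, neg_neg]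
    refine and_congr_left fun _ => ?_
    constructor <;> rintro ⟨h, h'⟩ <;> constructor <;> linarith
  rw [h1, ← measure_union]
  · refine measure_congr ?_
    have e0 : ∀ᵐ θ : ℝ, θ ≠ 0 := by simp [ae_iff]
    have e1 : ∀ᵐ θ : ℝ, θ ≠ Real.pi := by simp [ae_iff]
    filter_upwards [e0, e1] with θ h0 h1
    refine propext ?_
    change (θ ∈ Set.Ioc (-Real.pi) Real.pi ∧ velocity K θ ∈ t) ↔
      (θ ∈ Set.Ioo 0 Real.pi ∧ velocity K θ ∈ t) ∨ (θ ∈ Set.Ioo (-Real.pi) 0 ∧ velocity K θ ∈ t)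
    rw [← or_and_right]
    refine and_congr_left fun _ => ?_
    have := Real.pi_pos
    simp only [Set.mem_Ioc, Set.mem_Ioo]
    constructor
    · rintro ⟨ha, hb⟩
      rcases lt_or_gt_of_ne h0 with h | h
      · exact .inr ⟨ha, h⟩
      · exact .inl ⟨h, lt_of_le_of_ne hb h1⟩
    · rintro (⟨ha, hb⟩ | ⟨ha, hb⟩) <;> constructor <;> linarith
  · rw [Set.disjoint_left]
    rintro θ ⟨h1, _⟩ ⟨h2, _⟩
    linarith [h1.1, h2.2]
  · exact measurableSet_Ioo.inter (measurable_velocity K ht)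

/-- The flat band has velocity zero and produces the atom. The velocity is odd in θ, so the bands v
and -v have the same image law; together they double 1/(6π) to 1/(3π). -/
theorem waveLaw_const_apply (K : Coin) {t : Set ℝ} (ht : MeasurableSet t) :
    waveLaw K (fun _ _ => 1 / 3) t = ENNReal.ofReal (1 / 3) * Measure.dirac (0 : ℝ) t
      + ENNReal.ofReal (1 / (3 * Real.pi)) * (volume (Set.Ioo 0 Real.pi ∩ velocity K ⁻¹' t)
        + volume (Set.Ioo 0 Real.pi ∩ velocity K ⁻¹' (Neg.neg ⁻¹' t))) := by
  have hpi := Real.pi_pos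
  have hk : ∀ k, ((volume.restrict (Set.Ioc (-Real.pi) Real.pi)).withDensity
      fun _ => ENNReal.ofReal (1 / 3 / (2 * Real.pi))).map (fun θ => dir k * velocity K θ) t =
      ENNReal.ofReal (1 / 3 / (2 * Real.pi)) *
        volume (Set.Ioc (-Real.pi) Real.pi ∩ (fun θ => dir k * velocity K θ) ⁻¹' t) := by
    intro k
    have hm := measurable_dir_mul_velocity K k ht
    rw [Measure.map_apply (measurable_dir_mul_velocity K k) ht, withDensity_const,
      Measure.smul_apply, Measure.restrict_apply hm, Set.inter_comm, smul_eq_mul]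
  have ht' : MeasurableSet (Neg.neg ⁻¹' t) := measurable_neg ht
  have e0 : ENNReal.ofReal (1 / 3 / (2 * Real.pi)) * volume (Set.Ioc (-Real.pi) Real.pi ∩
      (fun θ => dir 0 * velocity K θ) ⁻¹' t) = ENNReal.ofReal (1 / 3) * Measure.dirac (0 : ℝ) t := by
    simp only [dir, Matrix.cons_val_zero, zero_mul]
    by_cases h : (0 : ℝ) ∈ t
    · rw [Set.preimage_const_of_mem h, Set.inter_univ, Real.volume_Ioc,
        ← ENNReal.ofReal_mul (by positivity), Measure.dirac_apply_of_mem h, mul_one]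
      congr 1
      field_simp
      norm_num
    · rw [Set.preimage_const_of_notMem h, Set.inter_empty, measure_empty,
        Measure.dirac_apply' _ ht, Set.indicator_of_notMem h]
      simp
  have e1 : (fun θ => dir 1 * velocity K θ) ⁻¹' t = velocity K ⁻¹' t := by simp [dir]
  have e2 : (fun θ => dir 2 * velocity K θ) ⁻¹' t = velocity K ⁻¹' (Neg.neg ⁻¹' t) := by
    ext θ
    simp [dir]
  have e3 : Neg.neg ⁻¹' (Neg.neg ⁻¹' t) = t := by ext x; simp
  rw [waveLaw, Measure.finsetSum_apply, Fin.sum_univ_three, hk, hk, hk, e0, e1, e2,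
    volume_Ioc_inter K ht, volume_Ioc_inter K ht', e3, add_assoc, ← mul_add]
  congr 1
  rw [show (1 : ℝ) / (3 * Real.pi) = 1 / 3 / (2 * Real.pi) * 2 by field_simp,
    ENNReal.ofReal_mul (by positivity), mul_assoc]
  congr 1
  rw [ENNReal.ofReal_ofNat, two_mul]
  ring

theorem hasEdges_coin {p q r : ℝ} (hp : p ∈ Set.Ioo (0 : ℝ) 1) (hq : q ∈ Set.Ioo (0 : ℝ) 1)
    (hr : r ∈ Set.Ioc (0 : ℝ) 1) (hl0 : 0 < lam0 p q r) :
    HasEdges (coin hp hq hr) (lam0 p q r) (lam1 p q r)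
      (Real.arccos (lam0 p q r) + Real.arccos (lam1 p q r))
      (Real.arccos (lam0 p q r) - Real.arccos (lam1 p q r)) :=
  { hasAngles_coin hp hq hr with
    a_eq' := coin_a_eq hp hq hr
    b_eq' := coin_b_eq hp hq hr
    l0_pos := hl0 }

/-- Both laws contain the same atom. Off it, the two branches on (0, π) give the density on (0, κ),
and evenness of the branch densities transports it to (-κ, 0). -/
theorem limitLaw_eq_waveLaw {p q r : ℝ} (hp : p ∈ Set.Ioo (0 : ℝ) 1) (hq : q ∈ Set.Ioo (0 : ℝ) 1)
    (hr : r ∈ Set.Ioc (0 : ℝ) 1) (hl0 : 0 < lam0 p q r) :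
    limitLaw p q r = waveLaw (coin hp hq hr) fun _ _ => 1 / 3 := by
  set K := coin hp hq hr
  set l0 := lam0 p q r
  set l1 := lam1 p q r
  have hl1 : 0 < l1 := hl0.trans (lam0_lt_lam1 hp hq hr)
  have hl1' : l1 ≤ 1 := lam1_le_one hp hq hr
  have H : HasEdges K l0 l1 (Real.arccos l0 + Real.arccos l1) (Real.arccos l0 - Real.arccos l1) :=
    hasEdges_coin hp hq hr hl0
  set β := Real.arccos l0 - Real.arccos l1
  have hκ : kappa p q r = 1 / 2 * Real.sin β := rfl
  set g : ℝ → ENNReal := fun x => ENNReal.ofReal (branchDensity (-1) l0 l1 x)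
    + ENNReal.ofReal (branchDensity 1 l0 l1 x) with hg
  have hgm : Measurable g := (measurable_branchDensity _ _ _).ennreal_ofReal.add
    (measurable_branchDensity _ _ _).ennreal_ofReal
  have hgneg : ∀ x, g (-x) = g x := fun x => by simp only [hg, branchDensity_neg]
  have hpi := Real.pi_pos
  have hwd : ∀ x, ENNReal.ofReal (2 / 3 * waveDensity p q r x) =
      (Set.Ioo (-(1 / 2 * Real.sin β)) (1 / 2 * Real.sin β)).indicator
        (fun x => ENNReal.ofReal (1 / (3 * Real.pi)) * g x) x := by
    intro x
    by_cases hx : |x| < 1 / 2 * Real.sin β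
    · have hx4 : 4 * x ^ 2 < Real.sin β ^ 2 := by
        have := sq_lt_sq' (by linarith [abs_nonneg x, H.sin_pos]) hx
        rw [sq_abs] at this
        linarith
      rw [waveDensity, Set.indicator_of_mem (by exact hx), Set.indicator_of_mem (show x ∈ Set.Ioo _ _ from abs_lt.1 hx),
        hg]
      beta_reduce
      rw [← ENNReal.ofReal_add (H.branchDensity_nonneg _ hx4) (H.branchDensity_nonneg _ hx4),
        ← ENNReal.ofReal_mul (by positivity)]
      congr 1
      unfold branchDensity
      field_simp
      exact mul_comm _ _
    · rw [waveDensity, Set.indicator_of_notMem (by exact hx),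
        Set.indicator_of_notMem (show x ∉ Set.Ioo _ _ from fun h => hx (abs_lt.2 h))]
      simp
  ext t ht
  have ht' : MeasurableSet (Neg.neg ⁻¹' t) := measurable_neg ht
  rw [waveLaw_const_apply K ht, H.volume_Ioo_inter hl1 hl1' ht, H.volume_Ioo_inter hl1 hl1' ht',
    limitLaw, Measure.add_apply, Measure.smul_apply, smul_eq_mul, withDensity_apply _ ht]
  congr 1
  simp_rw [hwd]
  rw [setLIntegral_indicator measurableSet_Ioo, lintegral_const_mul _ hgm]
  congr 1
  have hneg : ∫⁻ x in Neg.neg ⁻¹' t ∩ Set.Ioo 0 (1 / 2 * Real.sin β), g x =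
      ∫⁻ x in t ∩ Set.Ioo (-(1 / 2 * Real.sin β)) 0, g x := by
    rw [← (Measure.measurePreserving_neg (volume : Measure ℝ)).setLIntegral_comp_preimage
      (ht.inter measurableSet_Ioo) hgm]
    simp_rw [hgneg]
    congr 2
    ext x
    simp only [Set.mem_inter_iff, Set.mem_preimage, Set.mem_Ioo]
    refine and_congr_right fun _ => ?_
    constructor <;> rintro ⟨h, h'⟩ <;> constructor <;> linarith
  rw [hneg, ← lintegral_union (ht.inter measurableSet_Ioo)]
  · refine setLIntegral_congr ?_
    have e0 : ∀ᵐ x : ℝ, x ≠ 0 := by simp [ae_iff]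
    filter_upwards [e0] with x h0
    refine propext ?_
    change (x ∈ Set.Ioo _ _ ∧ x ∈ t) ↔ (x ∈ t ∧ x ∈ Set.Ioo _ _) ∨ (x ∈ t ∧ x ∈ Set.Ioo _ _)
    rw [and_comm, ← and_or_left]
    refine and_congr_right fun _ => ?_
    have := H.sin_pos
    simp only [Set.mem_Ioo]
    constructor
    · rintro ⟨ha, hb⟩
      rcases lt_or_gt_of_ne h0 with h | h
      · exact .inr ⟨ha, h⟩
      · exact .inl ⟨h, hb⟩
    · rintro (⟨ha, hb⟩ | ⟨ha, hb⟩) <;> constructor <;> linarith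
  · rw [Set.disjoint_left]
    rintro x ⟨_, h1⟩ ⟨_, h2⟩
    linarith [h1.1, h2.2]

/-! ### Weighted permutation operators on `ℓ²` -/

theorem lp_norm_sq {ι : Type*} (f : lp (fun _ : ι => ℂ) 2) : ‖f‖ ^ 2 = ∑' i, ‖f i‖ ^ 2 := by
  have h := lp.norm_rpow_eq_tsum (p := 2) (by norm_num) f
  norm_num at h
  exact h

theorem lp_summable_sq {ι : Type*} (f : lp (fun _ : ι => ℂ) 2) :
    Summable fun i => ‖f i‖ ^ 2 := by
  have h := (lp.hasSum_norm (p := 2) (by norm_num) f).summable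
  norm_num at h
  exact h

theorem memℓp_two_of_summable {ι : Type*} {f : ι → ℂ} (h : Summable fun i => ‖f i‖ ^ 2) :
    Memℓp f 2 := memℓp_gen (by norm_num; exact h)

theorem summable_weightedPerm {ι : Type*} (σ : Equiv.Perm ι) {c : ι → ℂ} (hc : ∀ i, ‖c i‖ ≤ 1)
    (f : lp (fun _ : ι => ℂ) 2) : Summable (fun i => ‖c i * f (σ i)‖ ^ 2) ∧
      ∑' i, ‖c i * f (σ i)‖ ^ 2 ≤ ‖f‖ ^ 2 := by
  have hle : ∀ i, ‖c i * f (σ i)‖ ^ 2 ≤ ‖f (σ i)‖ ^ 2 := fun i => by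
    rw [norm_mul]
    exact pow_le_pow_left₀ (by positivity) (mul_le_of_le_one_left (norm_nonneg _) (hc i)) 2
  have h : Summable fun i => ‖f (σ i)‖ ^ 2 := σ.summable_iff.2 (lp_summable_sq f)
  have h' := h.of_nonneg_of_le (fun _ => by positivity) hle
  refine ⟨h', ?_⟩
  rw [lp_norm_sq, ← σ.tsum_eq fun i => ‖f i‖ ^ 2]
  exact h'.tsum_le_tsum hle h

/-- The operator `f ↦ c · (f ∘ σ)` on `ℓ²`. -/
def weightedPerm {ι : Type*} (σ : Equiv.Perm ι) (c : ι → ℂ) (hc : ∀ i, ‖c i‖ ≤ 1) :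
    lp (fun _ : ι => ℂ) 2 →L[ℂ] lp (fun _ : ι => ℂ) 2 :=
  LinearMap.mkContinuous
    { toFun := fun f =>
        ⟨fun i => c i * f (σ i), memℓp_two_of_summable (summable_weightedPerm σ hc f).1⟩
      map_add' := fun f g => by ext i; exact mul_add _ _ _
      map_smul' := fun a f => by ext i; simp [mul_left_comm] } 1 fun f => by
    rw [one_mul]
    refine (sq_le_sq₀ (norm_nonneg _) (norm_nonneg _)).1 ?_
    rw [lp_norm_sq]
    exact (summable_weightedPerm σ hc f).2

theorem weightedPerm_apply {ι : Type*} (σ : Equiv.Perm ι) (c : ι → ℂ) (hc : ∀ i, ‖c i‖ ≤ 1)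
    (f : lp (fun _ : ι => ℂ) 2) (i : ι) : weightedPerm σ c hc f i = c i * f (σ i) := rfl

theorem norm_weightedPerm_le {ι : Type*} (σ : Equiv.Perm ι) (c : ι → ℂ) (hc : ∀ i, ‖c i‖ ≤ 1) :
    ‖weightedPerm σ c hc‖ ≤ 1 := by
  refine ContinuousLinearMap.opNorm_le_bound _ zero_le_one fun f => ?_
  rw [one_mul]
  refine (sq_le_sq₀ (norm_nonneg _) (norm_nonneg _)).1 ?_
  rw [lp_norm_sq]
  exact (summable_weightedPerm σ hc f).2

/-- The Hilbert space of square summable functions on the vertices. -/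
abbrev VertL2 : Type := lp (fun _ : Vert => ℂ) 2

/-- Translation of the cells. -/
def cellShift (k : ℤ) : Equiv.Perm Vert := (Equiv.addRight k).prodCongr (Equiv.refl V0)

/-- The sum of the translations by one cell in both directions. -/
def hop : VertL2 →L[ℂ] VertL2 :=
  weightedPerm (cellShift 1) (fun _ => 1) (by simp) +
    weightedPerm (cellShift (-1)) (fun _ => 1) (by simp)

theorem hop_apply (f : VertL2) (j : ℤ) (x : V0) :
    hop f (j, x) = f (j + 1, x) + f (j - 1, x) := by
  simp [hop, weightedPerm_apply, cellShift, sub_eq_add_neg]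

theorem norm_hop_le : ‖hop‖ ≤ 2 :=
  (norm_add_le _ _).trans (by
    linarith [norm_weightedPerm_le (cellShift 1) (fun _ => 1) (by simp),
      norm_weightedPerm_le (cellShift (-1)) (fun _ => 1) (by simp)])

theorem isSelfAdjoint_hop : IsSelfAdjoint hop := by
  rw [ContinuousLinearMap.isSelfAdjoint_iff_isSymmetric]
  intro f g
  have h1 : ∀ (k : ℤ) (f g : VertL2), inner ℂ (weightedPerm (cellShift k) (fun _ => 1) (by simp) f) g =
      inner ℂ f (weightedPerm (cellShift (-k)) (fun _ => 1) (by simp) g) := by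
    intro k f g
    rw [lp.inner_eq_tsum, lp.inner_eq_tsum, ← (cellShift (-k)).tsum_eq]
    refine tsum_congr fun ⟨j, x⟩ => ?_
    simp [weightedPerm_apply, cellShift]
  change inner ℂ (hop f) g = inner ℂ f (hop g)
  simp only [hop, add_apply, inner_add_left, inner_add_right, h1, neg_neg]
  ring

/-- Self-adjointness makes the spectrum real and the norm bounds it. Only this inclusion is needed;
plane waves supply the converse directly for J. -/
theorem mem_spectrum_hop {z : ℂ} (hz : z ∈ spectrum ℂ hop) :
    ∃ x : ℝ, z = x ∧ |x| ≤ 2 := by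
  refine ⟨z.re, isSelfAdjoint_hop.mem_spectrum_eq_re hz, ?_⟩
  exact (Complex.abs_re_le_norm z).trans ((spectrum.norm_le_norm_mul_of_mem hz).trans
    ((mul_le_of_le_one_right (norm_nonneg _) ContinuousLinearMap.norm_id_le).trans norm_hop_le))

/-! ### The symmetrized transition operator -/

/-- The symmetrized transition operator, in coordinates. -/
def symm (K : Coin) (f : Vert → ℂ) : Vert → ℂ
  | (j, .S) => K.s0 * f (j, .R) + K.sp * K.tp * f (j, .T) + K.sm * K.tm * f (j - 1, .T)
  | (j, .R) => K.s0 * f (j, .S)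
  | (j, .T) => K.sp * K.tp * f (j, .S) + K.sm * K.tm * f (j + 1, .S)

theorem symmTrans_eq_symm {p q r : ℝ} (hp : p ∈ Set.Ioo (0 : ℝ) 1) (hq : q ∈ Set.Ioo (0 : ℝ) 1)
    (hr : r ∈ Set.Ioc (0 : ℝ) 1) : symmTrans p q r = symm (coin hp hq hr) := by
  have h1 : 0 ≤ r * p := mul_nonneg hr.1.le hp.1.le
  have h2 : 0 ≤ r * (1 - p) := mul_nonneg hr.1.le (by linarith [hp.2])
  have h4 : 0 ≤ 1 - q := by linarith [hq.2]
  ext f ⟨j, x⟩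
  cases x <;>
    simp [symmTrans, org, A0.src, sum_inArcs_S, sum_inArcs_R, sum_inArcs_T, bar, symm, coin,
      prob, Real.sqrt_mul h1, Real.sqrt_mul h2, Real.sqrt_mul hq.1.le,
      Real.sqrt_mul h4]
  ring

theorem Coin.le_one (K : Coin) : |K.s0| ≤ 1 ∧ |K.sp * K.tp| ≤ 1 ∧ |K.sm * K.tm| ≤ 1 := by
  have hs := K.sq_s
  have ht := K.sq_t
  have h0 := sq_nonneg K.s0
  have h1 := sq_nonneg K.sp
  have h2 := sq_nonneg K.sm
  have h3 := sq_nonneg K.tp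
  have h4 := sq_nonneg K.tm
  refine ⟨?_, ?_, ?_⟩ <;> rw [← sq_le_one_iff_abs_le_one]
  · linarith
  · rw [mul_pow]; exact mul_le_one₀ (by linarith) h3 (by linarith)
  · rw [mul_pow]; exact mul_le_one₀ (by linarith) h4 (by linarith)

/-- The matching of the vertices `(j, S)` and `(j, R)`. -/
def matchSR : Equiv.Perm Vert := (Equiv.refl ℤ).prodCongr (Equiv.swap V0.S V0.R)

/-- The matching of the vertices `(j, S)` and `(j - k, T)`. -/
def matchST (k : ℤ) : Equiv.Perm Vert where
  toFun
    | (j, .S) => (j - k, .T)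
    | (j, .R) => (j, .R)
    | (j, .T) => (j + k, .S)
  invFun
    | (j, .S) => (j - k, .T)
    | (j, .R) => (j, .R)
    | (j, .T) => (j + k, .S)
  left_inv := by rintro ⟨j, x⟩; cases x <;> simp
  right_inv := by rintro ⟨j, x⟩; cases x <;> simp

/-- The symmetrized transition operator on `ℓ²`. -/
def symmL (K : Coin) : VertL2 →L[ℂ] VertL2 :=
  weightedPerm matchSR (fun u => if u.2 = .T then 0 else K.s0) (fun u => by
      split_ifs
      · simp
      · simpa using K.le_one.1)
    + weightedPerm (matchST 0) (fun u => if u.2 = .R then 0 else K.sp * K.tp) (fun u => by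
      split_ifs
      · simp
      · simpa [abs_mul] using K.le_one.2.1)
    + weightedPerm (matchST 1) (fun u => if u.2 = .R then 0 else K.sm * K.tm) (fun u => by
      split_ifs
      · simp
      · simpa [abs_mul] using K.le_one.2.2)

theorem symmL_apply (K : Coin) (f : VertL2) : (symmL K f : Vert → ℂ) = symm K f := by
  ext ⟨j, x⟩
  cases x <;> simp [symmL, weightedPerm_apply, matchSR, matchST, symm, Equiv.swap_apply_def]

/-- The square of the symmetrized transition operator on the range of this operator. -/
def symmSq (K : Coin) : VertL2 →L[ℂ] VertL2 :=
  ((K.s0 ^ 2 + K.sp ^ 2 * K.tp ^ 2 + K.sm ^ 2 * K.tm ^ 2 : ℝ) : ℂ) • 1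
    + ((K.sp * K.tp * (K.sm * K.tm) : ℝ) : ℂ) • hop

theorem symmSq_apply (K : Coin) (f : VertL2) (j : ℤ) (x : V0) : symmSq K f (j, x) =
    ((K.s0 ^ 2 + K.sp ^ 2 * K.tp ^ 2 + K.sm ^ 2 * K.tm ^ 2 : ℝ) : ℂ) * f (j, x)
      + ((K.sp * K.tp * (K.sm * K.tm) : ℝ) : ℂ) * (f (j + 1, x) + f (j - 1, x)) := by
  rw [← hop_apply]
  rfl

theorem commute_symmL_symmSq (K : Coin) : symmL K * symmSq K = symmSq K * symmL K := by
  ext f ⟨j, x⟩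
  change symmL K (symmSq K f) (j, x) = symmSq K (symmL K f) (j, x)
  rw [symmSq_apply, symmL_apply, symmL_apply]
  cases x <;> simp only [symm, symmSq_apply] <;> ring_nf

/-- J exchanges functions on S with functions on R and T, and J² is M on the former. In J³ two
consecutive factors can always be chosen to act on S, and M commutes with J. -/
theorem symmL_cube (K : Coin) : symmL K * symmL K * symmL K = symmSq K * symmL K := by
  ext f ⟨j, x⟩
  change symmL K (symmL K (symmL K f)) (j, x) = symmSq K (symmL K f) (j, x)
  rw [symmSq_apply, symmL_apply, symmL_apply, symmL_apply]
  cases x <;> simp only [symm, add_sub_cancel_right, sub_add_cancel] <;> push_cast <;> ring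

theorem isUnit_sub_symmL (K : Coin) {z : ℂ} (hz : z ≠ 0)
    (h : ∀ x : ℝ, |x| ≤ 2 → z ^ 2 ≠ ((K.s0 ^ 2 + K.sp ^ 2 * K.tp ^ 2 + K.sm ^ 2 * K.tm ^ 2
      + K.sp * K.tp * (K.sm * K.tm) * x : ℝ) : ℂ)) :
    IsUnit (algebraMap ℂ (VertL2 →L[ℂ] VertL2) z - symmL K) := by
  set A : ℂ := ((K.s0 ^ 2 + K.sp ^ 2 * K.tp ^ 2 + K.sm ^ 2 * K.tm ^ 2 : ℝ) : ℂ) with hA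
  set B : ℂ := ((K.sp * K.tp * (K.sm * K.tm) : ℝ) : ℂ) with hB
  have hB0 : B ≠ 0 := by
    have := K.sp_pos; have := K.sm_pos; have := K.tp_pos; have := K.tm_pos
    rw [hB]
    exact_mod_cast (by positivity : 0 < K.sp * K.tp * (K.sm * K.tm)).ne'
  set J := symmL K with hJ
  set M := symmSq K with hM
  have hMdef : M = A • 1 + B • hop := rfl
  have h1 : IsUnit (algebraMap ℂ (VertL2 →L[ℂ] VertL2) ((z ^ 2 - A) / B) - hop) := by
    by_contra hn
    obtain ⟨x, hx, hx2⟩ := mem_spectrum_hop (z := (z ^ 2 - A) / B) hn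
    refine h x hx2 ?_
    rw [div_eq_iff hB0] at hx
    push_cast
    rw [hA, hB] at hx
    push_cast at hx
    linear_combination hx
  have h2 : IsUnit ((z ^ 2) • (1 : VertL2 →L[ℂ] VertL2) - M) := by
    have : (z ^ 2) • (1 : VertL2 →L[ℂ] VertL2) - M =
        (Units.mk0 B hB0) • (algebraMap ℂ (VertL2 →L[ℂ] VertL2) ((z ^ 2 - A) / B) - hop) := by
      rw [hMdef, Algebra.algebraMap_eq_smul_one, Units.smul_def, Units.val_mk0, smul_sub, smul_smul,
        mul_div_cancel₀ _ hB0]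
      module
    rw [this]
    exact h1.smul _
  have h3 : IsUnit ((Units.mk0 z hz) • ((z ^ 2) • (1 : VertL2 →L[ℂ] VertL2) - M)) := h2.smul _
  have hcom : J * M = M * J := commute_symmL_symmSq K
  have hcube : J * J * J = M * J := symmL_cube K
  rw [Units.smul_def, Units.val_mk0] at h3
  rw [Algebra.algebraMap_eq_smul_one]
  -- From J³ = MJ = JM one gets (z - J)(z² + zJ + J² - M) = z(z² - M), so z - J is invertible as
  -- soon as z and z² - M are.
  set Y := (z ^ 2) • (1 : VertL2 →L[ℂ] VertL2) + z • J + J * J - M with hY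
  have e1 : (z • (1 : VertL2 →L[ℂ] VertL2) - J) * Y = z • ((z ^ 2) • 1 - M) := by
    simp only [hY, sub_mul, mul_add, mul_sub, smul_mul_assoc, mul_smul_comm, one_mul, mul_one,
      ← mul_assoc, hcube, hcom]
    module
  have e2 : Y * (z • (1 : VertL2 →L[ℂ] VertL2) - J) = z • ((z ^ 2) • 1 - M) := by
    simp only [hY, sub_mul, add_mul, mul_sub, smul_mul_assoc, mul_smul_comm, one_mul, mul_one,
      hcube]
    module
  have hc : Commute (z • (1 : VertL2 →L[ℂ] VertL2) - J) Y := e1.trans e2.symm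
  rw [← e1] at h3
  exact (hc.isUnit_mul_iff.1 h3).1

/-- Truncated plane waves are approximate eigenvectors. -/
theorem mem_spectrum_of_plane_wave (K : Coin) {z : ℂ} (f : Vert → ℂ) (hf : symm K f = z • f)
    {v : V0 → ℝ} (hv : ∀ j x, ‖f (j, x)‖ = v x) {x₀ : V0} (hx₀ : 0 < v x₀) :
    z ∈ spectrum ℂ (symmL K) := by
  classical
  intro hu
  obtain ⟨u, hu⟩ := hu
  set R : VertL2 →L[ℂ] VertL2 := ↑u⁻¹ with hR
  have hinv : ∀ g : VertL2, R (z • g - symmL K g) = g := by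
    intro g
    have h1 : R * (algebraMap ℂ (VertL2 →L[ℂ] VertL2) z - symmL K) = 1 := by
      rw [← hu, hR, Units.inv_mul]
    have h2 := congrArg (fun T : VertL2 →L[ℂ] VertL2 => T g) h1
    rw [Algebra.algebraMap_eq_smul_one] at h2
    exact h2
  set V := ∑ x, v x with hV
  have hv0 : ∀ x, 0 ≤ v x := fun x => hv 0 x ▸ norm_nonneg _
  have hvV : ∀ x, v x ≤ V := fun x =>
    Finset.single_le_sum (fun x _ => hv0 x) (Finset.mem_univ x)
  have hV0 : 0 ≤ V := (hv0 x₀).trans (hvV x₀)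
  set C := (‖z‖ + 3) * V with hC
  have hC0 : 0 ≤ C := by positivity
  -- A wave cut off to n cells has squared norm at least n v(x₀)². The cut produces defects only in
  -- the cells -1, 0, n - 1, n, that is on at most 12 vertices, where they are bounded by C. A
  -- bounded inverse R is then impossible for large n.
  have key : ∀ n : ℕ, (n : ℝ) * v x₀ ^ 2 ≤ ‖R‖ ^ 2 * (12 * C ^ 2) := by
    intro n
    set s : Finset Vert := Finset.Ico (0 : ℤ) n ×ˢ Finset.univ with hs
    set ψ : VertL2 := ∑ i ∈ s, lp.single (E := fun _ : Vert => ℂ) 2 i (f i) with hψ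
    have hψa : ∀ j x, ψ (j, x) = if 0 ≤ j ∧ j < n then f (j, x) else 0 := by
      intro j x
      rw [hψ, lp.coeFn_sum, Finset.sum_apply]
      simp only [lp.coeFn_single, Finset.sum_pi_single, hs, Finset.mem_product, Finset.mem_Ico,
        Finset.mem_univ, and_true]
    have hψn : ‖ψ‖ ^ 2 = ∑ i ∈ s, ‖f i‖ ^ 2 := by
      have := lp.norm_sum_single (E := fun _ : Vert => ℂ) (p := 2) (by norm_num) f s
      norm_num at this
      exact this
    have hlow : (n : ℝ) * v x₀ ^ 2 ≤ ‖ψ‖ ^ 2 := by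
      rw [hψn, hs, Finset.sum_product]
      have : ∀ j ∈ Finset.Ico (0 : ℤ) n, v x₀ ^ 2 ≤ ∑ x, ‖f (j, x)‖ ^ 2 := by
        intro j _
        rw [← hv j x₀]
        exact Finset.single_le_sum (f := fun x => ‖f (j, x)‖ ^ 2) (fun x _ => by positivity)
          (Finset.mem_univ x₀)
      have := Finset.card_nsmul_le_sum _ _ _ this
      simpa using this
    set g := z • ψ - symmL K ψ with hg
    have hga : ∀ i, g i = z * ψ i - symm K ψ i := by
      intro i
      rw [hg, lp.coeFn_sub, Pi.sub_apply, lp.coeFn_smul, Pi.smul_apply, symmL_apply, smul_eq_mul]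
    have hψb : ∀ j x, ‖ψ (j, x)‖ ≤ V := by
      intro j x
      rw [hψa]
      split_ifs
      · rw [hv]; exact hvV x
      · simpa using hV0
    have hgb : ∀ i, ‖g i‖ ≤ C := by
      rintro ⟨j, x⟩
      obtain ⟨c0, c1, c2⟩ := K.le_one
      have hm : ∀ (c : ℝ) i, |c| ≤ 1 → ‖(c : ℂ) * ψ i‖ ≤ V := fun c i hc => by
        rw [norm_mul, Complex.norm_real, Real.norm_eq_abs]
        exact (mul_le_of_le_one_left (norm_nonneg _) hc).trans (hψb i.1 i.2)
      have hz : ‖z * ψ (j, x)‖ ≤ ‖z‖ * V := by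
        rw [norm_mul]; exact mul_le_mul_of_nonneg_left (hψb j x) (norm_nonneg _)
      rw [hga]
      refine (norm_sub_le _ _).trans ?_
      have : ‖symm K ψ (j, x)‖ ≤ 3 * V := by
        cases x
        · exact (hm K.s0 _ c0).trans (by linarith)
        · have h1 := hm K.s0 (j, .R) c0
          have h2 := hm (K.sp * K.tp) (j, .T) c1
          have h3 := hm (K.sm * K.tm) (j - 1, .T) c2
          rw [Complex.ofReal_mul] at h2 h3
          refine (norm_add_le _ _).trans ?_
          linarith [norm_add_le ((K.s0 : ℂ) * ψ (j, .R)) (K.sp * K.tp * ψ (j, .T))]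
        · have h2 := hm (K.sp * K.tp) (j, .S) c1
          have h3 := hm (K.sm * K.tm) (j + 1, .S) c2
          rw [Complex.ofReal_mul] at h2 h3
          exact (norm_add_le _ _).trans (by linarith)
      rw [hC]
      linarith
    set s' : Finset Vert := ({-1, 0, (n : ℤ) - 1, (n : ℤ)} : Finset ℤ) ×ˢ Finset.univ with hs'
    have hgz : ∀ i ∉ s', g i = 0 := by
      rintro ⟨j, x⟩ hj
      simp only [hs', Finset.mem_product, Finset.mem_insert, Finset.mem_singleton,
        Finset.mem_univ, and_true, not_or] at hj
      obtain ⟨j1, j2, j3, j4⟩ := hj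
      rw [hga]
      by_cases hin : 0 ≤ j ∧ j < n
      · have e1 : 0 ≤ j - 1 ∧ j - 1 < n := by omega
        have e2 : 0 ≤ j + 1 ∧ j + 1 < n := by omega
        have h1 := congrFun hf (j, x)
        rw [Pi.smul_apply, smul_eq_mul] at h1
        cases x <;> simp only [symm, hψa, if_pos hin, if_pos e1, if_pos e2] at h1 ⊢ <;>
          rw [h1, sub_self]
      · have e1 : ¬(0 ≤ j - 1 ∧ j - 1 < n) := by omega
        have e2 : ¬(0 ≤ j + 1 ∧ j + 1 < n) := by omega
        cases x <;> simp only [symm, hψa, if_neg hin, if_neg e1, if_neg e2] <;> simp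
    have hgn : ‖g‖ ^ 2 ≤ 12 * C ^ 2 := by
      rw [lp_norm_sq, tsum_eq_sum (s := s') fun i hi => by rw [hgz i hi]; simp]
      refine (Finset.sum_le_card_nsmul _ _ (C ^ 2)
        fun i _ => pow_le_pow_left₀ (norm_nonneg _) (hgb i) 2).trans ?_
      rw [nsmul_eq_mul]
      refine mul_le_mul_of_nonneg_right ?_ (by positivity)
      have h1 : s'.card ≤ 4 * 3 := by
        rw [hs', Finset.card_product]
        exact Nat.mul_le_mul Finset.card_le_four le_rfl
      exact_mod_cast h1
    have h1 : ‖ψ‖ ≤ ‖R‖ * ‖g‖ := by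
      conv_lhs => rw [← hinv ψ]
      exact R.le_opNorm _
    calc (n : ℝ) * v x₀ ^ 2 ≤ ‖ψ‖ ^ 2 := hlow
      _ ≤ (‖R‖ * ‖g‖) ^ 2 := pow_le_pow_left₀ (norm_nonneg _) h1 2
      _ = ‖R‖ ^ 2 * ‖g‖ ^ 2 := mul_pow _ _ _
      _ ≤ _ := mul_le_mul_of_nonneg_left hgn (by positivity)
  obtain ⟨n, hn⟩ := exists_nat_gt (‖R‖ ^ 2 * (12 * C ^ 2) / v x₀ ^ 2)
  rw [div_lt_iff₀ (by positivity)] at hn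
  exact absurd (key n) (not_le.2 hn)

/-- The spectrum of the symmetrized transition operator. -/
theorem spectrum_symmL (K : Coin) {l0 l1 : ℝ} (h0 : 0 ≤ l0) (h1 : 0 ≤ l1)
    (e0 : l0 ^ 2 = 1 - (K.sp * K.tm + K.sm * K.tp) ^ 2)
    (e1 : l1 ^ 2 = 1 - (K.sp * K.tm - K.sm * K.tp) ^ 2) :
    spectrum ℂ (symmL K) =
      (fun x : ℝ => (x : ℂ)) '' (Set.Icc (-l1) (-l0) ∪ {0} ∪ Set.Icc l0 l1) := by
  have hs := K.sq_s
  have ht := K.sq_t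
  set A := K.s0 ^ 2 + K.sp ^ 2 * K.tp ^ 2 + K.sm ^ 2 * K.tm ^ 2 with hA
  set B := K.sp * K.tp * (K.sm * K.tm) with hB
  have hB0 : 0 < B := by
    have := K.sp_pos; have := K.sm_pos; have := K.tp_pos; have := K.tm_pos
    positivity
  have f0 : l0 ^ 2 = A - 2 * B := by
    rw [e0, hA, hB]; linear_combination (-1) * hs + (-K.sp ^ 2 - K.sm ^ 2) * ht
  have f1 : l1 ^ 2 = A + 2 * B := by
    rw [e1, hA, hB]; linear_combination (-1) * hs + (-K.sp ^ 2 - K.sm ^ 2) * ht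
  ext z
  constructor
  · intro hz
    by_cases hz0 : z = 0
    · exact ⟨0, Or.inl (Or.inr rfl), by simp [hz0]⟩
    have hex : ∃ x : ℝ, |x| ≤ 2 ∧ z ^ 2 = ((A + B * x : ℝ) : ℂ) := by
      by_contra! hn
      exact hz (isUnit_sub_symmL K hz0 hn)
    obtain ⟨x, hx, hzx⟩ := hex
    obtain ⟨hx1, hx2⟩ := abs_le.1 hx
    have hlo : l0 ^ 2 ≤ A + B * x := by rw [f0]; nlinarith
    have hhi : A + B * x ≤ l1 ^ 2 := by rw [f1]; nlinarith
    have hm : 0 ≤ A + B * x := (sq_nonneg l0).trans hlo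
    set y := √(A + B * x) with hy
    have hy0 : l0 ≤ y := Real.le_sqrt_of_sq_le hlo
    have hy1 : y ≤ l1 := Real.sqrt_le_iff.2 ⟨h1, hhi⟩
    rw [← Real.sq_sqrt hm, ← hy, Complex.ofReal_pow, sq_eq_sq_iff_eq_or_eq_neg] at hzx
    rcases hzx with rfl | rfl
    · exact ⟨y, Or.inr ⟨hy0, hy1⟩, rfl⟩
    · exact ⟨-y, Or.inl (Or.inl ⟨by linarith, by linarith⟩), by simp⟩
  · have main : ∀ y : ℝ, y ≠ 0 → l0 ≤ |y| → |y| ≤ l1 → (y : ℂ) ∈ spectrum ℂ (symmL K) := by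
      intro y hy hy0 hy1
      have g0 : l0 ^ 2 ≤ y ^ 2 := by rw [← sq_abs y]; exact pow_le_pow_left₀ h0 hy0 2
      have g1 : y ^ 2 ≤ l1 ^ 2 := by
        rw [← sq_abs y]; exact pow_le_pow_left₀ (abs_nonneg _) hy1 2
      -- The wave number θ solves y² = A + 2B cos θ; y ≠ 0 ensures that the wave does not vanish on
      -- S.
      set θ := Real.arccos ((y ^ 2 - A) / (2 * B)) with hθ
      have hcos : y ^ 2 = A + 2 * B * Real.cos θ := by
        rw [hθ, Real.cos_arccos]
        · field_simp; ring
        · rw [le_div_iff₀ (by positivity)]; linarith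
        · rw [div_le_iff₀ (by positivity)]; linarith
      set w : ℂ := Complex.exp (θ * Complex.I) with hw
      have hw0 : w ≠ 0 := Complex.exp_ne_zero _
      have hwn : ‖w‖ = 1 := Complex.norm_exp_ofReal_mul_I θ
      have hww : w + w⁻¹ = 2 * (Real.cos θ : ℂ) := by
        rw [hw, ← Complex.exp_neg, Complex.ofReal_cos, Complex.cos, neg_mul]
        ring
      have hc2 : (y : ℂ) ^ 2 = K.s0 ^ 2 + K.sp ^ 2 * K.tp ^ 2 + K.sm ^ 2 * K.tm ^ 2
          + K.sp * K.tp * (K.sm * K.tm) * (w + w⁻¹) := by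
        rw [hww]
        have : (y : ℂ) ^ 2 = ((A + 2 * B * Real.cos θ : ℝ) : ℂ) := by rw [← hcos]; push_cast; rfl
        rw [this, hA, hB]
        push_cast
        ring
      refine mem_spectrum_of_plane_wave K
        (fun u => w ^ u.1 * match u.2 with
          | .S => (y : ℂ)
          | .R => K.s0
          | .T => K.sp * K.tp + K.sm * K.tm * w)
        ?_ (v := fun x => match x with
          | .S => |y|
          | .R => |K.s0|
          | .T => ‖(K.sp * K.tp + K.sm * K.tm * w : ℂ)‖) ?_ (x₀ := .S) (abs_pos.2 hy)
      · ext ⟨j, x⟩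
        cases x
        · simp only [symm, Pi.smul_apply, smul_eq_mul]; ring
        · simp only [symm, Pi.smul_apply, smul_eq_mul, zpow_sub_one₀ hw0]
          have : w⁻¹ * w = 1 := inv_mul_cancel₀ hw0
          linear_combination (-w ^ j) * hc2 + w ^ j * K.sm ^ 2 * K.tm ^ 2 * this
        · simp only [symm, Pi.smul_apply, smul_eq_mul, zpow_add_one₀ hw0]; ring
      · intro j x
        rw [norm_mul, norm_zpow, hwn, one_zpow, one_mul]
        cases x <;> simp
    -- The kernel contains a bounded function that vanishes on S, with values on R and T balanced so
    -- that they cancel at S. Its value on R is nonzero even for r = 1.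
    have zero : ((0 : ℝ) : ℂ) ∈ spectrum ℂ (symmL K) := by
      have hpos : 0 < K.sp * K.tp + K.sm * K.tm := by
        have := K.sp_pos; have := K.sm_pos; have := K.tp_pos; have := K.tm_pos
        positivity
      refine mem_spectrum_of_plane_wave K
        (fun u => match u.2 with
          | .S => 0
          | .R => ((K.sp * K.tp + K.sm * K.tm : ℝ) : ℂ)
          | .T => -(K.s0 : ℂ))
        ?_ (v := fun x => match x with
          | .S => 0
          | .R => |K.sp * K.tp + K.sm * K.tm|
          | .T => |K.s0|) ?_ (x₀ := .R) (abs_pos.2 hpos.ne')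
      · ext ⟨j, x⟩
        cases x <;> simp [symm]
        ring
      · intro j x
        cases x
        · exact Complex.norm_real _
        all_goals simp
    rintro ⟨y, hy, rfl⟩
    rcases eq_or_ne y 0 with rfl | hy0
    · exact zero
    rcases hy with (⟨h2, h3⟩ | rfl) | ⟨h2, h3⟩
    · have : |y| = -y := abs_of_nonpos (by linarith)
      exact main y hy0 (by linarith) (by linarith)
    · exact zero
    · have : |y| = y := abs_of_nonneg (by linarith)
      exact main y hy0 (by linarith) (by linarith)

/-! ### Recurrence of the random walk -/

/-- The transition operator of the random walk, in coordinates. -/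
def transition (p q r : ℝ) (f : Vert → ℝ) : Vert → ℝ
  | (j, .S) => (1 - r) * f (j, .R) + r * p * f (j, .T) + r * (1 - p) * f (j - 1, .T)
  | (j, .R) => f (j, .S)
  | (j, .T) => q * f (j, .S) + (1 - q) * f (j + 1, .S)

/-- The probability that the random walk from `u` does not visit `v` at the times `0, …, n`. -/
def missProb (p q r : ℝ) (v : Vert) (n : ℕ) : Vert → ℝ :=
  Function.update (avoidProb p q r v n) v 0

/-- Setting the values at v to zero replaces the restricted sum over arcs avoiding v by the full
transition operator. -/
theorem avoidProb_succ (p q r : ℝ) (v : Vert) (n : ℕ) (u : Vert) :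
    avoidProb p q r v (n + 1) u = transition p q r (missProb p q r v n) u := by
  have h : avoidProb p q r v (n + 1) u =
      ∑ e ∈ outArcs u, prob p q r e * missProb p q r v n (ter e) := by
    rw [avoidProb, Finset.sum_filter]
    refine Finset.sum_congr rfl fun e _ => ?_
    by_cases he : ter e = v <;> simp [missProb, he]
  obtain ⟨j, x⟩ := u
  rw [h]
  cases x
  · simp [outArcs_R, transition, prob, ter]
  · simp [outArcs_S, transition, prob, ter]
    ring
  · simp [outArcs_T, transition, prob, ter]

section
variable {p q r : ℝ} (hp : p ∈ Set.Ioo (0 : ℝ) 1) (hq : q ∈ Set.Ioo (0 : ℝ) 1)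
  (hr : r ∈ Set.Ioc (0 : ℝ) 1)
include hp hq hr

theorem transition_mono {f g : Vert → ℝ} (h : ∀ u, f u ≤ g u) (u : Vert) :
    transition p q r f u ≤ transition p q r g u := by
  have h0 : 0 ≤ 1 - r := by linarith [hr.2]
  have h1 : 0 ≤ r * p := mul_nonneg hr.1.le hp.1.le
  have h2 : 0 ≤ r * (1 - p) := mul_nonneg hr.1.le (by linarith [hp.2])
  have h4 : 0 ≤ 1 - q := by linarith [hq.2]
  obtain ⟨j, x⟩ := u
  cases x
  · exact h _
  · exact add_le_add (add_le_add (mul_le_mul_of_nonneg_left (h _) h0)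
      (mul_le_mul_of_nonneg_left (h _) h1)) (mul_le_mul_of_nonneg_left (h _) h2)
  · exact add_le_add (mul_le_mul_of_nonneg_left (h _) hq.1.le)
      (mul_le_mul_of_nonneg_left (h _) h4)

omit hp hq hr in
theorem transition_const (c : ℝ) (u : Vert) : transition p q r (fun _ => c) u = c := by
  obtain ⟨j, x⟩ := u
  cases x <;> simp only [transition] <;> ring

/-- A subharmonic function bounded by `1` that vanishes at `v` bounds the probability to miss `v`
from below. -/
theorem le_missProb {v : Vert} {g : Vert → ℝ} (h1 : ∀ u, g u ≤ 1) (h0 : g v = 0)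
    (hg : ∀ u, g u ≤ transition p q r g u) (n : ℕ) (u : Vert) :
    g u ≤ missProb p q r v n u := by
  induction n generalizing u with
  | zero =>
    rcases eq_or_ne u v with rfl | hu
    · simp [missProb, h0]
    · simpa [missProb, hu, avoidProb] using h1 u
  | succ n ih =>
    rcases eq_or_ne u v with rfl | hu
    · simp [missProb, h0]
    · rw [missProb, Function.update_of_ne hu, avoidProb_succ]
      exact (hg u).trans (transition_mono hp hq hr ih u)

/-- Seen on the vertices S, the walk is a biased walk on ℤ for which ρ^j is harmonic. The positive
part of 1 - ρ^j is bounded, subharmonic, zero at the origin, and positive on one side of it since ρ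
≠ 1; it bounds the escape probability from below. -/
theorem not_recurrent_of_ne (hpq : p ≠ q) : ¬Recurrent p q r := by
  have ha : 0 < p * (1 - q) := mul_pos hp.1 (by linarith [hq.2])
  have hb : 0 < (1 - p) * q := mul_pos (by linarith [hp.2]) hq.1
  set ρ := (1 - p) * q / (p * (1 - q)) with hρ
  have hρ0 : 0 < ρ := div_pos hb ha
  have hρa : p * (1 - q) * ρ = (1 - p) * q := mul_div_cancel₀ _ ha.ne'
  have hρ1 : ρ ≠ 1 := fun h => hpq (by rw [h] at hρa; linarith)
  set s : ℤ → ℝ := fun j => max 0 (1 - ρ ^ j) with hs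
  have hsub : ∀ j, (p * (1 - q) + (1 - p) * q) * s j ≤
      p * (1 - q) * s (j + 1) + (1 - p) * q * s (j - 1) := by
    intro j
    have hpos : ∀ i, 0 ≤ s i := fun i => le_max_left _ _
    have hge : ∀ i, 1 - ρ ^ i ≤ s i := fun i => le_max_right _ _
    rw [← mul_max_of_nonneg _ _ (by positivity : 0 ≤ p * (1 - q) + (1 - p) * q) |>.symm]
    refine max_le ?_ ?_
    · rw [mul_zero]
      exact add_nonneg (mul_nonneg ha.le (hpos _)) (mul_nonneg hb.le (hpos _))
    · refine le_trans (le_of_eq ?_) (add_le_add (mul_le_mul_of_nonneg_left (hge (j + 1)) ha.le)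
        (mul_le_mul_of_nonneg_left (hge (j - 1)) hb.le))
      rw [zpow_add_one₀ hρ0.ne', zpow_sub_one₀ hρ0.ne', ← hρa]
      field_simp
      ring
  set g : Vert → ℝ := fun u => match u.2 with
    | .S => s u.1
    | .R => s u.1
    | .T => q * s u.1 + (1 - q) * s (u.1 + 1) with hg
  have hs1 : ∀ j, s j ≤ 1 := fun j => max_le zero_le_one (by linarith [zpow_pos hρ0 j])
  have hs0 : s 0 = 0 := by simp [hs]
  have hg0 : g (0, .S) = 0 := hs0
  have hg1 : ∀ u, g u ≤ 1 := by
    rintro ⟨j, x⟩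
    cases x
    · exact hs1 j
    · exact hs1 j
    · have h4 : 0 ≤ 1 - q := by linarith [hq.2]
      calc q * s j + (1 - q) * s (j + 1) ≤ q * 1 + (1 - q) * 1 :=
            add_le_add (mul_le_mul_of_nonneg_left (hs1 _) hq.1.le)
              (mul_le_mul_of_nonneg_left (hs1 _) h4)
        _ = 1 := by ring
  have hval : ∀ j, transition p q r g (j, .S) = (1 - r * (p * (1 - q) + (1 - p) * q)) * s j
      + r * (p * (1 - q) * s (j + 1) + (1 - p) * q * s (j - 1)) := by
    intro j
    simp only [transition, hg, sub_add_cancel]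
    ring
  have hgs : ∀ u, g u ≤ transition p q r g u := by
    rintro ⟨j, x⟩
    cases x
    · exact le_rfl
    · rw [hval]
      have := mul_le_mul_of_nonneg_left (hsub j) hr.1.le
      change s j ≤ _
      linarith
    · exact le_rfl
  have hpos : 0 < transition p q r g (0, .S) := by
    rw [hval, hs0, mul_zero, zero_add]
    refine mul_pos hr.1 ?_
    rcases hρ1.lt_or_gt with h | h
    · refine add_pos_of_pos_of_nonneg (mul_pos ha ?_) (mul_nonneg hb.le (le_max_left _ _))
      exact lt_max_of_lt_right (by simpa using h)
    · refine add_pos_of_nonneg_of_pos (mul_nonneg ha.le (le_max_left _ _)) (mul_pos hb ?_)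
      refine lt_max_of_lt_right ?_
      simpa using inv_lt_one_of_one_lt₀ h
  intro hrec
  have hlim := (tendsto_add_atTop_iff_nat 1).2 (hrec (0, .S))
  refine absurd (ge_of_tendsto' hlim (b := transition p q r g (0, .S)) fun n => ?_) (not_le.2 hpos)
  rw [avoidProb_succ]
  have hmiss := le_missProb (v := ((0 : ℤ), V0.S)) hp hq hr hg1 hg0 hgs n
  exact transition_mono hp hq hr hmiss _

end

/-! ### Bounded convex sequences and the driftless walk -/

/-- A positive increment of a convex sequence persists to the right and forces linear growth. -/
theorem le_of_convex_of_bounded {s : ℤ → ℝ} (hc : ∀ j, 2 * s j ≤ s (j + 1) + s (j - 1))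
    (hb : ∀ j, s j ≤ 1) (j : ℤ) : s (j + 1) ≤ s j := by
  by_contra! hlt
  have h1 : ∀ n : ℕ, s (j + 1) - s j ≤ s (j + n + 1) - s (j + n) := by
    intro n
    induction n with
    | zero => simp
    | succ n ih =>
      have := hc (j + n + 1)
      rw [add_sub_cancel_right] at this
      push_cast
      rw [← add_assoc]
      linarith
  have h2 : ∀ n : ℕ, s j + n * (s (j + 1) - s j) ≤ s (j + n) := by
    intro n
    induction n with
    | zero => simp
    | succ n ih =>
      have := h1 n
      push_cast
      rw [← add_assoc]
      linarith
  obtain ⟨n, hn⟩ := exists_nat_gt ((1 - s j) / (s (j + 1) - s j))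
  rw [div_lt_iff₀ (by linarith)] at hn
  linarith [h2 n, hb (j + n)]

theorem const_of_convex_of_bounded {s : ℤ → ℝ} (hc : ∀ j, 2 * s j ≤ s (j + 1) + s (j - 1))
    (hb : ∀ j, s j ≤ 1) (j : ℤ) : s j = s 0 := by
  have hd : ∀ j, s (j + 1) = s j := by
    intro j
    refine le_antisymm (le_of_convex_of_bounded hc hb j) ?_
    -- The opposite inequality is the same statement for the reflected sequence.
    have := le_of_convex_of_bounded (s := fun i => s (-i)) (fun i => ?_) (fun i => hb _) (-j - 1)
    · simpa [add_comm] using this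
    · have := hc (-i)
      rw [neg_add', neg_sub']
      rw [sub_neg_eq_add]
      linarith
  induction j using Int.induction_on with
  | zero => rfl
  | succ n ih => rw [hd, ih]
  | pred n ih => rw [← ih, ← hd (-n - 1), sub_add_cancel]

section
variable {p r : ℝ} (hp : p ∈ Set.Ioo (0 : ℝ) 1) (hr : r ∈ Set.Ioo (0 : ℝ) 1)
include hp hr

/-- A bounded nonnegative subharmonic function of the driftless walk which vanishes at some vertex
is zero. -/
theorem subharmonic_eq_zero {h : Vert → ℝ} (h0 : ∀ u, 0 ≤ h u) (h1 : ∀ u, h u ≤ 1)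
    (hs : ∀ u, h u ≤ transition p p r h u) {v : Vert} (hv : h v = 0) (u : Vert) : h u = 0 := by
  have hr1 : 0 < 1 - r := by linarith [hr.2]
  have hp1 : 0 < 1 - p := by linarith [hp.2]
  have hrp : 0 < r * p := mul_pos hr.1 hp.1
  have hrp1 : 0 < r * (1 - p) := mul_pos hr.1 hp1
  have eT : ∀ j, h (j, .T) ≤ p * h (j, .S) + (1 - p) * h (j + 1, .S) := fun j => hs (j, .T)
  have eR : ∀ j, h (j, .R) ≤ h (j, .S) := fun j => hs (j, .R)
  have eS : ∀ j, h (j, .S) ≤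
      (1 - r) * h (j, .R) + r * p * h (j, .T) + r * (1 - p) * h (j - 1, .T) := fun j => hs (j, .S)
  -- Eliminating R and T from the inequality at S gives both neighbours the same weight r p (1 - p),
  -- so h restricted to S is a bounded convex sequence.
  have hconst : ∀ j, h (j, .S) = h (0, .S) := by
    refine const_of_convex_of_bounded (s := fun j => h (j, .S)) (fun j => ?_) fun j => h1 _
    have t1 := mul_le_mul_of_nonneg_left (eT j) hrp.le
    have t2 := mul_le_mul_of_nonneg_left (eT (j - 1)) hrp1.le
    have t3 := mul_le_mul_of_nonneg_left (eR j) hr1.le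
    rw [sub_add_cancel] at t2
    refine le_of_mul_le_mul_left ?_ (mul_pos hrp hp1)
    linarith [eS j]
  set c := h (0, .S) with hc
  have hT : ∀ j, h (j, .T) ≤ c := fun j => by
    have := eT j
    rw [hconst, hconst (j + 1)] at this
    linarith
  have hR : ∀ j, h (j, .R) ≤ c := fun j => (eR j).trans_eq (hconst j)
  -- All values are at most c, and at S the average is at least c with positive weights, so a zero
  -- at a neighbour of S pulls c down to zero.
  have hc0 : c ≤ 0 := by
    obtain ⟨j, x⟩ := v
    have t := eS j
    have t1 := mul_le_mul_of_nonneg_left (hT j) hrp.le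
    have t2 := mul_le_mul_of_nonneg_left (hT (j - 1)) hrp1.le
    have t3 := mul_le_mul_of_nonneg_left (hR j) hr1.le
    rw [hconst] at t
    cases x
    · rw [hv] at t
      exact nonpos_of_mul_nonpos_right (by linarith : (1 - r) * c ≤ 0) hr1
    · rw [← hconst j, hv]
    · rw [hv] at t
      exact nonpos_of_mul_nonpos_right (by linarith : r * p * c ≤ 0) hrp
  refine le_antisymm ?_ (h0 u)
  obtain ⟨j, x⟩ := u
  cases x
  · exact (hR j).trans hc0
  · exact (hconst j).trans_le hc0
  · exact (hT j).trans hc0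

/-- The avoidance probabilities decrease to a limit a. Set to zero at v, it becomes a bounded
nonnegative subharmonic function vanishing at v, hence zero; and a(v) is its image under the
transition operator. -/
theorem recurrent_of_eq : Recurrent p p r := by
  have hr' : r ∈ Set.Ioc (0 : ℝ) 1 := ⟨hr.1, hr.2.le⟩
  intro v
  have hbound : ∀ n u, 0 ≤ avoidProb p p r v n u ∧ avoidProb p p r v n u ≤ 1 ∧
      avoidProb p p r v (n + 1) u ≤ avoidProb p p r v n u := by
    have hupd : ∀ {f g : Vert → ℝ}, (∀ u, f u ≤ g u) →
        ∀ u, Function.update f v 0 u ≤ Function.update g v 0 u := by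
      intro f g h u
      rcases eq_or_ne u v with rfl | hu
      · simp
      · simpa [hu] using h u
    have hz : Function.update (fun _ : Vert => (0 : ℝ)) v 0 = fun _ => 0 := by ext; simp
    have hone : ∀ u, Function.update (fun _ : Vert => (1 : ℝ)) v 0 u ≤ 1 := by
      intro u
      rcases eq_or_ne u v with rfl | hu
      · simp
      · simp [hu]
    intro n
    induction n with
    | zero =>
      refine fun u => ⟨zero_le_one, le_rfl, ?_⟩
      rw [avoidProb_succ]
      exact (transition_mono hp hp hr' hone u).trans_eq (transition_const 1 u)
    | succ n ih =>
      refine fun u => ⟨?_, ((ih u).2.2).trans (ih u).2.1, ?_⟩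
      · rw [avoidProb_succ, ← transition_const (p := p) (q := p) (r := r) 0 u, ← hz]
        exact transition_mono hp hp hr' (hupd fun u => (ih u).1) u
      · rw [avoidProb_succ, avoidProb_succ p p r v n]
        exact transition_mono hp hp hr' (hupd fun u => (ih u).2.2) u
  have hlim : ∀ u, ∃ a, Tendsto (fun n => avoidProb p p r v n u) atTop (𝓝 a) := fun u =>
    ⟨_, tendsto_atTop_ciInf (antitone_nat_of_succ_le fun n => (hbound n u).2.2)
      ⟨0, by rintro _ ⟨n, rfl⟩; exact (hbound n u).1⟩⟩
  choose a ha using hlim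
  set h := Function.update a v 0 with hh
  have hmiss : ∀ u, Tendsto (fun n => missProb p p r v n u) atTop (𝓝 (h u)) := by
    intro u
    rcases eq_or_ne u v with rfl | hu
    · simp [missProb, hh]
    · simpa [missProb, hh, hu] using ha u
  have htrans : ∀ u, a u = transition p p r h u := by
    intro u
    refine tendsto_nhds_unique ((tendsto_add_atTop_iff_nat 1).2 (ha u)) ?_
    simp only [avoidProb_succ]
    obtain ⟨j, x⟩ := u
    cases x
    · exact hmiss _
    · exact (((hmiss _).const_mul _).add ((hmiss _).const_mul _)).add ((hmiss _).const_mul _)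
    · exact ((hmiss _).const_mul _).add ((hmiss _).const_mul _)
  have ha0 : ∀ u, 0 ≤ a u := fun u => ge_of_tendsto' (ha u) fun n => (hbound n u).1
  have ha1 : ∀ u, a u ≤ 1 := fun u => le_of_tendsto' (ha u) fun n => (hbound n u).2.1
  have hle : ∀ u, h u ≤ a u := by
    intro u
    rcases eq_or_ne u v with rfl | hu
    · simpa [hh] using ha0 u
    · simp [hh, hu]
  have hzero : ∀ u, h u = 0 := by
    refine subharmonic_eq_zero hp hr (fun u => ?_) (fun u => (hle u).trans (ha1 u))
      (fun u => (hle u).trans_eq (htrans u)) (v := v) (by simp [hh])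
    rcases eq_or_ne u v with rfl | hu
    · simp [hh]
    · simpa [hh, hu] using ha0 u
  have : a v = 0 := by
    rw [htrans, funext hzero, transition_const]
  exact this ▸ ha v

end

theorem lam1_eq_one_iff {p q r : ℝ} (hp : p ∈ Set.Ioo (0 : ℝ) 1) (hq : q ∈ Set.Ioo (0 : ℝ) 1)
    (hr : 0 < r) : lam1 p q r = 1 ↔ p = q := by
  have ha : 0 ≤ p * (1 - q) := mul_nonneg hp.1.le (by linarith [hq.2])
  have hb : 0 ≤ (1 - p) * q := mul_nonneg (by linarith [hp.2]) hq.1.le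
  rw [lam1, Real.sqrt_eq_one, sub_eq_self, mul_eq_zero, or_iff_right hr.ne', sq_eq_zero_iff,
    sub_eq_zero, Real.sqrt_inj ha hb]
  constructor <;> intro h <;> linarith

theorem recurrent_iff {p q r : ℝ} (hp : p ∈ Set.Ioo (0 : ℝ) 1) (hq : q ∈ Set.Ioo (0 : ℝ) 1)
    (hr : r ∈ Set.Ioo (0 : ℝ) 1) : Recurrent p q r ↔ lam1 p q r = 1 := by
  rw [lam1_eq_one_iff hp hq hr.1]
  constructor
  · intro h
    by_contra hpq
    exact not_recurrent_of_ne hp hq ⟨hr.1, hr.2.le⟩ hpq h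
  · rintro rfl
    exact recurrent_of_eq hp hr

/-! ### The main theorem -/

/-- Here λ₀² = s0² + (sp tp - sm tm)², and r < 1 makes s0 positive. -/
theorem lam0_pos {p q r : ℝ} (hp : p ∈ Set.Ioo (0 : ℝ) 1) (hq : q ∈ Set.Ioo (0 : ℝ) 1)
    (hr : r ∈ Set.Ioo (0 : ℝ) 1) : 0 < lam0 p q r := by
  have hr' : r ∈ Set.Ioc (0 : ℝ) 1 := ⟨hr.1, hr.2.le⟩
  obtain ⟨h, h0⟩ := lam0_sq_eq hp hq hr'
  refine lt_of_le_of_ne h0 fun h1 => ?_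
  have hs := (coin hp hq hr').sq_s
  have ht := (coin hp hq hr').sq_t
  have hs0 : 0 < (coin hp hq hr').s0 := Real.sqrt_pos.2 (by linarith [hr.2])
  rw [← h1] at h
  have e : (0 : ℝ) = (coin hp hq hr').s0 ^ 2
      + ((coin hp hq hr').sp * (coin hp hq hr').tp - (coin hp hq hr').sm * (coin hp hq hr').tm) ^ 2 := by
    linear_combination h - hs - ((coin hp hq hr').sp ^ 2 + (coin hp hq hr').sm ^ 2) * ht
  have := sq_nonneg ((coin hp hq hr').sp * (coin hp hq hr').tp
    - (coin hp hq hr').sm * (coin hp hq hr').tm)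
  linarith [pow_pos hs0 2]

/-- At x = 0 the root of φ is rational in the λ's, so the value of γ at this single point already
decides whether λ₁ = 1. -/
theorem HasEdges.gammaFun_zero_sq {K : Coin} {l0 l1 α β : ℝ} (H : HasEdges K l0 l1 α β)
    (s : ℝ) (hl : l0 < l1) (hl1 : l1 ≤ 1) (hs : s = 1 ∨ s = -1) :
    gammaFun s 0 l1 l0 ^ 2 = (1 - l0 ^ 2) * (l0 ^ 2 * ((1 - l0 ^ 2) + s * (l1 ^ 2 - l0 ^ 2))
      + (1 - l1 ^ 2) * (l1 ^ 2 - s * (l1 ^ 2 - l0 ^ 2))) / (2 * (l1 ^ 2 - l0 ^ 2) ^ 2 * l0 ^ 2) := by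
  have h0 := H.l0_pos
  have hD : 0 < l1 ^ 2 - l0 ^ 2 := by nlinarith
  have hu : 0 ≤ 1 - l0 ^ 2 := by nlinarith
  have hv : 0 ≤ 1 - l1 ^ 2 := by nlinarith
  have hsq : √(phiFun l1 l0 0) = l1 ^ 2 - l0 ^ 2 := by
    rw [← Real.sqrt_sq hD.le]; congr 1; simp [phiFun]
  rw [H.gammaFun_eq (by simpa using pow_pos H.sin_pos 2), zetaFun, hsq, Real.sq_sqrt]
  · simp only [phiFun, uFun]; ring_nf
  · simp only [phiFun, uFun]
    refine div_nonneg (mul_nonneg (by simpa using hu) (add_nonneg ?_ (mul_nonneg hv ?_)))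
      (by norm_num; positivity)
    · rcases hs with rfl | rfl
      · exact mul_nonneg (by positivity) (by nlinarith)
      · exact mul_nonneg (by positivity) (by nlinarith)
    · rcases hs with rfl | rfl <;> norm_num <;> nlinarith

theorem tfae_recurrent {p q r : ℝ} (hp : p ∈ Set.Ioo (0 : ℝ) 1) (hq : q ∈ Set.Ioo (0 : ℝ) 1)
    (hr : r ∈ Set.Ioo (0 : ℝ) 1) : List.TFAE [Recurrent p q r, lam1 p q r = 1,
      ∀ x : ℝ, |x| < kappa p q r → gammaFun (-1) x (lam1 p q r) (lam0 p q r) = 0,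
      ∀ x : ℝ, |x| < kappa p q r → gammaFun 1 x (lam1 p q r) (lam0 p q r) = 1] := by
  have hr' : r ∈ Set.Ioc (0 : ℝ) 1 := ⟨hr.1, hr.2.le⟩
  have h0 := lam0_pos hp hq hr
  have H := hasEdges_coin hp hq hr' h0
  have hl := lam0_lt_lam1 hp hq hr'
  have hl1 := lam1_le_one hp hq hr'
  have hκ : |(0 : ℝ)| < kappa p q r := by
    rw [abs_zero]
    exact mul_pos one_half_pos H.sin_pos
  have hD : 0 < lam1 p q r ^ 2 - lam0 p q r ^ 2 := by nlinarith
  have hu : 0 < 1 - lam0 p q r ^ 2 := by nlinarith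
  tfae_have 1 ↔ 2 := recurrent_iff hp hq hr
  tfae_have 2 → 3 := fun h x _ => by rw [h, gammaFun_neg_one_of_eq_one]
  tfae_have 2 → 4 := fun h x _ => by rw [h, gammaFun_one_of_eq_one]
  tfae_have 3 → 2 := by
    intro h
    have h1 := H.gammaFun_zero_sq (-1) hl hl1 (.inr rfl)
    rw [h 0 hκ, zero_pow two_ne_zero, eq_comm, div_eq_zero_iff, or_iff_left (by positivity),
      mul_eq_zero, or_iff_right hu.ne'] at h1
    have h2 : (2 * lam1 p q r ^ 2) * (1 - lam1 p q r ^ 2) = 0 := by linear_combination h1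
    rw [mul_eq_zero, or_iff_right (by nlinarith), sub_eq_zero, eq_comm] at h2
    exact (pow_eq_one_iff_of_nonneg (by linarith) two_ne_zero).1 h2
  tfae_have 4 → 2 := by
    intro h
    have h1 := H.gammaFun_zero_sq 1 hl hl1 (.inl rfl)
    rw [h 0 hκ, one_pow, eq_comm, div_eq_one_iff_eq (by positivity)] at h1
    have h2 : (1 - lam0 p q r ^ 2) ^ 2 = (lam1 p q r ^ 2 - lam0 p q r ^ 2) ^ 2 := by
      refine mul_left_cancel₀ (by positivity : 2 * lam0 p q r ^ 2 ≠ 0) ?_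
      linear_combination h1
    have h3 := (sq_eq_sq₀ hu.le hD.le).1 h2
    exact (pow_eq_one_iff_of_nonneg (by linarith) two_ne_zero).1 (by linarith)
  tfae_finish

/-- The only atom is at 0, so for y ≠ 0 the half-line below y is a continuity set. -/
theorem limitLaw_singleton (p q r : ℝ) {y : ℝ} (hy : y ≠ 0) : limitLaw p q r {y} = 0 := by
  rw [limitLaw, Measure.add_apply, Measure.smul_apply,
    withDensity_absolutelyContinuous _ _ (measure_singleton y)]
  simp [hy.symm]

/-- Two steps move a nonzero amplitude to the next cell. This provides a state outside the localized
subspace, for the lower bound over all states. -/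
theorem step_step_single_ne (K : Coin) :
    step K (step K (Pi.single ((0, .ep) : Arc) 1)) ≠ -Pi.single ((0, .ep) : Arc) 1 := by
  intro h
  have h1 := congrFun h (1, .ep)
  have := K.sp_pos; have := K.sm_pos; have := K.tp_pos; have := K.tm_pos
  have h2 : (2 * K.sp * (K.sm * (2 * K.tm * K.tp)) : ℂ) = 0 := by
    simpa [step, Pi.single_apply] using h1
  have h3 : (2 * K.sp * (K.sm * (2 * K.tm * K.tp)) : ℝ) = 0 := by exact_mod_cast h2
  exact (by positivity : (2 * K.sp * (K.sm * (2 * K.tm * K.tp)) : ℝ) ≠ 0) h3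

theorem findProb_eq {p q r : ℝ} (hp : p ∈ Set.Ioo (0 : ℝ) 1) (hq : q ∈ Set.Ioo (0 : ℝ) 1)
    (hr : r ∈ Set.Ioc (0 : ℝ) 1) (Ψ : Arc → ℂ) :
    findProb p q r Ψ = cellProb (coin hp hq hr) Ψ := by
  funext n j
  rw [findProb, cellProb, szegedy_eq_step hp hq hr]

theorem mixedProb_eq {p q r : ℝ} (hp : p ∈ Set.Ioo (0 : ℝ) 1) (hq : q ∈ Set.Ioo (0 : ℝ) 1)
    (hr : r ∈ Set.Ioc (0 : ℝ) 1) : mixedProb p q r = mixedCellProb (coin hp hq hr) := by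
  funext n j
  simp only [mixedProb, mixedCellProb, findProb_eq hp hq hr]

end Magnifier
end

theorem theorem2 (p q r : ℝ) (hp : p ∈ Set.Ioo (0 : ℝ) 1) (hq : q ∈ Set.Ioo (0 : ℝ) 1)
    (hr : r ∈ Set.Ioc (0 : ℝ) 1) :
    -- `λ₀ ≤ λ₁` are the edges of the spectrum of the (symmetrized) random walk on `ℓ²`
    (∃ J : lp (fun _ : Magnifier.Vert => ℂ) 2 →L[ℂ] lp (fun _ : Magnifier.Vert => ℂ) 2,
      (∀ f, (J f : Magnifier.Vert → ℂ) = Magnifier.symmTrans p q r f) ∧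
      spectrum ℂ J = (fun x : ℝ => (x : ℂ)) ''
        (Set.Icc (-Magnifier.lam1 p q r) (-Magnifier.lam0 p q r) ∪ {0} ∪
          Set.Icc (Magnifier.lam0 p q r) (Magnifier.lam1 p q r))) ∧
    -- the laws of `X_n` are probability measures
    (∀ Ψ : lp (fun _ : Magnifier.Arc => ℂ) 2, ‖Ψ‖ = 1 →
      ∀ n, IsProbabilityMeasure (Magnifier.scaledLaw (Magnifier.findProb p q r Ψ) n)) ∧
    -- (1) over all initial states
    IsGLB {x : ℝ | ∀ Ψ : lp (fun _ : Magnifier.Arc => ℂ) 2, ‖Ψ‖ = 1 →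
        Magnifier.EventuallyWithin (Magnifier.findProb p q r Ψ) x} (Magnifier.kappa p q r) ∧
    -- (1) for each single finitely supported initial state that is not completely localized
    (∀ Ψ : lp (fun _ : Magnifier.Arc => ℂ) 2, ‖Ψ‖ = 1 →
      (Function.support (Ψ : Magnifier.Arc → ℂ)).Finite →
      Magnifier.szegedy p q r (Magnifier.szegedy p q r Ψ) ≠ -(Ψ : Magnifier.Arc → ℂ) →
      Magnifier.IsPseudoVelocity (Magnifier.findProb p q r Ψ) (Magnifier.kappa p q r)) ∧
    -- (1) for the mixed initial state
    Magnifier.IsPseudoVelocity (Magnifier.mixedProb p q r) (Magnifier.kappa p q r) ∧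
    -- (2)
    (r < 1 →
      (∃ (hn : ∀ n, IsProbabilityMeasure (Magnifier.scaledLaw (Magnifier.mixedProb p q r) n))
        (hl : IsProbabilityMeasure (Magnifier.limitLaw p q r)),
        Tendsto (β := ProbabilityMeasure ℝ)
          (fun n => ⟨Magnifier.scaledLaw (Magnifier.mixedProb p q r) n, hn n⟩) atTop
          (𝓝 ⟨Magnifier.limitLaw p q r, hl⟩)) ∧
      (∀ y : ℝ, y ≠ 0 →
        Tendsto (fun n => Magnifier.scaledLaw (Magnifier.mixedProb p q r) n (Set.Iio y)) atTop
          (𝓝 (Magnifier.limitLaw p q r (Set.Iio y)))) ∧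
      List.TFAE [Magnifier.Recurrent p q r,
        Magnifier.lam1 p q r = 1,
        ∀ x : ℝ, |x| < Magnifier.kappa p q r →
          Magnifier.gammaFun (-1) x (Magnifier.lam1 p q r) (Magnifier.lam0 p q r) = 0,
        ∀ x : ℝ, |x| < Magnifier.kappa p q r →
          Magnifier.gammaFun 1 x (Magnifier.lam1 p q r) (Magnifier.lam0 p q r) = 1]) := by

  have hH := Magnifier.hasAngles_coin hp hq hr
  set K := Magnifier.coin hp hq hr with hK
  have hκ : ∀ θ, |Magnifier.velocity K θ| ≤ Magnifier.kappa p q r := hH.abs_velocity_le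
  have hκ' : ∀ x < Magnifier.kappa p q r,
      ∃ θ ∈ Set.Ioo 0 Real.pi, x < Magnifier.velocity K θ := fun x hx => hH.exists_lt_velocity hx
  have henergy : ∀ Ψ : lp (fun _ : Magnifier.Arc => ℂ) 2, ‖Ψ‖ = 1 → Magnifier.energy Ψ = 1 :=
    fun Ψ hΨ => by rw [Magnifier.energy_lp, hΨ]; simp
  have hfind : ∀ Ψ, Magnifier.findProb p q r Ψ = Magnifier.cellProb K Ψ :=
    Magnifier.findProb_eq hp hq hr
  have hmixed : Magnifier.mixedProb p q r = Magnifier.mixedCellProb K :=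
    Magnifier.mixedProb_eq hp hq hr
  have hsingle : ∀ Ψ : lp (fun _ : Magnifier.Arc => ℂ) 2, ‖Ψ‖ = 1 →
      (Function.support (Ψ : Magnifier.Arc → ℂ)).Finite →
      Magnifier.szegedy p q r (Magnifier.szegedy p q r Ψ) ≠ -(Ψ : Magnifier.Arc → ℂ) →
      Magnifier.IsPseudoVelocity (Magnifier.findProb p q r Ψ) (Magnifier.kappa p q r) := by
    intro Ψ hΨ hfin hloc
    rw [Magnifier.szegedy_eq_step hp hq hr] at hloc
    rw [hfind]
    exact Magnifier.isPseudoVelocity_of_finite_support hκ hκ' hfin (henergy Ψ hΨ) hloc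
  refine ⟨⟨Magnifier.symmL K, fun f => ?_, ?_⟩, fun Ψ hΨ n => ?_, ⟨fun x hx => ?_, fun b hb => ?_⟩,
    hsingle, ?_, fun hr1 => ⟨?_, ?_, Magnifier.tfae_recurrent hp hq ⟨hr.1, hr1⟩⟩⟩
  · rw [Magnifier.symmL_apply, Magnifier.symmTrans_eq_symm hp hq hr]
  · have h0 := Magnifier.lam0_sq_eq hp hq hr
    have h1 := Magnifier.lam1_sq_eq hp hq hr
    exact Magnifier.spectrum_symmL K h0.2 h1.2 h0.1 h1.1
  · rw [hfind]
    exact Magnifier.isProbabilityMeasure_scaledLaw_cellProb K (henergy Ψ hΨ) n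
  -- A velocity bound valid for all states holds for this one, whose own pseudo velocity is already
  -- κ.
  · set Ψ : lp (fun _ : Magnifier.Arc => ℂ) 2 :=
      lp.single (E := fun _ : Magnifier.Arc => ℂ) 2 (0, .ep) 1
    have hcoe : (Ψ : Magnifier.Arc → ℂ) = Pi.single (0, .ep) 1 := lp.coeFn_single _ _ _
    have hΨ : ‖Ψ‖ = 1 := by
      rw [lp.norm_single (by norm_num)]; simp
    refine (hsingle Ψ hΨ ?_ ?_).1 (hx Ψ hΨ)
    · rw [hcoe]
      exact Magnifier.finite_support_single _
    · rw [Magnifier.szegedy_eq_step hp hq hr, hcoe]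
      exact Magnifier.step_step_single_ne K
  · refine le_of_forall_gt_imp_ge_of_dense fun x hx => hb fun Ψ hΨ => ?_
    rw [hfind]
    exact Magnifier.eventuallyWithin_of_lp hκ hx Ψ hΨ
  · rw [hmixed]
    exact Magnifier.isPseudoVelocity_mixedCellProb hκ hκ'
  all_goals
    have hlim := Magnifier.tendsto_probabilityMeasure
      (Magnifier.isProbabilityMeasure_scaledLaw_mixedCellProb K)
      (Magnifier.isProbabilityMeasure_waveLaw_const K) (Magnifier.tendsto_charFun_mixedCellProb K)
    have hlaw := Magnifier.limitLaw_eq_waveLaw hp hq hr (Magnifier.lam0_pos hp hq ⟨hr.1, hr1⟩)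
    rw [← hK] at hlaw
    simp only [← hlaw, ← hmixed] at hlim
  · exact ⟨_, _, hlim⟩
  · intro y hy
    refine ProbabilityMeasure.tendsto_measure_of_null_frontier_of_tendsto' hlim ?_
    rw [frontier_Iio]
    exact Magnifier.limitLaw_singleton p q r hy
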